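/- **Orbispaces.** An *orbispace structure* on a topological space $X$ consists of spaces $E_i$ ($i\in I$), discrete groups $G_i$ acting on $E_i$ by homeomorphisms, and an étale topological groupoid $\Gamma$ with space of units $\bigsqcup_i E_i$, such that (i) the restriction of $\Gamma$ to each $E_i$ is the product groupoid $G_i\times E_i$, (ii) $X$ is, as a topological space, the space of orbits of $\Gamma$, and (iii) for each $i$ the image $U_i$ of $E_i$ in $X$ is open and is the quotient space $E_i/G_i$. Write $\pi_i:E_i\to U_i$. Condition (C1): $\Gamma$ is locally connected. Condition (C2): for all $i,j$, on each connected component of the space $\Gamma_{ij}$ of arrows from $E_i$ to $E_j$ the source (resp. target) map is a homeomorphism onto a connected component of the image of $\Gamma_{ij}$ under the source (resp. target) map. The orbispace is *paracompact, locally compact and Hausdorff* if $X$ is, all $E_i$ are locally compact and Hausdorff, and all $\pi_i:E_i\to U_i$ are proper. **Local charts.** A *local chart* is a connected open set $\widehat U\subseteq E_i$ (for some $i$) which is a connected component of $\pi_i^{-1}(\pi_i(\widehat U))$; it uniformizes $U=\pi_i(\widehat U)$, and its group $G_U$ is the stabilizer of $\widehat U$ in $G_i$. For local charts $\widehat U,\widehat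 V$ let $T(U,V)$ be the set of connected components of the space of arrows from $\widehat U$ to $\widehat V$. For $\xi\in T(U,V)$ write $\varphi_\xi(x)=y$ if $\xi$ contains an arrow from $x\in\widehat U$ to $y\in\widehat V$. If $\xi$ contains an arrow $\gamma$ with source $x$ and $\eta\in T(V,W)$ contains an arrow $\delta$ composable with $\gamma$, then $\eta\circ\xi(x)\in T(U,W)$ is the class of $\delta\gamma$. Elements of $G_U$ are regarded as elements of $T(U,U)$. **Homomorphisms and maps.** Let $X,X'$ be orbispaces. A *homomorphism* $\sigma=(\{f_\alpha\},\{\rho_{\beta\alpha}\})$ consists of a set $\{\widehat U_\alpha\}$ of local charts of $X$ whose images $U_\alpha$ cover $X$, a local chart $\widehat{U'_\alpha}$ of $X'$ for each $\alpha$, continuous maps $f_\alpha:\widehat U_\alpha\to\widehat{U'_\alpha}$ and maps $\rho_{\beta\alpha}:T(U_\alpha,U_\beta)\to T(U'_\alpha,U'_\beta)$ such that $\varphi_\xi(x)=y$ implies $\varphi_{\rho_{\beta\alpha}(\xi)}(f_\alpha(x))=f_\beta(y)$, and $\rho_{\delta\alpha}(\eta\circ\xi(x))=\rho_{\delta\beta}(\eta)\circ\rho_{\beta\alpha}(\xi)\,(f_\alpha(x))$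 whenever the left side is defined. A homomorphism $(\{g_a\},\{\rho_{ba}\})$ is *induced* by $(\{f_\alpha\},\{\rho_{\beta\alpha}\})$ via data $(\theta,\{\xi_a\},\{\xi'_a\})$, where $\theta$ maps the indices $a$ to indices $\alpha$, $\xi_a\in T(U_a,U_{\theta(a)})$ with $\varphi_{\xi_a}$ defined on all of $\widehat U_a$, and $\xi'_a\in T(U'_a,U'_{\theta(a)})$, if $g_a=\varphi_{\xi'_a}^{-1}\circ f_{\theta(a)}\circ\varphi_{\xi_a}$ and $\rho_{ba}(\eta)=(\xi'_b)^{-1}\circ\rho_{\theta(b)\theta(a)}(\xi_b\circ\eta\circ\xi_a^{-1})\circ\xi'_a$. Two homomorphisms are *equivalent* if they induce a common homomorphism, and $[X;X']$ is the set of equivalence classes, called *maps of orbispaces*. **Admissible homomorphisms.** A local chart $\widehat U\subseteq E_i$ of $X$ is *admissible* if the closure $\overline U$ of $U$ in $X$ is compact and contained in $U_i$, the interior of the closure $\overline{\widehat U}$ of $\widehat U$ in $E_i$ is $\widehat U$, and $\pi_i$ maps $\overline{\widehat U}$ onto $\overline U$, two points of $\overline{\widehat U}$ having the same image only if they are related by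 an element of $G_U$. A homomorphism is *admissible* if $\{U_\alpha\}$ is a locally finite family, all $\widehat U_\alpha$ are admissible, and the homomorphism extends continuously to the closures: there are continuous extensions $F_\alpha:\overline{\widehat U_\alpha}\to\widehat{U'_\alpha}$ of the $f_\alpha$ such that for every arrow $\gamma$ from $x\in\overline{\widehat U_\alpha}$ to $y\in\overline{\widehat U_\beta}$ in the closure of the space of arrows from $\widehat U_\alpha$ to $\widehat U_\beta$ there is an arrow $\gamma'$ from $F_\alpha(x)$ to $F_\beta(y)$ such that $\rho_{\beta\alpha}$ takes the class of $\gamma'$ on the classes of all arrows from $\widehat U_\alpha$ to $\widehat U_\beta$ in some neighbourhood of $\gamma$. **Notation.** Fix a *shape* $\rho=(\{\widehat U_\alpha\},\{\widehat{U'_\alpha}\},\{\rho_{\beta\alpha}\})$ of admissible homomorphisms. Let $\mathcal O_\rho$ be the set of all $\{f_\alpha\}$ for which $(\{f_\alpha\},\{\rho_{\beta\alpha}\})$ is an admissible homomorphism. A *basic subset* of $\mathcal O_\rho$ is given by a finite family $(K_{\alpha,k},O_{\alpha,k})_k$ for each $\alpha$, with $K_{\alpha,k}\subseteq\widehat U_\alpha$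 compact and $O_{\alpha,k}\subseteq\widehat{U'_\alpha}$ open, and consists of all $\{f_\alpha\}$ with $f_\alpha(K_{\alpha,k})\subseteq O_{\alpha,k}$ for all $\alpha,k$; these sets generate the topology of $\mathcal O_\rho$. Let $G_\rho$ be the group of all families $\{g_\alpha\}$, $g_\alpha\in G_{U'_\alpha}$, such that $\rho_{\beta\alpha}(\xi)=g_\beta\circ\rho_{\beta\alpha}(\xi)\circ g_\alpha^{-1}$ for all $\xi\in T(U_\alpha,U_\beta)$ and all $\alpha,\beta$. For $\tau=\{f_a\}\in\mathcal O_{\rho_1}$ and $\sigma=\{h_\alpha\}\in\mathcal O_{\rho_2}$ let $\Gamma_{\sigma\tau}$ be the set of families $\eta$ of maps $\eta_{\alpha a}:T(U_a,U_\alpha)\to T(U'_a,U'_\alpha)$ such that $\varphi_\xi(x)=y$ implies $\varphi_{\eta_{\alpha a}(\xi)}(f_a(x))=h_\alpha(y)$, and $\eta_{\beta a}(\zeta\circ\xi(x))=\rho_{2,\beta\alpha}(\zeta)\circ\eta_{\alpha a}(\xi)\,(f_a(x))$ and $\eta_{\alpha a}(\zeta\circ\xi(x))=\eta_{\alpha b}(\zeta)\circ\rho_{1,ba}(\xi)\,(f_a(x))$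 whenever the left sides are defined. For a family $\eta$ the *sheet* of $\eta$ is the set of all $(\tau,\sigma)\in\mathcal O_{\rho_1}\times\mathcal O_{\rho_2}$ with $\eta\in\Gamma_{\sigma\tau}$, with the subspace topology. **Theorem.** Let $X$ be a paracompact, locally compact, Hausdorff orbispace and $X'$ any orbispace, both satisfying (C1) and (C2). Then: 1. Equivalence of homomorphisms is an equivalence relation, and every map of orbispaces in $[X;X']$ is represented by an admissible homomorphism. 2. For all $\rho_1,\rho_2$ and $\eta$, both projections of the sheet of $\eta$, to $\mathcal O_{\rho_1}$ and to $\mathcal O_{\rho_2}$, are homeomorphisms onto open subsets. 3. Let $\tau\in\mathcal O_{\rho_1}$, $\sigma\in\mathcal O_{\rho_2}$, let $\theta$ be a map from the charts of $\rho_1$ to the charts of $\rho_2$ and let $\xi_a\in T(U_a,U_{\theta(a)})$ with $\varphi_{\xi_a}$ defined on all of $\widehat U_a$. Then $\eta\mapsto\{\eta_{\theta(a)a}(\xi_a)\}_a$ is a bijection from $\Gamma_{\sigma\tau}$ onto the set of all $\{\xi'_a\}$ such that $\tau$ is induced by $\sigma$ via $(\theta,\{\xi_a\},\{\xi'_a\})$.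 4. Give $[X;X']$ the topology generated by the images of the basic subsets of all $\mathcal O_\rho$, and give $\Gamma^{[X;X']}=\bigsqcup\Gamma_{\sigma\tau}$ ($\sigma,\tau$ admissible) the topology of the disjoint union of all sheets. Then $\Gamma^{[X;X']}$, with the elements of $\Gamma_{\sigma\tau}$ as arrows from $\tau$ to $\sigma$ and with composition given by $(\eta_2\eta_1)(\zeta\circ\xi(x))=\eta_2(\zeta)\circ\eta_1(\xi)\,(f_a(x))$ (where $\tau=\{f_a\}$ is the source of $\eta_1$), is an étale topological groupoid with space of units $\bigsqcup_\rho\mathcal O_\rho$; its space of orbits, as a topological space, is $[X;X']$, the orbit map being the one that assigns to an admissible homomorphism its class; its restriction to $\mathcal O_\rho$ is the product groupoid $G_\rho\times\mathcal O_\rho$ for the action $\{g_\alpha\}\cdot\{f_\alpha\}=\{g_\alpha\circ f_\alpha\}$, where $(\{g_\alpha\},\{f_\alpha\})$ corresponds to $\xi\mapsto g_\beta\circ\rho_{\beta\alpha}(\xi)$; and the image of $\mathcal O_\rho$ in $[X;X']$ is open and is the quotient space $\mathcal O_\rho/G_\rho$. In particular $[X;X']$ is an orbispace with charts $\mathcal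 O_\rho$ and groups $G_\rho$. -/

import Mathlib

open Topology

/-- A topological groupoid with space of units `U` and space of arrows `A`.
`comp g f` is the composite `g ∘ f`; it is only meaningful when `src g = tgt f`. -/
structure TopGroupoid (U A : Type*) [TopologicalSpace U] [TopologicalSpace A] where
  src : A → U
  tgt : A → U
  one : U → A
  inv : A → A
  comp : A → A → A
  src_one : ∀ u, src (one u) = u
  tgt_one : ∀ u, tgt (one u) = u
  src_inv : ∀ a, src (inv a) = tgt a
  tgt_inv : ∀ a, tgt (inv a) = src a
  src_comp : ∀ g f, src g = tgt f → src (comp g f) = src f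
  tgt_comp : ∀ g f, src g = tgt f → tgt (comp g f) = tgt g
  comp_one : ∀ f, comp f (one (src f)) = f
  one_comp : ∀ f, comp (one (tgt f)) f = f
  inv_comp : ∀ f, comp (inv f) f = one (src f)
  comp_inv : ∀ f, comp f (inv f) = one (tgt f)
  assoc : ∀ h g f, src h = tgt g → src g = tgt f → comp (comp h g) f = comp h (comp g f)
  continuous_src : Continuous src
  continuous_tgt : Continuous tgt
  continuous_one : Continuous one
  continuous_inv : Continuous inv
  continuousOn_comp : ContinuousOn (fun p : A × A => comp p.1 p.2) {p | src p.1 = tgt p.2}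

/-- An étale topological groupoid: source and target are local homeomorphisms. -/
def TopGroupoid.IsEtale {U A : Type*} [TopologicalSpace U] [TopologicalSpace A]
    (Γ : TopGroupoid U A) : Prop :=
  IsLocalHomeomorph Γ.src ∧ IsLocalHomeomorph Γ.tgt

/-- An orbispace structure on the topological space `X`, given by charts `E i` with (discrete)
groups `G i`, and an étale topological groupoid with space of arrows `A` whose space of units is
the disjoint union of the charts. `act` is the action of `G i` on `E i`, `proj` is the orbit map,
and `prod i g x` is the arrow from `x` to `g x` corresponding to `(g, x)` in the product groupoid
`G i × E i`. -/
structure OrbispaceStr (X : Type*) [TopologicalSpace X] {ι : Type*}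
    (E : ι → Type*) [∀ i, TopologicalSpace (E i)] (G : ι → Type*) [∀ i, Group (G i)]
    (A : Type*) [TopologicalSpace A] extends TopGroupoid (Σ i, E i) A where
  isEtale : toTopGroupoid.IsEtale
  act : ∀ i, MulAction (G i) (E i)
  continuous_act : ∀ i (g : G i), Continuous fun x : E i => (act i).smul g x
  -- the restriction of the groupoid to each chart is the product groupoid `G i × E i`
  prod : ∀ i, G i → E i → A
  src_prod : ∀ i g x, src (prod i g x) = ⟨i, x⟩
  tgt_prod : ∀ i g x, tgt (prod i g x) = ⟨i, (act i).smul g x⟩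
  prod_one : ∀ i x, prod i 1 x = one ⟨i, x⟩
  prod_mul : ∀ i g h x, prod i (g * h) x = comp (prod i g ((act i).smul h x)) (prod i h x)
  isEmbedding_prod : ∀ i, letI : TopologicalSpace (G i) := ⊥
    IsEmbedding fun p : G i × E i => prod i p.1 p.2
  range_prod : ∀ i, Set.range (fun p : G i × E i => prod i p.1 p.2) =
    {γ | (src γ).1 = i ∧ (tgt γ).1 = i}
  -- `X` is the space of orbits of the groupoid
  proj : (Σ i, E i) → X
  isQuotientMap_proj : IsQuotientMap proj
  proj_eq_iff : ∀ u v, proj u = proj v ↔ ∃ γ, src γ = u ∧ tgt γ = v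
  -- the image of each chart is open in `X` and is the quotient of `E i` by `G i`
  isOpen_range : ∀ i, IsOpen (Set.range fun x : E i => proj ⟨i, x⟩)
  isQuotientMap_chart : ∀ i, IsQuotientMap (Set.rangeFactorization fun x : E i => proj ⟨i, x⟩)
  proj_chart_eq_iff : ∀ i (x y : E i), proj ⟨i, x⟩ = proj ⟨i, y⟩ ↔ ∃ g, (act i).smul g x = y

namespace OrbispaceStr

section Basic

variable {X : Type*} [TopologicalSpace X] {ι : Type*} {E : ι → Type*}
  [∀ i, TopologicalSpace (E i)] {G : ι → Type*} [∀ i, Group (G i)]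
  {A : Type*} [TopologicalSpace A]

/-- The map from the chart `E i` to `X`. -/
def chartProj (P : OrbispaceStr X E G A) (i : ι) (x : E i) : X := P.proj ⟨i, x⟩

/-- The set of arrows from the chart `E i` to the chart `E j`. -/
def between (P : OrbispaceStr X E G A) (i j : ι) : Set A :=
  {γ | (P.src γ).1 = i ∧ (P.tgt γ).1 = j}

/-- (C1): the groupoid is locally connected. -/
def C1 (_P : OrbispaceStr X E G A) : Prop := LocallyConnectedSpace A

/-- (C2): on every connected component of the space of arrows from one chart to another, the source
(resp. target) map is a homeomorphism onto a connected component of the image of the source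
(resp. target) map. -/
def C2 (P : OrbispaceStr X E G A) : Prop :=
  ∀ i j, ∀ γ ∈ P.between i j,
    (IsEmbedding ((connectedComponentIn (P.between i j) γ).domRestrict P.src) ∧
      P.src '' connectedComponentIn (P.between i j) γ =
        connectedComponentIn (P.src '' P.between i j) (P.src γ)) ∧
    (IsEmbedding ((connectedComponentIn (P.between i j) γ).domRestrict P.tgt) ∧
      P.tgt '' connectedComponentIn (P.between i j) γ =
        connectedComponentIn (P.tgt '' P.between i j) (P.tgt γ))

/-- The orbispace is paracompact, locally compact and Hausdorff: the underlying space is so, the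
charts are locally compact and Hausdorff, and each chart is proper over its image. -/
structure IsParacompactLocallyCompactHausdorff (P : OrbispaceStr X E G A) : Prop where
  paracompact : ParacompactSpace X
  locallyCompact : LocallyCompactSpace X
  hausdorff : T2Space X
  locallyCompact_chart : ∀ i, LocallyCompactSpace (E i)
  hausdorff_chart : ∀ i, T2Space (E i)
  proper_chart : ∀ i, IsProperMap (Set.rangeFactorization (P.chartProj i))

/-- A local chart of the maximal atlas of the orbispace with connected charts: a connected open
subset `carrier` of some `E i` which is a connected component of the inverse image in `E i` of its
own image in `X`. -/
structure LocalChart (P : OrbispaceStr X E G A) where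
  idx : ι
  carrier : Set (E idx)
  isOpen_carrier : IsOpen carrier
  isConnected_carrier : IsConnected carrier
  isComponent_carrier : ∀ x ∈ carrier,
    connectedComponentIn (P.chartProj idx ⁻¹' (P.chartProj idx '' carrier)) x = carrier

variable {P : OrbispaceStr X E G A}

/-- The connected open subset of `X` uniformized by a local chart. -/
def LocalChart.image (c : LocalChart P) : Set X := P.chartProj c.idx '' c.carrier

/-- A point of a local chart, as a unit of the groupoid. -/
def LocalChart.pt (c : LocalChart P) (x : c.carrier) : Σ i, E i := ⟨c.idx, x.1⟩

/-- The group of a local chart: the elements of `G i` that preserve the chart. -/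
def LocalChart.group (c : LocalChart P) : Subgroup (G c.idx) where
  carrier := {g | ∀ x, (P.act c.idx).smul g x ∈ c.carrier ↔ x ∈ c.carrier}
  one_mem' x := by
    have h : (P.act c.idx).smul 1 x = x := (P.act c.idx).one_smul x
    rw [h]
  mul_mem' {g h} hg hh x := by
    have e : (P.act c.idx).smul (g * h) x = (P.act c.idx).smul g ((P.act c.idx).smul h x) :=
      (P.act c.idx).mul_smul g h x
    rw [e]
    exact (hg _).trans (hh x)
  inv_mem' {g} hg x := by
    have e : (P.act c.idx).smul g ((P.act c.idx).smul g⁻¹ x) = x := by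
      have h1 := (P.act c.idx).mul_smul g g⁻¹ x
      have h2 := (P.act c.idx).one_smul x
      rw [mul_inv_cancel] at h1
      exact h1.symm.trans h2
    have h := hg ((P.act c.idx).smul g⁻¹ x)
    rw [e] at h
    exact h.symm

/-- The action of the group of a local chart on the chart. -/
def LocalChart.smul (c : LocalChart P) (g : c.group) (x : c.carrier) : c.carrier :=
  ⟨(P.act c.idx).smul g.1 x.1, (g.2 x.1).2 x.2⟩

/-- The set of arrows from the local chart `c` to the local chart `d`. -/
def Arrows (c d : LocalChart P) : Set A :=
  {γ | (∃ x, P.src γ = c.pt x) ∧ ∃ y, P.tgt γ = d.pt y}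

/-- The set `T(c, d)` of connected components of the space of arrows from `c` to `d`. -/
def T (c d : LocalChart P) : Type _ := ConnectedComponents (Arrows c d)

/-- The class in `T(c, d)` of an arrow from `c` to `d`. -/
def T.mk {c d : LocalChart P} (γ : Arrows c d) : T c d := ConnectedComponents.mk γ

/-- `T.Maps ξ x y` means `φ_ξ(x) = y`, where `φ_ξ` is the transition homeomorphism of `ξ`: the
class `ξ` contains an arrow from `x` to `y`. -/
def T.Maps {c d : LocalChart P} (ξ : T c d) (x : c.carrier) (y : d.carrier) : Prop :=
  ∃ γ : Arrows c d, T.mk γ = ξ ∧ P.src γ.1 = c.pt x ∧ P.tgt γ.1 = d.pt y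

/-- `T.CompAt x ξ η ζ` means `ζ = η ∘ ξ (x)`: there are arrows in `ξ` and `η`, the first one
with source `x`, whose composite is defined and belongs to `ζ`. -/
def T.CompAt {c d e : LocalChart P} (x : c.carrier) (ξ : T c d) (η : T d e) (ζ : T c e) : Prop :=
  ∃ (γ : Arrows c d) (δ : Arrows d e) (ε : Arrows c e), T.mk γ = ξ ∧ T.mk δ = η ∧ T.mk ε = ζ ∧
    P.src γ.1 = c.pt x ∧ P.src δ.1 = P.tgt γ.1 ∧ ε.1 = P.comp δ.1 γ.1

/-- The arrow from `x` to `g x` given by an element `g` of the group of a local chart. -/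
def LocalChart.arrow (c : LocalChart P) (g : c.group) (x : c.carrier) : Arrows c c :=
  ⟨P.prod c.idx g.1 x.1, ⟨x, P.src_prod _ _ _⟩, ⟨c.smul g x, P.tgt_prod _ _ _⟩⟩

/-- The element of `T(c, c)` given by an element of the group of a local chart. -/
noncomputable def LocalChart.ofGroup (c : LocalChart P) (g : c.group) : T c c :=
  T.mk (c.arrow g ⟨c.isConnected_carrier.nonempty.some, c.isConnected_carrier.nonempty.some_mem⟩)

/-- `Conj g h γ δ` means `δ = h ∘ γ ∘ g⁻¹`, for arrows `γ`, `δ` from `c` to `d` and elements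
`g`, `h` of the groups of `c` and `d`. -/
def Conj {c d : LocalChart P} (g : c.group) (h : d.group) (γ δ : Arrows c d) : Prop :=
  ∃ x y, P.src γ.1 = c.pt x ∧ P.tgt γ.1 = d.pt y ∧ P.src δ.1 = c.pt (c.smul g x) ∧
    P.comp δ.1 (c.arrow g x).1 = P.comp (d.arrow h y).1 γ.1

/-- Admissible local charts: the image `U` in `X` has compact closure, contained in the image of
the ambient chart `E i`; the chart is the interior of its closure in `E i`; and the quotient of
this closure by the group of the chart is the closure of `U`. -/
structure LocalChart.IsAdmissible (c : LocalChart P) : Prop where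
  isCompact_closure : IsCompact (closure c.image)
  closure_subset : closure c.image ⊆ Set.range (P.chartProj c.idx)
  interior_closure : interior (closure c.carrier) = c.carrier
  image_closure : P.chartProj c.idx '' closure c.carrier = closure c.image
  orbit_closure : ∀ x ∈ closure c.carrier, ∀ y ∈ closure c.carrier,
    P.chartProj c.idx x = P.chartProj c.idx y → ∃ g : c.group, (P.act c.idx).smul g.1 x = y

theorem pt_injective (c : LocalChart P) {x y : c.carrier} (h : c.pt x = c.pt y) : x = y := by
  unfold LocalChart.pt at h
  simp only [Sigma.mk.injEq, heq_eq_eq, true_and] at h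
  exact Subtype.ext h

theorem src_arrow (c : LocalChart P) (g : c.group) (x : c.carrier) :
    P.src (c.arrow g x).1 = c.pt x := P.src_prod _ _ _

theorem tgt_arrow (c : LocalChart P) (g : c.group) (x : c.carrier) :
    P.tgt (c.arrow g x).1 = c.pt (c.smul g x) := P.tgt_prod _ _ _

theorem smul_mul (c : LocalChart P) (g h : c.group) (x : c.carrier) :
    c.smul (g * h) x = c.smul g (c.smul h x) :=
  Subtype.ext ((P.act c.idx).mul_smul g.1 h.1 x.1)

theorem smul_one (c : LocalChart P) (x : c.carrier) : c.smul 1 x = x :=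
  Subtype.ext ((P.act c.idx).one_smul x.1)

theorem arrow_mul (c : LocalChart P) (g h : c.group) (x : c.carrier) :
    (c.arrow (g * h) x).1 = P.comp (c.arrow g (c.smul h x)).1 (c.arrow h x).1 :=
  P.prod_mul _ _ _ _

theorem arrow_one (c : LocalChart P) (x : c.carrier) : (c.arrow 1 x).1 = P.one (c.pt x) :=
  P.prod_one _ _

theorem conj_one {c d : LocalChart P} {γ δ : Arrows c d} (h : Conj 1 1 γ δ) : γ = δ := by
  obtain ⟨x, y, h1, h2, h3, h4⟩ := h
  rw [arrow_one, arrow_one] at h4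
  rw [smul_one] at h3
  rw [← h3, P.comp_one, ← h2, P.one_comp] at h4
  exact Subtype.ext h4.symm

theorem conj_inv {c d : LocalChart P} {g : c.group} {h : d.group} {γ δ : Arrows c d}
    (H : Conj g⁻¹ h⁻¹ γ δ) : Conj g h δ γ := by
  obtain ⟨x, y, h1, h2, h3, h4⟩ := H
  have ex : c.smul g (c.smul g⁻¹ x) = x := by rw [← smul_mul, mul_inv_cancel, smul_one]
  have a1 : P.src (d.arrow h⁻¹ y).1 = P.tgt γ.1 := by rw [src_arrow, h2]
  have a2 : P.src δ.1 = P.tgt (c.arrow g⁻¹ x).1 := by rw [tgt_arrow, h3]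
  have a3 : P.tgt δ.1 = d.pt (d.smul h⁻¹ y) := by
    rw [← P.tgt_comp _ _ a2, h4, P.tgt_comp _ _ a1, tgt_arrow]
  have a4 : P.src (d.arrow h (d.smul h⁻¹ y)).1 = P.tgt δ.1 := by rw [src_arrow, a3]
  have a5 : P.src (c.arrow g⁻¹ x).1 = P.tgt (c.arrow g (c.smul g⁻¹ x)).1 := by
    rw [src_arrow, tgt_arrow, ex]
  have a6 : P.src (d.arrow h (d.smul h⁻¹ y)).1 = P.tgt (d.arrow h⁻¹ y).1 := by
    rw [src_arrow, tgt_arrow]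
  have e1 : P.comp (c.arrow g⁻¹ x).1 (c.arrow g (c.smul g⁻¹ x)).1 = P.one (P.src δ.1) := by
    have := arrow_mul c g⁻¹ g (c.smul g⁻¹ x)
    rw [ex, inv_mul_cancel, arrow_one] at this
    rw [← this, h3]
  have e2 : P.comp (d.arrow h (d.smul h⁻¹ y)).1 (d.arrow h⁻¹ y).1 = P.one (P.tgt γ.1) := by
    have := arrow_mul d h h⁻¹ y
    rw [mul_inv_cancel, arrow_one] at this
    rw [← this, h2]
  refine ⟨c.smul g⁻¹ x, d.smul h⁻¹ y, h3, a3, by rw [ex, h1], ?_⟩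
  have e3 : P.comp (d.arrow h (d.smul h⁻¹ y)).1 (P.comp δ.1 (c.arrow g⁻¹ x).1) = γ.1 := by
    rw [h4, ← P.assoc _ _ _ a6 a1, e2, P.one_comp]
  rw [← e3, P.assoc _ _ _ (by rw [P.tgt_comp _ _ a2, a4]) (by rw [P.src_comp _ _ a2, a5]),
    P.assoc _ _ _ a2 a5, e1, P.comp_one]

theorem conj_mul {c d : LocalChart P} {g g' : c.group} {h h' : d.group} {γ δ : Arrows c d}
    (H : Conj (g * g') (h * h') γ δ) : ∃ ε : Arrows c d, Conj g' h' γ ε ∧ Conj g h ε δ := by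
  obtain ⟨x, y, h1, h2, h3, h4⟩ := H
  have b1 : P.src γ.1 = P.tgt (P.inv (c.arrow g' x).1) := by rw [P.tgt_inv, src_arrow, h1]
  have b2 : P.src (d.arrow h' y).1 = P.tgt (P.comp γ.1 (P.inv (c.arrow g' x).1)) := by
    rw [P.tgt_comp _ _ b1, src_arrow, h2]
  let ε : A := P.comp (d.arrow h' y).1 (P.comp γ.1 (P.inv (c.arrow g' x).1))
  have s : P.src ε = c.pt (c.smul g' x) := by
    rw [P.src_comp _ _ b2, P.src_comp _ _ b1, P.src_inv, tgt_arrow]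
  have t : P.tgt ε = d.pt (d.smul h' y) := by rw [P.tgt_comp _ _ b2, tgt_arrow]
  have b3 : P.src (P.inv (c.arrow g' x).1) = P.tgt (c.arrow g' x).1 := P.src_inv _
  have b4 : P.src ε = P.tgt (c.arrow g' x).1 := by rw [s, tgt_arrow]
  have e : P.comp ε (c.arrow g' x).1 = P.comp (d.arrow h' y).1 γ.1 := by
    rw [P.assoc _ _ _ b2 (by rw [P.src_comp _ _ b1, b3]), P.assoc _ _ _ b1 b3, P.inv_comp,
      src_arrow, ← h1, P.comp_one]
  refine ⟨⟨ε, ⟨_, s⟩, ⟨_, t⟩⟩, ⟨x, y, h1, h2, s, e⟩, ⟨_, _, s, t, by rw [h3, smul_mul], ?_⟩⟩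
  have b5 : P.src δ.1 = P.tgt (c.arrow g (c.smul g' x)).1 := by rw [tgt_arrow, h3, smul_mul]
  have b6 : P.src (d.arrow h (d.smul h' y)).1 = P.tgt ε := by rw [src_arrow, t]
  have b7 : P.src (d.arrow h (d.smul h' y)).1 = P.tgt (d.arrow h' y).1 := by
    rw [src_arrow, tgt_arrow]
  have b8 : P.src (c.arrow g (c.smul g' x)).1 = P.tgt (c.arrow g' x).1 := by
    rw [src_arrow, tgt_arrow]
  have b9 : P.src (d.arrow h' y).1 = P.tgt γ.1 := by rw [src_arrow, h2]
  rw [arrow_mul, arrow_mul, ← P.assoc _ _ _ b5 b8, P.assoc _ _ _ b7 b9, ← e,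
    ← P.assoc _ _ _ b6 b4] at h4
  -- cancel the last factor
  have key : ∀ u : A, P.src u = P.tgt (c.arrow g' x).1 →
      P.comp (P.comp u (c.arrow g' x).1) (P.inv (c.arrow g' x).1) = u := by
    intro u hu
    rw [P.assoc _ _ _ hu (P.tgt_inv _).symm, P.comp_inv, ← hu, P.comp_one]
  have k1 := key _ ((P.src_comp _ _ b5).trans b8)
  have k2 := key _ ((P.src_comp _ _ b6).trans b4)
  rw [h4] at k1
  exact k1.symm.trans k2

end Basic

section Maps

variable {X : Type*} [TopologicalSpace X] {ι : Type*} {E : ι → Type*}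
  [∀ i, TopologicalSpace (E i)] {G : ι → Type*} [∀ i, Group (G i)]
  {A : Type*} [TopologicalSpace A]
  {X' : Type*} [TopologicalSpace X'] {ι' : Type*} {E' : ι' → Type*}
  [∀ i, TopologicalSpace (E' i)] {G' : ι' → Type*} [∀ i, Group (G' i)]
  {A' : Type*} [TopologicalSpace A']

/-- The discrete part of a homomorphism: a set of local charts covering `X`, an assignment of a
local chart of `X'` to each of them, and maps `ρ_{βα} : T(U_α, U_β) → T(U'_α, U'_β)`. -/
structure Shape (P : OrbispaceStr X E G A) (P' : OrbispaceStr X' E' G' A') where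
  cover : Set (LocalChart P)
  covers : ∀ p : X, ∃ c ∈ cover, p ∈ c.image
  target : cover → LocalChart P'
  rho : ∀ α β : cover, T α.1 β.1 → T (target α) (target β)

variable {P : OrbispaceStr X E G A} {P' : OrbispaceStr X' E' G' A'}

/-- Families of maps `f_α` from the local charts of a cover to the assigned local charts. -/
def Shape.LocalMaps (r : Shape P P') : Type _ := ∀ α : r.cover, α.1.carrier → (r.target α).carrier

/-- `({f_α}, {ρ_{βα}})` is a homomorphism of étale topological groupoids from the restriction of
the groupoid of `X` to the charts of the cover, to the groupoid of `X'`. -/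
structure IsHom (r : Shape P P') (f : r.LocalMaps) : Prop where
  continuous : ∀ α, Continuous (f α)
  maps : ∀ (α β : r.cover) (ξ : T α.1 β.1) (x : α.1.carrier) (y : β.1.carrier),
    ξ.Maps x y → (r.rho α β ξ).Maps (f α x) (f β y)
  comp : ∀ (α β δ : r.cover) (ξ : T α.1 β.1) (η : T β.1 δ.1) (ζ : T α.1 δ.1)
    (x : α.1.carrier), T.CompAt x ξ η ζ →
      T.CompAt (f α x) (r.rho α β ξ) (r.rho β δ η) (r.rho α δ ζ)

/-- Homomorphisms. -/
def GroupoidHom (P : OrbispaceStr X E G A) (P' : OrbispaceStr X' E' G' A') : Type _ :=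
  Σ r : Shape P P', {f : r.LocalMaps // IsHom r f}

/-- The homomorphism `(s, g)`, with cover `{U_a}`, is induced by the homomorphism `(r, f)`, with
cover `{U_α}`, via the data `(θ, {ξ_a}, {ξ'_a})`: every `U_a` is contained in `U_{θ(a)}`,
`g_a = φ_{ξ'_a}⁻¹ ∘ f_{θ(a)} ∘ φ_{ξ_a}`, and
`ρ_{ba}(η) = ξ'_b⁻¹ ∘ ρ_{θ(b)θ(a)}(ξ_b ∘ η ∘ ξ_a⁻¹) ∘ ξ'_a`. -/
structure IsInducedVia (r s : Shape P P') (f : r.LocalMaps) (g : s.LocalMaps)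
    (θ : s.cover → r.cover) (ξ : ∀ a, T a.1 (θ a).1)
    (ξ' : ∀ a, T (s.target a) (r.target (θ a))) : Prop where
  maps : ∀ (a : s.cover) (x : a.1.carrier),
    ∃ y, (ξ a).Maps x y ∧ (ξ' a).Maps (g a x) (f (θ a) y)
  rho : ∀ (a b : s.cover) (η : T a.1 b.1) (ω : T (θ a).1 (θ b).1) (μ : T a.1 (θ b).1)
    (x : a.1.carrier), T.CompAt x (ξ a) ω μ → T.CompAt x η (ξ b) μ →
      ∃ μ', T.CompAt (g a x) (ξ' a) (r.rho (θ a) (θ b) ω) μ' ∧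
        T.CompAt (g a x) (s.rho a b η) (ξ' b) μ'

/-- `κ` is induced by `σ`. -/
def Induces (σ κ : GroupoidHom P P') : Prop :=
  ∃ θ ξ ξ', IsInducedVia σ.1 κ.1 σ.2.1 κ.2.1 θ ξ ξ'

/-- Two homomorphisms are equivalent if they induce a common homomorphism. -/
def HomEquiv (P : OrbispaceStr X E G A) (P' : OrbispaceStr X' E' G' A')
    (σ τ : GroupoidHom P P') : Prop :=
  ∃ κ, Induces σ κ ∧ Induces τ κ

/-- The set `[X; X']` of maps of orbispaces: equivalence classes of homomorphisms. -/
def OrbMap (P : OrbispaceStr X E G A) (P' : OrbispaceStr X' E' G' A') : Type _ :=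
  Quot (HomEquiv P P')

/-- Admissible homomorphisms: the cover is locally finite, its charts are admissible, and the
homomorphism extends continuously to the closures of the charts. The extension consists of maps
`F α` on the closures, and of an extension over the closure of the space of arrows from `α` to `β`;
continuity of the latter means that `ρ` is locally constant near the limit arrows. -/
structure IsAdmissible (r : Shape P P') (f : r.LocalMaps) : Prop where
  locallyFinite : LocallyFinite fun α : r.cover => α.1.image
  charts : ∀ α ∈ r.cover, α.IsAdmissible
  extend : ∃ F : ∀ α : r.cover, closure α.1.carrier → (r.target α).carrier,
    (∀ α, Continuous (F α)) ∧
    (∀ (α : r.cover) (x : α.1.carrier), F α ⟨x.1, subset_closure x.2⟩ = f α x) ∧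
    ∀ (α β : r.cover) (x : closure α.1.carrier) (y : closure β.1.carrier) (γ : A),
      γ ∈ closure (Arrows α.1 β.1) → P.src γ = ⟨α.1.idx, x.1⟩ → P.tgt γ = ⟨β.1.idx, y.1⟩ →
        ∃ γ' : Arrows (r.target α) (r.target β), P'.src γ'.1 = (r.target α).pt (F α x) ∧
          P'.tgt γ'.1 = (r.target β).pt (F β y) ∧
          ∃ N ∈ 𝓝 γ, ∀ δ : Arrows α.1 β.1, δ.1 ∈ N → r.rho α β (T.mk δ) = T.mk γ'

/-- The index set of the mapping orbispace: the shapes of admissible homomorphisms. -/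
def AdmShape (P : OrbispaceStr X E G A) (P' : OrbispaceStr X' E' G' A') : Type _ :=
  {r : Shape P P' // ∃ f, IsHom r f ∧ IsAdmissible r f}

/-- The space `𝒪_ρ` of admissible homomorphisms of a given shape. -/
def HomSpace (r : AdmShape P P') : Type _ :=
  {f : r.1.LocalMaps // IsHom r.1 f ∧ IsAdmissible r.1 f}

/-- The basic set of all `{f_α}` in `𝒪_ρ` such that `f_α(K) ⊆ O` for all `α` and all `(K, O)` in
the family `S α`. -/
def HomSpace.basic {r : AdmShape P P'}
    (S : ∀ α : r.1.cover, Set (Set α.1.carrier × Set (r.1.target α).carrier)) :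
    Set (HomSpace r) :=
  {f | ∀ α, ∀ p ∈ S α, f.1 α '' p.1 ⊆ p.2}

/-- The families used for the topology on `𝒪_ρ`: for every `α` a finite set of pairs of a compact
subset of the chart and an open subset of the assigned chart. -/
def IsBasicFamily {r : AdmShape P P'}
    (S : ∀ α : r.1.cover, Set (Set α.1.carrier × Set (r.1.target α).carrier)) : Prop :=
  ∀ α, (S α).Finite ∧ ∀ p ∈ S α, IsCompact p.1 ∧ IsOpen p.2

/-- The topology of compact-open type on `𝒪_ρ`. -/
instance (r : AdmShape P P') : TopologicalSpace (HomSpace r) :=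
  TopologicalSpace.generateFrom {W | ∃ S, IsBasicFamily S ∧ W = HomSpace.basic (r := r) S}

/-- The map of orbispaces represented by an admissible homomorphism. -/
def HomSpace.toOrbMap {r : AdmShape P P'} (f : HomSpace r) : OrbMap P P' :=
  Quot.mk _ ⟨r.1, f.1, f.2.1⟩

/-- The topology on `[X; X']`, generated by the images of the basic subsets of all `𝒪_ρ`. -/
instance : TopologicalSpace (OrbMap P P') :=
  TopologicalSpace.generateFrom {W | ∃ (r : AdmShape P P')
    (S : ∀ α : r.1.cover, Set (Set α.1.carrier × Set (r.1.target α).carrier)),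
    IsBasicFamily S ∧ W = HomSpace.toOrbMap '' HomSpace.basic S}

/-- The group `G_ρ`: families `{g_α}`, with `g_α` in the group of the local chart `U'_α`, such that
`ρ_{βα}(ξ) = g_β ∘ ρ_{βα}(ξ) ∘ g_α⁻¹` for all `ξ`. -/
def ShapeGroup (r : AdmShape P P') : Subgroup (∀ α : r.1.cover, (r.1.target α).group) where
  carrier := {g | ∀ (α β : r.1.cover) (γ δ : Arrows (r.1.target α) (r.1.target β)),
    Conj (g α) (g β) γ δ → ∀ ξ : T α.1 β.1, T.mk γ = r.1.rho α β ξ ↔ T.mk δ = r.1.rho α β ξ}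
  one_mem' α β γ δ h ξ := by rw [conj_one h]
  mul_mem' {g h} hg hh α β γ δ H ξ := by
    obtain ⟨ε, h1, h2⟩ := conj_mul H
    exact (hh α β γ ε h1 ξ).trans (hg α β ε δ h2 ξ)
  inv_mem' {g} hg α β γ δ H ξ := (hg α β δ γ (conj_inv H) ξ).symm

/-- The possible discrete parts of an isomorphism between homomorphisms with covers `{U_a}` and
`{U_α}`: families of maps `T(U_a, U_α) → T(U'_a, U'_α)`. -/
def Transf (r s : AdmShape P P') : Type _ :=
  ∀ (a : r.1.cover) (α : s.1.cover), T a.1 α.1 → T (r.1.target a) (s.1.target α)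

/-- The set `Γ_{στ}` of isomorphisms from `τ = {f_a}` to `σ = {h_α}`: families of maps
`η : T(U_a, U_α) → T(U'_a, U'_α)` which are compatible with the local maps and with composition. -/
structure IsTransf {r s : AdmShape P P'} (η : Transf r s) (f : HomSpace r) (h : HomSpace s) :
    Prop where
  maps : ∀ (a : r.1.cover) (α : s.1.cover) (ξ : T a.1 α.1) (x : a.1.carrier) (y : α.1.carrier),
    ξ.Maps x y → (η a α ξ).Maps (f.1 a x) (h.1 α y)
  comp_left : ∀ (a : r.1.cover) (α β : s.1.cover) (ξ : T a.1 α.1) (ζ : T α.1 β.1)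
    (ω : T a.1 β.1) (x : a.1.carrier), T.CompAt x ξ ζ ω →
      T.CompAt (f.1 a x) (η a α ξ) (s.1.rho α β ζ) (η a β ω)
  comp_right : ∀ (a b : r.1.cover) (α : s.1.cover) (ξ : T a.1 b.1) (ζ : T b.1 α.1)
    (ω : T a.1 α.1) (x : a.1.carrier), T.CompAt x ξ ζ ω →
      T.CompAt (f.1 a x) (r.1.rho a b ξ) (η b α ζ) (η a α ω)

/-- The sheet of the mapping groupoid defined by `η`: all pairs `(τ, σ)` in `𝒪_r × 𝒪_s` such that
`η` is an isomorphism from `τ` to `σ`. -/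
def Sheet {r s : AdmShape P P'} (η : Transf r s) : Type _ :=
  {p : HomSpace r × HomSpace s // IsTransf η p.1 p.2}

/-- A sheet carries the topology of a subspace of `𝒪_r × 𝒪_s`. -/
instance {r s : AdmShape P P'} (η : Transf r s) : TopologicalSpace (Sheet η) :=
  inferInstanceAs (TopologicalSpace {p : HomSpace r × HomSpace s // IsTransf η p.1 p.2})

/-- The arrows of the mapping groupoid: the disjoint union of all `Γ_{στ}`, for admissible `σ` and
`τ`. -/
def MapArrow (P : OrbispaceStr X E G A) (P' : OrbispaceStr X' E' G' A') : Type _ :=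
  Σ k : (Σ r s : AdmShape P P', Transf r s), Sheet k.2.2

/-- The étale topology on the arrows: the disjoint union of the sheets. -/
instance : TopologicalSpace (MapArrow P P') :=
  inferInstanceAs (TopologicalSpace (Σ k : (Σ r s : AdmShape P P', Transf r s), Sheet k.2.2))

/-- The arrow from `f` to `h` given by an isomorphism `η`. -/
def MapArrow.mk {r s : AdmShape P P'} (η : Transf r s) (f : HomSpace r) (h : HomSpace s)
    (hη : IsTransf η f h) : MapArrow P P' :=
  ⟨⟨r, s, η⟩, ⟨(f, h), hη⟩⟩

end Maps

end OrbispaceStr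

/-! A homomorphism is a functor between étale groupoids, and everything rests on one rigidity fact.
By (C2) an arrow is determined by its class in `T c d` together with its source, and a class defined
at one point of a connected set continues over the whole set as long as the set lies over the image
of the target chart (`T.exists_arrow`). Composition identities continue in the same way
(`T.CompAt.of_isPreconnected`). Hence discrete data `ρ` or `η`, together with the local maps, amount
to continuous maps on arrows (`IsNat.lift`), and natural transformations can be built, inverted and
composed on arrows.

Equivalence: data via which `f` is induced by `h` are the same as a natural transformation with
prescribed values on the classes `ξ_a` (`IsInducedVia.existsUnique_isNat`). So two homomorphisms are
equivalent exactly when a natural transformation joins them (`homEquiv_iff`), and transitivity is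
composition (`IsNat.exists_comp`). Admissible representatives arise by restriction to a locally
finite cover by admissible charts whose closures lie in the old charts. Such charts exist because
properness gives stabilizers of finite index (`exists_isAdmissible`).

Topology: the heart is that sheets project homeomorphically onto open sets. For `η : f → h` and an
arrow `γ` from `x` in a chart of `f` to `y` in the closure of a chart of `h`, the values of `η` on
arrows near `γ` have one limit class `τ` (`IsNat.exists_limClass`), and near `y` the target is
obtained from `f` near `x` by applying `φ_τ`. Compactness of the closed charts and local finiteness
make this uniform, so the target depends continuously on the source
(`IsTransf.exists_basic_subset`). For `g` close to `f`, small connected sets joining `f x` to `g x`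
carry all classes and laws from `f` to `g`, and the same formula defines a target for `g`
(`IsTransf.exists_isTransf`).

Composition laws persist nearby for the same reason, so the mapping groupoid is étale. The orbit map
is open by definition of the topology, and continuous because saturations are unions of projections
of open parts of sheets. Isomorphisms between homomorphisms of one shape are determined by their
values on identity classes, which are group elements (`IsTransf.exists_shapeGroup`). -/

section TopGroupoidLemmas

open Filter

/-! ### Cancellation in groupoids and local splitting of arrows. -/

namespace TopGroupoid

variable {U A : Type*} [TopologicalSpace U] [TopologicalSpace A] (Γ : TopGroupoid U A)

theorem comp_inv_cancel {δ γ : A} (h : Γ.src δ = Γ.tgt γ) :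
    Γ.comp (Γ.comp δ γ) (Γ.inv γ) = δ := by
  rw [Γ.assoc _ _ _ h (Γ.tgt_inv _).symm, Γ.comp_inv, ← h, Γ.comp_one]

theorem inv_comp_cancel {δ γ : A} (h : Γ.src δ = Γ.tgt γ) :
    Γ.comp (Γ.inv δ) (Γ.comp δ γ) = γ := by
  rw [← Γ.assoc _ _ _ (Γ.src_inv _) h, Γ.inv_comp, h, Γ.one_comp]

theorem comp_cancel_inv {γ ε : A} (h : Γ.src γ = Γ.src ε) :
    Γ.comp (Γ.comp γ (Γ.inv ε)) ε = γ := by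
  rw [Γ.assoc _ _ _ (h.trans (Γ.tgt_inv _).symm) (Γ.src_inv _), Γ.inv_comp, ← h, Γ.comp_one]

theorem cancel_inv_comp {γ δ : A} (h : Γ.tgt δ = Γ.tgt γ) :
    Γ.comp δ (Γ.comp (Γ.inv δ) γ) = γ := by
  rw [← Γ.assoc _ _ _ (Γ.tgt_inv _).symm ((Γ.src_inv _).trans h), Γ.comp_inv, h, Γ.one_comp]

theorem comp_right_cancel {γ δ ε : A} (h : Γ.src γ = Γ.tgt ε) (h' : Γ.src δ = Γ.tgt ε)
    (e : Γ.comp γ ε = Γ.comp δ ε) : γ = δ := by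
  rw [← Γ.comp_inv_cancel h, e, Γ.comp_inv_cancel h']

theorem comp_left_cancel {γ δ ε : A} (h : Γ.src ε = Γ.tgt γ) (h' : Γ.src ε = Γ.tgt δ)
    (e : Γ.comp ε γ = Γ.comp ε δ) : γ = δ := by
  rw [← Γ.inv_comp_cancel h, e, Γ.inv_comp_cancel h']

theorem eq_inv_of_comp_eq_one {γ δ : A} (h : Γ.src δ = Γ.tgt γ)
    (e : Γ.comp δ γ = Γ.one (Γ.src γ)) : δ = Γ.inv γ :=
  Γ.comp_right_cancel h (Γ.src_inv _) (e.trans (Γ.inv_comp _).symm)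

theorem inv_inv (γ : A) : Γ.inv (Γ.inv γ) = γ :=
  (Γ.eq_inv_of_comp_eq_one (Γ.tgt_inv _).symm (by rw [Γ.comp_inv, Γ.src_inv])).symm

theorem inv_comp_rev {γ δ : A} (h : Γ.src δ = Γ.tgt γ) :
    Γ.inv (Γ.comp δ γ) = Γ.comp (Γ.inv γ) (Γ.inv δ) := by
  symm
  have h1 : Γ.src (Γ.inv γ) = Γ.tgt (Γ.inv δ) := by rw [Γ.src_inv, Γ.tgt_inv, h]
  apply Γ.eq_inv_of_comp_eq_one
  · rw [Γ.src_comp _ _ h1, Γ.tgt_comp _ _ h, Γ.src_inv]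
  · rw [Γ.assoc _ _ _ h1 (by rw [Γ.src_inv, Γ.tgt_comp _ _ h]), Γ.inv_comp_cancel h, Γ.inv_comp,
      Γ.src_comp _ _ h]

theorem one_eq_of_comp_self {γ : A} (h : Γ.src γ = Γ.tgt γ) (e : Γ.comp γ γ = γ) :
    γ = Γ.one (Γ.src γ) :=
  Γ.comp_left_cancel h (Γ.tgt_one _).symm (e.trans (Γ.comp_one _).symm)

theorem tendsto_comp {Y : Type*} {l : Filter Y} {u v : Y → A} {δ γ : A}
    (h : Γ.src δ = Γ.tgt γ) (hu : Tendsto u l (𝓝 δ)) (hv : Tendsto v l (𝓝 γ))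
    (huv : ∀ᶠ y in l, Γ.src (u y) = Γ.tgt (v y)) :
    Tendsto (fun y => Γ.comp (u y) (v y)) l (𝓝 (Γ.comp δ γ)) := by
  have := Γ.continuousOn_comp (δ, γ) h
  refine this.tendsto.comp (tendsto_nhdsWithin_iff.2 ⟨hu.prodMk_nhds hv, huv⟩)

theorem comp_mem_of_nhds {δ γ : A} (h : Γ.src δ = Γ.tgt γ) {W : Set A}
    (hW : W ∈ 𝓝 (Γ.comp δ γ)) :
    ∃ V₂ ∈ 𝓝 δ, ∃ V₁ ∈ 𝓝 γ, ∀ δ' ∈ V₂, ∀ γ' ∈ V₁, Γ.src δ' = Γ.tgt γ' →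
      Γ.comp δ' γ' ∈ W := by
  have := Γ.continuousOn_comp (δ, γ) h hW
  rw [mem_map, mem_nhdsWithin_iff_exists_mem_nhds_inter] at this
  obtain ⟨V, hV, hs⟩ := this
  rw [Set.subset_def] at hs
  rw [nhds_prod_eq, mem_prod_iff] at hV
  obtain ⟨V₂, h₂, V₁, h₁, hV⟩ := hV
  exact ⟨V₂, h₂, V₁, h₁, fun δ' hδ γ' hγ e => hs (δ', γ') ⟨hV ⟨hδ, hγ⟩, e⟩⟩

variable {Γ}

theorem IsEtale.image_src_mem (hΓ : Γ.IsEtale) {γ : A} {N : Set A} (hN : N ∈ 𝓝 γ) :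
    Γ.src '' N ∈ 𝓝 (Γ.src γ) := hΓ.1.isOpenMap.image_mem_nhds hN

theorem IsEtale.image_tgt_mem (hΓ : Γ.IsEtale) {γ : A} {N : Set A} (hN : N ∈ 𝓝 γ) :
    Γ.tgt '' N ∈ 𝓝 (Γ.tgt γ) := hΓ.2.isOpenMap.image_mem_nhds hN

/-- Openness of the source map gives `γ'` near `γ` with the same source as `ε`, and then `ε γ'⁻¹` is
near `δ` by continuity. Local statements about composites are reduced to their factors in this way.
-/
theorem IsEtale.eventually_exists_comp (hΓ : Γ.IsEtale) {δ γ : A} (h : Γ.src δ = Γ.tgt γ)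
    {V₂ V₁ : Set A} (h₂ : V₂ ∈ 𝓝 δ) (h₁ : V₁ ∈ 𝓝 γ) :
    ∀ᶠ ε in 𝓝 (Γ.comp δ γ), ∃ δ' ∈ V₂, ∃ γ' ∈ V₁, Γ.src δ' = Γ.tgt γ' ∧
      Γ.comp δ' γ' = ε := by
  have e : Γ.src (Γ.comp δ γ) = Γ.tgt (Γ.inv γ) := by rw [Γ.src_comp _ _ h, Γ.tgt_inv]
  obtain ⟨W₂, hW₂, W₁, hW₁, hW⟩ := Γ.comp_mem_of_nhds e (W := V₂)
    (by rwa [Γ.comp_inv_cancel h])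
  have h3 : V₁ ∩ Γ.inv ⁻¹' W₁ ∈ 𝓝 γ := Filter.inter_mem h₁ (Γ.continuous_inv.continuousAt hW₁)
  have h4 : Γ.src ⁻¹' (Γ.src '' (V₁ ∩ Γ.inv ⁻¹' W₁)) ∈ 𝓝 (Γ.comp δ γ) := by
    apply Γ.continuous_src.continuousAt
    rw [Γ.src_comp _ _ h]
    exact hΓ.image_src_mem h3
  filter_upwards [hW₂, h4] with ε h5 ⟨γ', ⟨h6, h7⟩, h8⟩
  refine ⟨Γ.comp ε (Γ.inv γ'), hW _ h5 _ h7 (by rw [Γ.tgt_inv, h8]), γ', h6, ?_, ?_⟩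
  · rw [Γ.src_comp _ _ (by rw [Γ.tgt_inv, h8]), Γ.src_inv]
  · exact Γ.comp_cancel_inv h8.symm

end TopGroupoid

end TopGroupoidLemmas

namespace OrbispaceStr

/-! ### Classes of arrows between local charts and their continuation. -/

section SingleOrbispace

open Filter

variable {X : Type*} [TopologicalSpace X] {ι : Type*} {E : ι → Type*}
  [∀ i, TopologicalSpace (E i)] {G : ι → Type*} [∀ i, Group (G i)]
  {A : Type*} [TopologicalSpace A] {P : OrbispaceStr X E G A}

theorem proj_src (P : OrbispaceStr X E G A) (γ : A) : P.proj (P.src γ) = P.proj (P.tgt γ) :=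
  (P.proj_eq_iff _ _).2 ⟨γ, rfl, rfl⟩

/-- The saturation of an open set `V` is `tgt (src⁻¹ V)`, which is open because the target map is
open. -/
theorem isOpenMap_proj (P : OrbispaceStr X E G A) : IsOpenMap P.proj := by
  intro V hV
  rw [← P.isQuotientMap_proj.isOpen_preimage]
  have : P.proj ⁻¹' (P.proj '' V) = P.tgt '' (P.src ⁻¹' V) := by
    ext u
    constructor
    · rintro ⟨v, hv, e⟩
      obtain ⟨γ, h1, h2⟩ := (P.proj_eq_iff _ _).1 e
      exact ⟨γ, by rwa [Set.mem_preimage, h1], h2⟩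
    · rintro ⟨γ, h, rfl⟩
      exact ⟨_, h, P.proj_src γ⟩
  rw [this]
  exact P.isEtale.2.isOpenMap _ (hV.preimage P.continuous_src)

theorem continuous_proj (P : OrbispaceStr X E G A) : Continuous P.proj :=
  P.isQuotientMap_proj.continuous

theorem locallyConnectedSpace_units (h1 : P.C1) : LocallyConnectedSpace (Σ i, E i) := by
  have : LocallyConnectedSpace A := h1
  have : IsQuotientMap P.src := P.isEtale.1.isOpenMap.isQuotientMap P.continuous_src
    (fun u => ⟨P.one u, P.src_one u⟩)
  exact this.isCoinducing.locallyConnectedSpace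

theorem locallyConnectedSpace_chart (h1 : P.C1) (i : ι) : LocallyConnectedSpace (E i) := by
  have := locallyConnectedSpace_units h1
  exact IsOpenEmbedding.sigmaMk.locallyConnectedSpace

namespace LocalChart

/-- A local chart as a set of units of the groupoid. -/
def units (c : LocalChart P) : Set (Σ i, E i) := Set.range c.pt

theorem pt_mem_units (c : LocalChart P) (x : c.carrier) : c.pt x ∈ c.units := ⟨x, rfl⟩

theorem isOpenEmbedding_pt (c : LocalChart P) : IsOpenEmbedding c.pt :=
  IsOpenEmbedding.sigmaMk.comp c.isOpen_carrier.isOpenEmbedding_subtypeVal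

theorem continuous_pt (c : LocalChart P) : Continuous c.pt := c.isOpenEmbedding_pt.continuous

theorem isOpen_units (c : LocalChart P) : IsOpen c.units := c.isOpenEmbedding_pt.isOpen_range

theorem units_eq (c : LocalChart P) : c.units = Sigma.mk c.idx '' c.carrier := by
  ext u
  constructor
  · rintro ⟨x, rfl⟩
    exact ⟨x.1, x.2, rfl⟩
  · rintro ⟨x, hx, rfl⟩
    exact ⟨⟨x, hx⟩, rfl⟩

theorem mem_units {c : LocalChart P} {x : E c.idx} :
    (⟨c.idx, x⟩ : Σ i, E i) ∈ c.units ↔ x ∈ c.carrier := by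
  rw [units_eq, sigma_mk_injective.mem_set_image]

theorem closure_units (c : LocalChart P) :
    closure c.units = Sigma.mk c.idx '' closure c.carrier := by
  rw [units_eq, IsClosedEmbedding.sigmaMk.closure_image_eq]

theorem isPreconnected_units (c : LocalChart P) : IsPreconnected c.units := by
  rw [units_eq]
  exact c.isConnected_carrier.isPreconnected.image _ continuous_sigmaMk.continuousOn

theorem image_eq (c : LocalChart P) : c.image = P.proj '' c.units := by
  rw [units_eq, Set.image_image]
  rfl

theorem isOpen_image (c : LocalChart P) : IsOpen c.image := by
  rw [image_eq]
  exact P.isOpenMap_proj _ c.isOpen_units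

theorem proj_mem_image {c : LocalChart P} {u : Σ i, E i} (hu : u ∈ c.units) :
    P.proj u ∈ c.image := by
  rw [image_eq]
  exact ⟨u, hu, rfl⟩

theorem exists_arrow {c : LocalChart P} {u : Σ i, E i} (hu : P.proj u ∈ c.image) :
    ∃ γ, P.src γ = u ∧ P.tgt γ ∈ c.units := by
  rw [image_eq] at hu
  obtain ⟨v, hv, e⟩ := hu
  obtain ⟨γ, h1, h2⟩ := (P.proj_eq_iff _ _).1 e.symm
  exact ⟨γ, h1, by rwa [h2]⟩

/-- A preconnected set of units lies in a single `E i`, where `c` is a whole component of the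
preimage of its image. This is the form in which the component condition on charts is used: a
connected set over the image of `c` cannot leave `c`. -/
theorem subset_units (c : LocalChart P) {C : Set (Σ i, E i)} (hC : IsPreconnected C)
    (hp : ∀ u ∈ C, P.proj u ∈ c.image) (hne : (C ∩ c.units).Nonempty) : C ⊆ c.units := by
  obtain ⟨u, huC, huc⟩ := hne
  obtain ⟨i, t, ht, rfl⟩ := Sigma.isConnected_iff.1 ⟨⟨u, huC⟩, hC⟩
  obtain ⟨x, hx, rfl⟩ := huC
  have hi : i = c.idx := by
    obtain ⟨y, hy⟩ := huc
    exact (congrArg Sigma.fst hy).symm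
  subst hi
  rw [mem_units] at huc
  rintro _ ⟨y, hy, rfl⟩
  rw [mem_units, ← c.isComponent_carrier x huc]
  exact ht.isPreconnected.subset_connectedComponentIn hx
    (fun z hz => hp _ ⟨z, hz, rfl⟩) hy

end LocalChart

theorem mem_arrows {c d : LocalChart P} {γ : A} :
    γ ∈ Arrows c d ↔ P.src γ ∈ c.units ∧ P.tgt γ ∈ d.units := by
  constructor
  · rintro ⟨⟨x, hx⟩, ⟨y, hy⟩⟩
    exact ⟨⟨x, hx.symm⟩, ⟨y, hy.symm⟩⟩
  · rintro ⟨⟨x, hx⟩, ⟨y, hy⟩⟩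
    exact ⟨⟨x, hx.symm⟩, ⟨y, hy.symm⟩⟩

theorem isOpen_arrows (c d : LocalChart P) : IsOpen (Arrows c d) := by
  have : Arrows c d = P.src ⁻¹' c.units ∩ P.tgt ⁻¹' d.units := Set.ext fun γ => mem_arrows
  rw [this]
  exact (c.isOpen_units.preimage P.continuous_src).inter (d.isOpen_units.preimage P.continuous_tgt)

section ArrowSection

variable {c d e : LocalChart P}

theorem src_mem_units (γ : Arrows c d) : P.src γ.1 ∈ c.units := (mem_arrows.1 γ.2).1

theorem tgt_mem_units (γ : Arrows c d) : P.tgt γ.1 ∈ d.units := (mem_arrows.1 γ.2).2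

/-- The source of an arrow between local charts, as a point of the first chart. -/
noncomputable def srcPt (γ : Arrows c d) : c.carrier := γ.2.1.choose

/-- The target of an arrow between local charts, as a point of the second chart. -/
noncomputable def tgtPt (γ : Arrows c d) : d.carrier := γ.2.2.choose

theorem pt_srcPt (γ : Arrows c d) : c.pt (srcPt γ) = P.src γ.1 := γ.2.1.choose_spec.symm

theorem pt_tgtPt (γ : Arrows c d) : d.pt (tgtPt γ) = P.tgt γ.1 := γ.2.2.choose_spec.symm

theorem srcPt_eq {γ : Arrows c d} {x : c.carrier} (h : P.src γ.1 = c.pt x) : srcPt γ = x :=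
  pt_injective c ((pt_srcPt γ).trans h)

theorem tgtPt_eq {γ : Arrows c d} {y : d.carrier} (h : P.tgt γ.1 = d.pt y) : tgtPt γ = y :=
  pt_injective d ((pt_tgtPt γ).trans h)

theorem continuous_srcPt : Continuous (srcPt : Arrows c d → c.carrier) := by
  rw [c.isOpenEmbedding_pt.isEmbedding.continuous_iff]
  exact (P.continuous_src.comp continuous_subtype_val).congr fun γ => (pt_srcPt γ).symm

theorem continuous_tgtPt : Continuous (tgtPt : Arrows c d → d.carrier) := by
  rw [d.isOpenEmbedding_pt.isEmbedding.continuous_iff]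
  exact (P.continuous_tgt.comp continuous_subtype_val).congr fun γ => (pt_tgtPt γ).symm

theorem proj_src_mem_image (γ : Arrows c d) : P.proj (P.src γ.1) ∈ d.image := by
  rw [P.proj_src]
  exact LocalChart.proj_mem_image (tgt_mem_units γ)

/-- The composite of arrows between local charts. -/
def compArrow (δ : Arrows d e) (γ : Arrows c d) (h : P.src δ.1 = P.tgt γ.1) : Arrows c e :=
  ⟨P.comp δ.1 γ.1, mem_arrows.2
    ⟨by rw [P.src_comp _ _ h]; exact (src_mem_units γ), by rw [P.tgt_comp _ _ h]; exact (tgt_mem_units δ)⟩⟩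

theorem src_compArrow (δ : Arrows d e) (γ : Arrows c d) (h : P.src δ.1 = P.tgt γ.1) :
    P.src (compArrow δ γ h).1 = P.src γ.1 := P.src_comp _ _ h

theorem tgt_compArrow (δ : Arrows d e) (γ : Arrows c d) (h : P.src δ.1 = P.tgt γ.1) :
    P.tgt (compArrow δ γ h).1 = P.tgt δ.1 := P.tgt_comp _ _ h

/-- The inverse of an arrow between local charts. -/
def invArrow (γ : Arrows c d) : Arrows d c :=
  ⟨P.inv γ.1, mem_arrows.2
    ⟨by rw [P.src_inv]; exact (tgt_mem_units γ), by rw [P.tgt_inv]; exact (src_mem_units γ)⟩⟩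

theorem continuous_invArrow : Continuous (invArrow : Arrows c d → Arrows d c) :=
  (P.continuous_inv.comp continuous_subtype_val).subtype_mk _

end ArrowSection

theorem LocalChart.exists_arrow_of_proj_mem {c d : LocalChart P} {x : c.carrier}
    (h : P.proj (c.pt x) ∈ d.image) : ∃ γ : Arrows c d, P.src γ.1 = c.pt x := by
  obtain ⟨γ, h1, h2⟩ := LocalChart.exists_arrow h
  exact ⟨⟨γ, mem_arrows.2 ⟨by rw [h1]; exact c.pt_mem_units x, h2⟩⟩, h1⟩

namespace T

variable {c d e : LocalChart P}

theorem exists_mk (ξ : T c d) : ∃ γ : Arrows c d, T.mk γ = ξ :=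
  ConnectedComponents.surjective_coe ξ

/-- The set of arrows of a class. -/
def arrows (ξ : T c d) : Set A := Subtype.val '' {γ : Arrows c d | T.mk γ = ξ}

theorem mk_eq_iff {γ δ : Arrows c d} :
    T.mk γ = T.mk δ ↔ γ ∈ connectedComponent δ := ConnectedComponents.coe_eq_coe'

theorem setOf_mk_eq (δ : Arrows c d) : {γ : Arrows c d | T.mk γ = T.mk δ} = connectedComponent δ :=
  Set.ext fun _ => mk_eq_iff

theorem arrows_mk (γ : Arrows c d) :
    (T.mk γ).arrows = connectedComponentIn (Arrows c d) γ.1 := by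
  rw [connectedComponentIn_eq_image γ.2, arrows, setOf_mk_eq]

theorem mem_arrows_mk (γ : Arrows c d) : γ.1 ∈ (T.mk γ).arrows := ⟨γ, rfl, rfl⟩

theorem isOpen_arrows (h1 : P.C1) (ξ : T c d) : IsOpen ξ.arrows := by
  obtain ⟨γ, rfl⟩ := ξ.exists_mk
  rw [arrows_mk]
  have : LocallyConnectedSpace A := h1
  exact (OrbispaceStr.isOpen_arrows c d).connectedComponentIn

theorem isOpen_mk_eq (h1 : P.C1) (ξ : T c d) : IsOpen {γ : Arrows c d | T.mk γ = ξ} := by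
  obtain ⟨γ, rfl⟩ := ξ.exists_mk
  rw [setOf_mk_eq]
  have : LocallyConnectedSpace A := h1
  have := (OrbispaceStr.isOpen_arrows c d).locallyConnectedSpace
  exact isOpen_connectedComponent

theorem eventually_mk_eq (h1 : P.C1) (γ : Arrows c d) : ∀ᶠ δ in 𝓝 γ, T.mk δ = T.mk γ :=
  (isOpen_mk_eq h1 (T.mk γ)).mem_nhds rfl

theorem mk_eq_of_isPreconnected {S : Set A} (hS : IsPreconnected S) (hsub : S ⊆ Arrows c d)
    {γ δ : Arrows c d} (hγ : γ.1 ∈ S) (hδ : δ.1 ∈ S) : T.mk γ = T.mk δ := by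
  have h1 : γ.1 ∈ connectedComponentIn (Arrows c d) δ.1 :=
    hS.subset_connectedComponentIn hδ hsub hγ
  rw [← arrows_mk] at h1
  obtain ⟨γ', h2, h3⟩ := h1
  rwa [← Subtype.ext h3]

theorem arrows_subset_component (γ : Arrows c d) :
    (T.mk γ).arrows ⊆ connectedComponentIn (P.between c.idx d.idx) γ.1 := by
  rw [arrows_mk]
  apply connectedComponentIn_mono
  rintro δ ⟨⟨x, hx⟩, ⟨y, hy⟩⟩
  exact ⟨by rw [hx]; rfl, by rw [hy]; rfl⟩

theorem mem_between (γ : Arrows c d) : γ.1 ∈ P.between c.idx d.idx := by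
  obtain ⟨γ, ⟨x, hx⟩, ⟨y, hy⟩⟩ := γ
  exact ⟨by rw [hx]; rfl, by rw [hy]; rfl⟩

/-- A class lies in one component of the arrows between the ambient charts, and there (C2) makes the
source map injective. The later uniqueness arguments rest on this. -/
theorem eq_of_src_eq (h2 : P.C2) {γ δ : Arrows c d} (h : T.mk γ = T.mk δ)
    (hs : P.src γ.1 = P.src δ.1) : γ = δ := by
  have e := (h2 _ _ δ.1 (mem_between δ)).1.1.injective
  have m1 := arrows_subset_component δ (h ▸ mem_arrows_mk γ)
  have m2 := arrows_subset_component δ (mem_arrows_mk δ)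
  have := @e ⟨γ.1, m1⟩ ⟨δ.1, m2⟩ hs
  exact Subtype.ext (Subtype.mk.inj this)

theorem injOn_src (h2 : P.C2) (ξ : T c d) : Set.InjOn P.src ξ.arrows := by
  rintro _ ⟨γ, h, rfl⟩ _ ⟨δ, h', rfl⟩ e
  exact congrArg Subtype.val (eq_of_src_eq h2 (h.trans h'.symm) e)

/-- A class which contains an arrow starting in a connected set `C` is defined on all of `C`,
provided that the image of `C` in the base is contained in the image of the second chart. -/
theorem exists_arrow (h2 : P.C2) (γ : Arrows c d) {C : Set (Σ i, E i)} (hC : IsPreconnected C)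
    (hc : C ⊆ c.units) (hd : ∀ u ∈ C, P.proj u ∈ d.image) (hγ : P.src γ.1 ∈ C)
    {u : Σ i, E i} (hu : u ∈ C) : ∃ δ : Arrows c d, T.mk δ = T.mk γ ∧ P.src δ.1 = u := by
  set K := connectedComponentIn (P.between c.idx d.idx) γ.1 with hK
  obtain ⟨⟨emb, him⟩, -⟩ := h2 _ _ γ.1 (mem_between γ)
  have hsub : C ⊆ P.src '' K := by
    rw [him]
    refine hC.subset_connectedComponentIn hγ fun v hv => ?_
    obtain ⟨δ, e1, e2⟩ := LocalChart.exists_arrow (hd v hv)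
    refine ⟨δ, T.mem_between (c := c) (d := d) ⟨δ, mem_arrows.2 ⟨?_, e2⟩⟩, e1⟩
    rw [e1]
    exact hc hv
  let S : Set A := K ∩ P.src ⁻¹' C
  -- The source map is an embedding on `K` whose image contains `C`, so it identifies `S` with `C`.
  have hS : IsPreconnected S := by
    have : S = Subtype.val '' {k : K | P.src k.1 ∈ C} := by
      ext a
      constructor
      · rintro ⟨h, h'⟩
        exact ⟨⟨a, h⟩, h', rfl⟩
      · rintro ⟨k, h, rfl⟩
        exact ⟨k.2, h⟩
    rw [this]
    refine IsPreconnected.image ?_ _ continuous_subtype_val.continuousOn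
    rw [← emb.isInducing.isPreconnected_image]
    convert hC using 1
    ext v
    constructor
    · rintro ⟨k, hk, rfl⟩
      exact hk
    · intro hv
      obtain ⟨k, hk, rfl⟩ := hsub hv
      exact ⟨⟨k, hk⟩, hv, rfl⟩
  have hγS : γ.1 ∈ S := ⟨mem_connectedComponentIn (mem_between γ), hγ⟩
  -- `K` is a component for the ambient charts only; connectedness of `S` keeps the targets inside
  -- the smaller chart `d`.
  have hT : P.tgt '' S ⊆ d.units := by
    refine d.subset_units (hS.image _ P.continuous_tgt.continuousOn) ?_
      ⟨_, ⟨γ.1, hγS, rfl⟩, (tgt_mem_units γ)⟩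
    rintro _ ⟨a, ha, rfl⟩
    rw [← P.proj_src]
    exact hd _ ha.2
  have hSA : S ⊆ Arrows c d := fun a ha => mem_arrows.2 ⟨hc ha.2, hT ⟨a, ha, rfl⟩⟩
  obtain ⟨k, hk, rfl⟩ := hsub hu
  have hkS : k ∈ S := ⟨hk, hu⟩
  exact ⟨⟨k, hSA hkS⟩, mk_eq_of_isPreconnected hS hSA hkS hγS, rfl⟩

/-- This inverts the source map on a class: injectivity is (C2), and the inverse is continuous
because the class is open by (C1) and the source map is open. -/
theorem exists_section (h1 : P.C1) (h2 : P.C2) (ξ : T c d) :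
    ∃ s : (Σ i, E i) → A, ContinuousOn s (P.src '' ξ.arrows) ∧ ∀ γ ∈ ξ.arrows, s (P.src γ) = γ := by
  obtain ⟨γ₀, -⟩ := ξ.exists_mk
  have : Nonempty A := ⟨γ₀.1⟩
  have inj := injOn_src h2 ξ
  refine ⟨Function.invFunOn P.src ξ.arrows, ?_, fun γ hγ => inj.leftInvOn_invFunOn hγ⟩
  rintro _ ⟨γ, hγ, rfl⟩
  rw [ContinuousWithinAt, inj.leftInvOn_invFunOn hγ]
  intro N hN
  have : P.src '' (N ∩ ξ.arrows) ∈ 𝓝 (P.src γ) :=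
    P.isEtale.image_src_mem (inter_mem hN ((isOpen_arrows h1 ξ).mem_nhds hγ))
  refine mem_map.2 (mem_nhdsWithin_of_mem_nhds (mem_of_superset this ?_))
  rintro _ ⟨δ, ⟨hδN, hδ⟩, rfl⟩
  rw [Set.mem_preimage, inj.leftInvOn_invFunOn hδ]
  exact hδN

theorem maps_mk (γ : Arrows c d) : (T.mk γ).Maps (srcPt γ) (tgtPt γ) :=
  ⟨γ, rfl, (pt_srcPt γ).symm, (pt_tgtPt γ).symm⟩

theorem Maps.unique (h2 : P.C2) {ξ : T c d} {x : c.carrier} {y y' : d.carrier}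
    (h : ξ.Maps x y) (h' : ξ.Maps x y') : y = y' := by
  obtain ⟨γ, e1, e2, e3⟩ := h
  obtain ⟨γ', e1', e2', e3'⟩ := h'
  obtain rfl := eq_of_src_eq h2 (e1.trans e1'.symm) (e2.trans e2'.symm)
  exact pt_injective d (e3.symm.trans e3')

/-- A class defined at one point of a connected set is defined on the whole set, if the image of
the set in the base is contained in that of the second chart. -/
theorem Maps.exists_of_isPreconnected (h2 : P.C2) {ξ : T c d} {x : c.carrier} {y : d.carrier}
    (h : ξ.Maps x y) {O : Set c.carrier} (hO : IsPreconnected O) (hx : x ∈ O)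
    (hd : ∀ z ∈ O, P.proj (c.pt z) ∈ d.image) {z : c.carrier} (hz : z ∈ O) :
    ∃ w, ξ.Maps z w := by
  obtain ⟨γ, rfl, e2, e3⟩ := h
  have := exists_arrow h2 γ (hO.image c.pt c.continuous_pt.continuousOn)
    (by rintro _ ⟨z, -, rfl⟩; exact c.pt_mem_units z)
    (by rintro _ ⟨z, hz, rfl⟩; exact hd z hz) ⟨x, hx, e2.symm⟩ ⟨z, hz, rfl⟩
  obtain ⟨δ, h, h'⟩ := this
  exact ⟨tgtPt δ, δ, h, h', (pt_tgtPt δ).symm⟩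

/-- The transition map of a class is open and continuous where it is defined. -/
theorem Maps.preimage_mem_nhds (h1 : P.C1) {ξ : T c d} {x : c.carrier} {y : d.carrier}
    (h : ξ.Maps x y) {O : Set d.carrier} (hO : O ∈ 𝓝 y) :
    {z | ∃ w ∈ O, ξ.Maps z w} ∈ 𝓝 x := by
  obtain ⟨γ, rfl, e2, e3⟩ := h
  have hN : {δ : Arrows c d | T.mk δ = T.mk γ ∧ tgtPt δ ∈ O} ∈ 𝓝 γ := by
    refine inter_mem (eventually_mk_eq h1 γ) (continuous_tgtPt.continuousAt ?_)
    rwa [tgtPt_eq e3]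
  have := (OrbispaceStr.isOpen_arrows c d).isOpenEmbedding_subtypeVal.image_mem_nhds.2 hN
  have := P.isEtale.image_src_mem this
  rw [e2] at this
  refine mem_of_superset (c.continuous_pt.continuousAt this) ?_
  rintro z ⟨_, ⟨δ, ⟨hδ, hδO⟩, rfl⟩, hz⟩
  exact ⟨_, hδO, δ, hδ, hz, (pt_tgtPt δ).symm⟩

theorem CompAt.of_arrows (γ : Arrows c d) (δ : Arrows d e) (h : P.src δ.1 = P.tgt γ.1)
    {x : c.carrier} (hx : P.src γ.1 = c.pt x) :
    CompAt x (T.mk γ) (T.mk δ) (T.mk (compArrow δ γ h)) :=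
  ⟨γ, δ, compArrow δ γ h, rfl, rfl, rfl, hx, h, rfl⟩

theorem CompAt.elim {x : c.carrier} {ξ : T c d} {η : T d e} {ζ : T c e} (H : CompAt x ξ η ζ) :
    ∃ (γ : Arrows c d) (δ : Arrows d e) (h : P.src δ.1 = P.tgt γ.1), T.mk γ = ξ ∧ T.mk δ = η ∧
      T.mk (compArrow δ γ h) = ζ ∧ P.src γ.1 = c.pt x := by
  obtain ⟨γ, δ, ε, e1, e2, e3, e4, e5, e6⟩ := H
  refine ⟨γ, δ, e5, e1, e2, ?_, e4⟩
  rw [← e3]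
  congr 1
  exact Subtype.ext e6.symm

/-- Once classes and sources are fixed, (C2) leaves only one choice of factors, so `η ∘ ξ (x)` is
single-valued. -/
theorem CompAt.eq_mk (h2 : P.C2) {γ : Arrows c d} {δ : Arrows d e} (h : P.src δ.1 = P.tgt γ.1)
    {x : c.carrier} (hx : P.src γ.1 = c.pt x) {ζ : T c e} (H : CompAt x (T.mk γ) (T.mk δ) ζ) :
    ζ = T.mk (compArrow δ γ h) := by
  obtain ⟨γ', δ', h', e1, e2, e3, e4⟩ := H.elim
  obtain rfl := eq_of_src_eq h2 e1 (e4.trans hx.symm)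
  obtain rfl := eq_of_src_eq h2 e2 (h'.trans h.symm)
  exact e3.symm

/-- An identity between composites which holds at one point of a connected set persists on the
whole set, if the image of the set in the base is contained in those of the charts involved. -/
theorem CompAt.of_isPreconnected (h1 : P.C1) (h2 : P.C2) {x : c.carrier} {ξ : T c d} {η : T d e}
    {ζ : T c e} (H : CompAt x ξ η ζ) {O : Set c.carrier} (hO : IsPreconnected O) (hx : x ∈ O)
    (hd : ∀ z ∈ O, P.proj (c.pt z) ∈ d.image) (he : ∀ z ∈ O, P.proj (c.pt z) ∈ e.image)
    {z : c.carrier} (hz : z ∈ O) : CompAt z ξ η ζ := by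
  obtain ⟨γ, δ, h, rfl, rfl, rfl, hγ⟩ := H.elim
  obtain ⟨s, hs, hs'⟩ := exists_section h1 h2 (T.mk γ)
  obtain ⟨t, ht, ht'⟩ := exists_section h1 h2 (T.mk (compArrow δ γ h))
  have hC : IsPreconnected (c.pt '' O) := hO.image c.pt c.continuous_pt.continuousOn
  have hCc : c.pt '' O ⊆ c.units := by rintro _ ⟨z, -, rfl⟩; exact c.pt_mem_units z
  have key : ∀ z ∈ O, ∃ (γ' : Arrows c d) (ε' : Arrows c e), T.mk γ' = T.mk γ ∧
      T.mk ε' = T.mk (compArrow δ γ h) ∧ P.src γ'.1 = c.pt z ∧ P.src ε'.1 = c.pt z ∧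
      s (c.pt z) = γ'.1 ∧ t (c.pt z) = ε'.1 := by
    intro z hz
    obtain ⟨γ', a1, a2⟩ := exists_arrow h2 γ hC hCc
      (by rintro _ ⟨z, hz, rfl⟩; exact hd z hz) (by rw [hγ]; exact ⟨x, hx, rfl⟩) ⟨z, hz, rfl⟩
    obtain ⟨ε', b1, b2⟩ := exists_arrow h2 (compArrow δ γ h) hC hCc
      (by rintro _ ⟨z, hz, rfl⟩; exact he z hz)
      (by rw [src_compArrow, hγ]; exact ⟨x, hx, rfl⟩) ⟨z, hz, rfl⟩
    refine ⟨γ', ε', a1, b1, a2, b2, ?_, ?_⟩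
    · rw [← a2, hs' _ (a1 ▸ mem_arrows_mk γ')]
    · rw [← b2, ht' _ (b1 ▸ mem_arrows_mk ε')]
  -- The arrow of `η` over `z` has to be the arrow of `ζ` times the inverse of the arrow of `ξ`.
  -- This product depends continuously on `z` and equals `δ` at `x`, so its class is constant on
  -- `O`.
  let φ : c.carrier → A := fun z => P.comp (t (c.pt z)) (P.inv (s (c.pt z)))
  have hsO : ContinuousOn (fun z => s (c.pt z)) O := by
    refine hs.comp c.continuous_pt.continuousOn fun z hz => ?_
    obtain ⟨γ', -, a1, -, a2, -⟩ := key z hz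
    exact ⟨γ'.1, a1 ▸ mem_arrows_mk γ', a2⟩
  have htO : ContinuousOn (fun z => t (c.pt z)) O := by
    refine ht.comp c.continuous_pt.continuousOn fun z hz => ?_
    obtain ⟨-, ε', -, a1, -, a2, -⟩ := key z hz
    exact ⟨ε'.1, a1 ▸ mem_arrows_mk ε', a2⟩
  have comp_ok : ∀ z ∈ O, P.src (t (c.pt z)) = P.tgt (P.inv (s (c.pt z))) := by
    intro z hz
    obtain ⟨γ', ε', -, -, a1, a2, a3, a4⟩ := key z hz
    rw [a3, a4, P.tgt_inv, a1, a2]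
  have hφ : ContinuousOn φ O := fun z hz =>
    P.tendsto_comp (comp_ok z hz) (htO z hz)
      ((P.continuous_inv.tendsto _).comp (hsO z hz))
      (eventually_mem_nhdsWithin.mono fun w hw => comp_ok w hw)
  have hφA : φ '' O ⊆ Arrows d e := by
    rintro _ ⟨z, hz, rfl⟩
    obtain ⟨γ', ε', -, -, a1, a2, a3, a4⟩ := key z hz
    have := comp_ok z hz
    rw [mem_arrows]
    constructor
    · rw [P.src_comp _ _ this, P.src_inv, a3]
      exact (tgt_mem_units γ')
    · rw [P.tgt_comp _ _ this, a4]
      exact (tgt_mem_units ε')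
  have hφx : φ x = δ.1 := by
    have e1 : s (c.pt x) = γ.1 := by rw [← hγ, hs' _ (mem_arrows_mk γ)]
    have e2 : t (c.pt x) = (compArrow δ γ h).1 := by
      rw [← hγ, ← src_compArrow δ γ h, ht' _ (mem_arrows_mk _)]
    change P.comp (t (c.pt x)) (P.inv (s (c.pt x))) = δ.1
    rw [e1, e2]
    exact P.comp_inv_cancel h
  obtain ⟨γ', ε', a1, a2, a3, a4, a5, a6⟩ := key z hz
  have hδ : φ z ∈ Arrows d e := hφA ⟨z, hz, rfl⟩
  have e1 : T.mk (⟨φ z, hδ⟩ : Arrows d e) = T.mk δ :=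
    mk_eq_of_isPreconnected (hO.image _ hφ) hφA ⟨z, hz, rfl⟩ ⟨x, hx, hφx⟩
  have ok := comp_ok z hz
  refine ⟨γ', ⟨φ z, hδ⟩, ε', a1, e1, a2, a3, ?_, ?_⟩
  · change P.src (P.comp _ _) = _
    rw [P.src_comp _ _ ok, P.src_inv, a5]
  · change ε'.1 = P.comp (P.comp (t (c.pt z)) (P.inv (s (c.pt z)))) γ'.1
    rw [a5, a6, P.comp_cancel_inv (a4.trans a3.symm)]

end T

end SingleOrbispace

end OrbispaceStr

namespace OrbispaceStr

/-! ### Inverse classes, components as charts, inclusions of charts. -/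

section ChartConstructions

open Filter

variable {X : Type*} [TopologicalSpace X] {ι : Type*} {E : ι → Type*}
  [∀ i, TopologicalSpace (E i)] {G : ι → Type*} [∀ i, Group (G i)]
  {A : Type*} [TopologicalSpace A] {P : OrbispaceStr X E G A}

/-- The inverse of a class of arrows. -/
def T.inv {c d : LocalChart P} : T c d → T d c :=
  (continuous_invArrow (c := c) (d := d)).connectedComponentsMap

theorem T.inv_mk {c d : LocalChart P} (γ : Arrows c d) : T.inv (T.mk γ) = T.mk (invArrow γ) := rfl

theorem invArrow_invArrow {c d : LocalChart P} (γ : Arrows c d) : invArrow (invArrow γ) = γ :=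
  Subtype.ext (P.inv_inv _)

theorem T.inv_inv {c d : LocalChart P} (ξ : T c d) : T.inv (T.inv ξ) = ξ := by
  obtain ⟨γ, rfl⟩ := ξ.exists_mk
  rw [T.inv_mk, T.inv_mk, invArrow_invArrow]

theorem src_invArrow {c d : LocalChart P} (γ : Arrows c d) :
    P.src (invArrow γ).1 = P.tgt γ.1 := P.src_inv _

theorem tgt_invArrow {c d : LocalChart P} (γ : Arrows c d) :
    P.tgt (invArrow γ).1 = P.src γ.1 := P.tgt_inv _

/-- The connected component, in its chart, of the inverse image of an open set of the base. -/
def LocalChart.component (h1 : P.C1) {V : Set X} (hV : IsOpen V) (u : Σ i, E i)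
    (hu : P.proj u ∈ V) : LocalChart P where
  idx := u.1
  carrier := connectedComponentIn (P.chartProj u.1 ⁻¹' V) u.2
  isOpen_carrier := by
    have := locallyConnectedSpace_chart h1 u.1
    exact (hV.preimage (P.continuous_proj.comp continuous_sigmaMk)).connectedComponentIn
  isConnected_carrier := isConnected_connectedComponentIn_iff.2 hu
  isComponent_carrier := by
    intro x hx
    apply Set.Subset.antisymm
    · rw [connectedComponentIn_eq hx]
      apply connectedComponentIn_mono
      rintro y ⟨z, hz, e⟩
      have : z ∈ P.chartProj u.1 ⁻¹' V := connectedComponentIn_subset _ _ hz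
      rwa [Set.mem_preimage, ← e]
    · exact isPreconnected_connectedComponentIn.subset_connectedComponentIn hx
        (Set.subset_preimage_image _ _)

theorem LocalChart.mem_component (h1 : P.C1) {V : Set X} (hV : IsOpen V) (u : Σ i, E i)
    (hu : P.proj u ∈ V) : u ∈ (LocalChart.component h1 hV u hu).units :=
  (LocalChart.mem_units (c := LocalChart.component h1 hV u hu)).2 (mem_connectedComponentIn hu)

theorem LocalChart.image_component_subset (h1 : P.C1) {V : Set X} (hV : IsOpen V)
    (u : Σ i, E i) (hu : P.proj u ∈ V) : (LocalChart.component h1 hV u hu).image ⊆ V := by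
  rintro _ ⟨x, hx, rfl⟩
  exact connectedComponentIn_subset (P.chartProj u.1 ⁻¹' V) u.2 hx

theorem LocalChart.component_units_subset (h1 : P.C1) {V : Set X} (hV : IsOpen V)
    (u : Σ i, E i) (hu : P.proj u ∈ V) {c : LocalChart P} (hc : u ∈ c.units) (hVc : V ⊆ c.image) :
    (LocalChart.component h1 hV u hu).units ⊆ c.units :=
  c.subset_units (LocalChart.isPreconnected_units _)
    (fun _ hv => hVc (image_component_subset h1 hV u hu (proj_mem_image hv)))
    ⟨u, mem_component h1 hV u hu, hc⟩

/-- The inclusion of a local chart in a larger one. -/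
noncomputable def LocalChart.incl {c d : LocalChart P} (h : c.units ⊆ d.units) (x : c.carrier) :
    d.carrier := (h (c.pt_mem_units x)).choose

theorem LocalChart.pt_incl {c d : LocalChart P} (h : c.units ⊆ d.units) (x : c.carrier) :
    d.pt (LocalChart.incl h x) = c.pt x := (h (c.pt_mem_units x)).choose_spec

theorem LocalChart.continuous_incl {c d : LocalChart P} (h : c.units ⊆ d.units) :
    Continuous (LocalChart.incl h) := by
  rw [d.isOpenEmbedding_pt.isEmbedding.continuous_iff]
  exact c.continuous_pt.congr fun x => (LocalChart.pt_incl h x).symm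

/-- Arrows between local charts, as arrows between larger local charts. -/
def inclArrow {c d c' d' : LocalChart P} (hc : c.units ⊆ c'.units) (hd : d.units ⊆ d'.units)
    (γ : Arrows c d) : Arrows c' d' :=
  ⟨γ.1, mem_arrows.2 ⟨hc (src_mem_units γ), hd (tgt_mem_units γ)⟩⟩

theorem continuous_inclArrow {c d c' d' : LocalChart P} (hc : c.units ⊆ c'.units)
    (hd : d.units ⊆ d'.units) : Continuous (inclArrow hc hd) :=
  continuous_subtype_val.subtype_mk _

/-- The class of arrows between larger charts which contains a given class of arrows. -/
def T.incl {c d c' d' : LocalChart P} (hc : c.units ⊆ c'.units) (hd : d.units ⊆ d'.units) :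
    T c d → T c' d' := (continuous_inclArrow hc hd).connectedComponentsMap

/-- Any arrow from `c` to `d` will do: its class continues over the connected chart `c`, all of
which lies over `d.image`. -/
theorem T.exists_full (h2 : P.C2) {c d : LocalChart P} (h : c.image ⊆ d.image) :
    ∃ ξ : T c d, ∀ x, ∃ y, ξ.Maps x y := by
  obtain ⟨x, hx⟩ := c.isConnected_carrier.nonempty
  have hp := fun z : c.carrier => h (LocalChart.proj_mem_image (c.pt_mem_units z))
  obtain ⟨γ, hγ⟩ := LocalChart.exists_arrow_of_proj_mem (hp ⟨x, hx⟩)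
  refine ⟨T.mk γ, fun z => (T.maps_mk γ).exists_of_isPreconnected h2 (O := Set.univ) ?_
    trivial (fun z _ => hp z) trivial⟩
  exact Subtype.preconnectedSpace c.isConnected_carrier.isPreconnected |>.isPreconnected_univ

end ChartConstructions

/-! ### Natural transformations as maps on arrows; inverses and composites. -/

section Transformations

open Filter

variable {X : Type*} [TopologicalSpace X] {ι : Type*} {E : ι → Type*}
  [∀ i, TopologicalSpace (E i)] {G : ι → Type*} [∀ i, Group (G i)]
  {A : Type*} [TopologicalSpace A]
  {X' : Type*} [TopologicalSpace X'] {ι' : Type*} {E' : ι' → Type*}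
  [∀ i, TopologicalSpace (E' i)] {G' : ι' → Type*} [∀ i, Group (G' i)]
  {A' : Type*} [TopologicalSpace A']
  {P : OrbispaceStr X E G A} {P' : OrbispaceStr X' E' G' A'}

/-- The possible discrete parts of a natural transformation between homomorphisms. -/
def GTransf (r s : Shape P P') : Type _ :=
  ∀ (a : r.cover) (α : s.cover), T a.1 α.1 → T (r.target a) (s.target α)

/-- Natural transformations between not necessarily admissible homomorphisms. -/
structure IsNat {r s : Shape P P'} (η : GTransf r s) (f : r.LocalMaps) (h : s.LocalMaps) :
    Prop where
  maps : ∀ (a : r.cover) (α : s.cover) (ξ : T a.1 α.1) (x : a.1.carrier) (y : α.1.carrier),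
    ξ.Maps x y → (η a α ξ).Maps (f a x) (h α y)
  comp_left : ∀ (a : r.cover) (α β : s.cover) (ξ : T a.1 α.1) (ζ : T α.1 β.1)
    (ω : T a.1 β.1) (x : a.1.carrier), T.CompAt x ξ ζ ω →
      T.CompAt (f a x) (η a α ξ) (s.rho α β ζ) (η a β ω)
  comp_right : ∀ (a b : r.cover) (α : s.cover) (ξ : T a.1 b.1) (ζ : T b.1 α.1)
    (ω : T a.1 α.1) (x : a.1.carrier), T.CompAt x ξ ζ ω →
      T.CompAt (f a x) (r.rho a b ξ) (η b α ζ) (η a α ω)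

theorem IsHom.isNat {r : Shape P P'} {f : r.LocalMaps} (hf : IsHom r f) : IsNat r.rho f f :=
  ⟨hf.maps, hf.comp, hf.comp⟩

theorem IsTransf.isNat {r s : AdmShape P P'} {η : Transf r s} {f : HomSpace r} {h : HomSpace s}
    (H : IsTransf η f h) : IsNat (r := r.1) (s := s.1) η f.1 h.1 :=
  ⟨H.maps, H.comp_left, H.comp_right⟩

theorem IsNat.isTransf {r s : AdmShape P P'} {η : Transf r s} {f : HomSpace r} {h : HomSpace s}
    (H : IsNat (r := r.1) (s := s.1) η f.1 h.1) : IsTransf η f h :=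
  ⟨H.maps, H.comp_left, H.comp_right⟩

namespace IsNat

variable {r s t : Shape P P'} {η : GTransf r s} {f : r.LocalMaps} {h : s.LocalMaps}

theorem exists_lift (H : IsNat η f h) {a : r.cover} {α : s.cover} (γ : Arrows a.1 α.1) :
    ∃ γ' : Arrows (r.target a) (s.target α), T.mk γ' = η a α (T.mk γ) ∧
      P'.src γ'.1 = (r.target a).pt (f a (srcPt γ)) ∧
      P'.tgt γ'.1 = (s.target α).pt (h α (tgtPt γ)) :=
  H.maps a α (T.mk γ) _ _ (T.maps_mk γ)

/-- The action of a natural transformation on arrows. -/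
noncomputable def lift (H : IsNat η f h) {a : r.cover} {α : s.cover} (γ : Arrows a.1 α.1) :
    Arrows (r.target a) (s.target α) := (H.exists_lift γ).choose

theorem mk_lift (H : IsNat η f h) {a : r.cover} {α : s.cover} (γ : Arrows a.1 α.1) :
    T.mk (H.lift γ) = η a α (T.mk γ) := (H.exists_lift γ).choose_spec.1

theorem src_lift (H : IsNat η f h) {a : r.cover} {α : s.cover} (γ : Arrows a.1 α.1) :
    P'.src (H.lift γ).1 = (r.target a).pt (f a (srcPt γ)) := (H.exists_lift γ).choose_spec.2.1

theorem tgt_lift (H : IsNat η f h) {a : r.cover} {α : s.cover} (γ : Arrows a.1 α.1) :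
    P'.tgt (H.lift γ).1 = (s.target α).pt (h α (tgtPt γ)) := (H.exists_lift γ).choose_spec.2.2

theorem src_lift_eq (H : IsNat η f h) {a : r.cover} {α : s.cover} {γ : Arrows a.1 α.1}
    {x : a.1.carrier} (hx : P.src γ.1 = a.1.pt x) :
    P'.src (H.lift γ).1 = (r.target a).pt (f a x) := by rw [H.src_lift, srcPt_eq hx]

theorem tgt_lift_eq (H : IsNat η f h) {a : r.cover} {α : s.cover} {γ : Arrows a.1 α.1}
    {y : α.1.carrier} (hy : P.tgt γ.1 = α.1.pt y) :
    P'.tgt (H.lift γ).1 = (s.target α).pt (h α y) := by rw [H.tgt_lift, tgtPt_eq hy]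

theorem lift_eq (h2' : P'.C2) (H : IsNat η f h) {a : r.cover} {α : s.cover} {γ : Arrows a.1 α.1}
    {γ' : Arrows (r.target a) (s.target α)} (e : T.mk γ' = η a α (T.mk γ)) {x : a.1.carrier}
    (hx : P.src γ.1 = a.1.pt x) (hx' : P'.src γ'.1 = (r.target a).pt (f a x)) : H.lift γ = γ' :=
  T.eq_of_src_eq h2' ((H.mk_lift γ).trans e.symm) ((H.src_lift_eq hx).trans hx'.symm)

theorem src_lift_eq_tgt_lift {k : t.LocalMaps}
    {η₁ : GTransf r s} {η₂ : GTransf s t} (H₁ : IsNat η₁ f h) (H₂ : IsNat η₂ h k) {a : r.cover}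
    {b : s.cover} {c : t.cover} {γ : Arrows a.1 b.1} {δ : Arrows b.1 c.1}
    (e : P.src δ.1 = P.tgt γ.1) : P'.src (H₂.lift δ).1 = P'.tgt (H₁.lift γ).1 := by
  rw [H₁.tgt_lift, H₂.src_lift_eq (e.trans (pt_tgtPt γ).symm)]

theorem lift_comp_left (h2' : P'.C2) (H : IsNat η f h) (Hs : IsNat s.rho h h) {a : r.cover}
    {α β : s.cover} (γ : Arrows a.1 α.1) (δ : Arrows α.1 β.1) (e : P.src δ.1 = P.tgt γ.1) :
    (H.lift (compArrow δ γ e)).1 = P'.comp (Hs.lift δ).1 (H.lift γ).1 := by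
  have hx := (pt_srcPt γ).symm
  obtain ⟨γ', δ', e', a1, a2, a3, a4⟩ :=
    (H.comp_left _ _ _ _ _ _ _ (T.CompAt.of_arrows γ δ e hx)).elim
  obtain rfl := H.lift_eq h2' a1 hx a4
  obtain rfl := Hs.lift_eq h2' a2 (e.trans (pt_tgtPt γ).symm) (e'.trans (H.tgt_lift γ))
  rw [H.lift_eq h2' a3 ((src_compArrow _ _ _).trans hx) ((src_compArrow _ _ _).trans a4)]
  rfl

theorem lift_comp_right (h2' : P'.C2) (H : IsNat η f h) (Hr : IsNat r.rho f f) {a b : r.cover}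
    {α : s.cover} (γ : Arrows a.1 b.1) (δ : Arrows b.1 α.1) (e : P.src δ.1 = P.tgt γ.1) :
    (H.lift (compArrow δ γ e)).1 = P'.comp (H.lift δ).1 (Hr.lift γ).1 := by
  have hx := (pt_srcPt γ).symm
  obtain ⟨γ', δ', e', a1, a2, a3, a4⟩ :=
    (H.comp_right _ _ _ _ _ _ _ (T.CompAt.of_arrows γ δ e hx)).elim
  obtain rfl := Hr.lift_eq h2' a1 hx a4
  obtain rfl := H.lift_eq h2' a2 (e.trans (pt_tgtPt γ).symm) (e'.trans (Hr.tgt_lift γ))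
  rw [H.lift_eq h2' a3 ((src_compArrow _ _ _).trans hx) ((src_compArrow _ _ _).trans a4)]
  rfl

/-- Near an arrow the class of the lift is constant by (C1), and its source varies continuously.
Openness of the source map gives an arrow of that class, near the old lift, with the required
source; by (C2) it is the new lift. -/
theorem continuous_lift (h1 : P.C1) (h1' : P'.C1) (h2' : P'.C2) (hf : ∀ a, Continuous (f a))
    (H : IsNat η f h) (a : r.cover) (α : s.cover) :
    Continuous fun γ : Arrows a.1 α.1 => H.lift γ := by
  rw [continuous_iff_continuousAt]
  intro γ₀
  refine tendsto_def.2 fun N hN => ?_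
  have hN' : N ∩ {δ | T.mk δ = T.mk (H.lift γ₀)} ∈ 𝓝 (H.lift γ₀) :=
    inter_mem hN (T.eventually_mk_eq h1' _)
  have h3 := P'.isEtale.image_src_mem
    ((isOpen_arrows _ _).isOpenEmbedding_subtypeVal.image_mem_nhds.2 hN')
  rw [H.src_lift] at h3
  have h4 : Continuous fun γ : Arrows a.1 α.1 => (r.target a).pt (f a (srcPt γ)) :=
    (r.target a).continuous_pt.comp ((hf a).comp continuous_srcPt)
  filter_upwards [h4.continuousAt h3, T.eventually_mk_eq h1 γ₀] with γ h5 h6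
  obtain ⟨_, ⟨δ, ⟨hδN, hδ⟩, rfl⟩, e⟩ := h5
  rw [Set.mem_preimage, H.lift_eq h2' (γ' := δ) ?_ (pt_srcPt γ).symm e]
  · exact hδN
  · rw [hδ, H.mk_lift, h6]

/-- A natural transformation is determined by its action on arrows. -/
theorem of_lift (Hr : IsNat r.rho f f) (Hs : IsNat s.rho h h)
    (N : ∀ (a : r.cover) (α : s.cover), Arrows a.1 α.1 → Arrows (r.target a) (s.target α))
    (hN : ∀ a α γ, T.mk (N a α γ) = η a α (T.mk γ))
    (hsrc : ∀ a α γ, P'.src (N a α γ).1 = (r.target a).pt (f a (srcPt γ)))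
    (htgt : ∀ a α γ, P'.tgt (N a α γ).1 = (s.target α).pt (h α (tgtPt γ)))
    (hleft : ∀ a α β (γ : Arrows a.1 α.1) (δ : Arrows α.1 β.1) (e : P.src δ.1 = P.tgt γ.1),
      (N a β (compArrow δ γ e)).1 = P'.comp (Hs.lift δ).1 (N a α γ).1)
    (hright : ∀ a b α (γ : Arrows a.1 b.1) (δ : Arrows b.1 α.1) (e : P.src δ.1 = P.tgt γ.1),
      (N a α (compArrow δ γ e)).1 = P'.comp (N b α δ).1 (Hr.lift γ).1) : IsNat η f h := by
  constructor
  · rintro a α ξ x y ⟨γ, rfl, e1, e2⟩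
    exact ⟨N a α γ, hN _ _ _, by rw [hsrc, srcPt_eq e1], by rw [htgt, tgtPt_eq e2]⟩
  · intro a α β ξ ζ ω x H
    obtain ⟨γ, δ, e, rfl, rfl, rfl, e4⟩ := H.elim
    refine ⟨N a α γ, Hs.lift δ, N a β (compArrow δ γ e), hN _ _ _, Hs.mk_lift _, hN _ _ _,
      by rw [hsrc, srcPt_eq e4], ?_, hleft _ _ _ _ _ _⟩
    rw [htgt, Hs.src_lift_eq (e.trans (pt_tgtPt γ).symm)]
  · intro a b α ξ ζ ω x H
    obtain ⟨γ, δ, e, rfl, rfl, rfl, e4⟩ := H.elim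
    refine ⟨Hr.lift γ, N b α δ, N a α (compArrow δ γ e), Hr.mk_lift _, hN _ _ _, hN _ _ _,
      Hr.src_lift_eq e4, ?_, hright _ _ _ _ _ _⟩
    rw [Hr.tgt_lift, hsrc, srcPt_eq (e.trans (pt_tgtPt γ).symm)]

end IsNat

/-- The inverse of a family of maps of classes. -/
def GTransf.inv {r s : Shape P P'} (η : GTransf r s) : GTransf s r :=
  fun α a ξ => T.inv (η a α (T.inv ξ))

theorem GTransf.inv_inv {r s : Shape P P'} (η : GTransf r s) : η.inv.inv = η := by
  funext a α ξ
  simp only [GTransf.inv, T.inv_inv]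

namespace IsNat

variable {r s t : Shape P P'} {η : GTransf r s} {f : r.LocalMaps} {h : s.LocalMaps}

theorem inv (h2' : P'.C2) (Hr : IsNat r.rho f f) (Hs : IsNat s.rho h h) (H : IsNat η f h) :
    IsNat η.inv h f := by
  refine of_lift Hs Hr (fun α a γ => invArrow (H.lift (invArrow γ))) ?_ ?_ ?_ ?_ ?_
  · intro α a γ
    change T.inv (T.mk (H.lift (invArrow γ))) = _
    rw [H.mk_lift]
    rfl
  · intro α a γ
    rw [src_invArrow, H.tgt_lift_eq ((tgt_invArrow γ).trans (pt_srcPt γ).symm)]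
  · intro α a γ
    rw [tgt_invArrow, H.src_lift_eq ((src_invArrow γ).trans (pt_tgtPt γ).symm)]
  · intro α a b γ δ e
    have e1 : P.src (invArrow (compArrow δ γ e)).1 = P.tgt δ.1 := by
      rw [src_invArrow, tgt_compArrow]
    have key := H.lift_comp_right h2' Hr δ (invArrow (compArrow δ γ e)) e1
    have e2 : compArrow (invArrow (compArrow δ γ e)) δ e1 = invArrow γ := by
      apply Subtype.ext
      change P.comp (P.inv (P.comp δ.1 γ.1)) δ.1 = P.inv γ.1
      rw [P.inv_comp_rev e, P.comp_cancel_inv (γ := P.inv γ.1) (by rw [P.src_inv, e])]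
    rw [e2] at key
    change P'.inv _ = P'.comp _ (P'.inv _)
    have e3 : P'.src (H.lift (invArrow (compArrow δ γ e))).1 = P'.tgt (Hr.lift δ).1 := by
      rw [Hr.tgt_lift, H.src_lift_eq (e1.trans (pt_tgtPt δ).symm)]
    rw [key, P'.inv_comp_rev e3, P'.cancel_inv_comp]
    rw [P'.tgt_inv, e3]
  · intro α β a γ δ e
    have e1 : P.src γ.1 = P.tgt (invArrow (compArrow δ γ e)).1 := by
      rw [tgt_invArrow, src_compArrow]
    have key := H.lift_comp_left h2' Hs (invArrow (compArrow δ γ e)) γ e1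
    have e2 : compArrow γ (invArrow (compArrow δ γ e)) e1 = invArrow δ := by
      apply Subtype.ext
      change P.comp γ.1 (P.inv (P.comp δ.1 γ.1)) = P.inv δ.1
      rw [P.inv_comp_rev e, P.cancel_inv_comp (by rw [P.tgt_inv, e])]
    rw [e2] at key
    change P'.inv _ = P'.comp (P'.inv _) _
    have e3 : P'.src (Hs.lift γ).1 = P'.tgt (H.lift (invArrow (compArrow δ γ e))).1 := by
      rw [H.tgt_lift, Hs.src_lift_eq (e1.trans (pt_tgtPt _).symm)]
    rw [key, P'.inv_comp_rev e3, P'.comp_cancel_inv]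
    rw [P'.src_inv, e3]

/-- A continuous map on arrows preserves components and so induces the maps of classes;
transformations can be constructed on arrows, with continuity replacing any bookkeeping of classes.
-/
theorem exists_of_arrows (Hr : IsNat r.rho f f) (Hs : IsNat s.rho h h)
    (N : ∀ (a : r.cover) (α : s.cover), Arrows a.1 α.1 → Arrows (r.target a) (s.target α))
    (hN : ∀ a α, Continuous (N a α))
    (hsrc : ∀ a α γ, P'.src (N a α γ).1 = (r.target a).pt (f a (srcPt γ)))
    (htgt : ∀ a α γ, P'.tgt (N a α γ).1 = (s.target α).pt (h α (tgtPt γ)))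
    (hleft : ∀ a α β (γ : Arrows a.1 α.1) (δ : Arrows α.1 β.1) (e : P.src δ.1 = P.tgt γ.1),
      (N a β (compArrow δ γ e)).1 = P'.comp (Hs.lift δ).1 (N a α γ).1)
    (hright : ∀ a b α (γ : Arrows a.1 b.1) (δ : Arrows b.1 α.1) (e : P.src δ.1 = P.tgt γ.1),
      (N a α (compArrow δ γ e)).1 = P'.comp (N b α δ).1 (Hr.lift γ).1) :
    ∃ η : GTransf r s, IsNat η f h ∧ ∀ a α γ, η a α (T.mk γ) = T.mk (N a α γ) :=
  ⟨fun a α => (hN a α).connectedComponentsMap,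
    of_lift Hr Hs N (fun _ _ _ => rfl) hsrc htgt hleft hright, fun _ _ _ => rfl⟩

end IsNat

/-- Continuity of a map on arrows which is locally given by splitting the arrows and composing
the images of the factors. -/
theorem continuousAt_of_split {a b c : LocalChart P} {a' b' c' : LocalChart P'}
    {N : Arrows a c → Arrows a' c'} {N₁ : Arrows a b → Arrows a' b'} {N₂ : Arrows b c → Arrows b' c'}
    {ε : Arrows a b} {δ : Arrows b c} (e : P.src δ.1 = P.tgt ε.1) (h₁ : ContinuousAt N₁ ε)
    (h₂ : ContinuousAt N₂ δ) {B : Set (Arrows a b)} (hB : B ∈ 𝓝 ε)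
    (hN : ∀ ε' ∈ B, ∀ (δ' : Arrows b c) (e' : P.src δ'.1 = P.tgt ε'.1),
      P'.src (N₂ δ').1 = P'.tgt (N₁ ε').1 ∧
      (N (compArrow δ' ε' e')).1 = P'.comp (N₂ δ').1 (N₁ ε').1) :
    ContinuousAt N (compArrow δ ε e) := by
  refine (IsInducing.subtypeVal.continuousAt_iff (f := N)).2 (tendsto_def.2 fun W hW => ?_)
  obtain ⟨e1, e2⟩ := hN ε (mem_of_mem_nhds hB) δ e
  rw [Function.comp, e2] at hW
  obtain ⟨V₂, hV₂, V₁, hV₁, hV⟩ := P'.comp_mem_of_nhds e1 hW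
  have op := fun c d : LocalChart P => (isOpen_arrows c d).isOpenEmbedding_subtypeVal
  have m₁ : Subtype.val '' (N₁ ⁻¹' (Subtype.val ⁻¹' V₁) ∩ B) ∈ 𝓝 ε.1 :=
    (op _ _).image_mem_nhds.2 (inter_mem (h₁ (continuous_subtype_val.continuousAt hV₁)) hB)
  have m₂ : Subtype.val '' (N₂ ⁻¹' (Subtype.val ⁻¹' V₂)) ∈ 𝓝 δ.1 :=
    (op _ _).image_mem_nhds.2 (h₂ (continuous_subtype_val.continuousAt hV₂))
  have := P.isEtale.eventually_exists_comp e m₂ m₁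
  refine (continuous_subtype_val (p := (· ∈ Arrows a c))).continuousAt.eventually this |>.mono ?_
  rintro γ ⟨_, ⟨δ', hδ, rfl⟩, _, ⟨ε', ⟨hε, hεB⟩, rfl⟩, e', e''⟩
  have : γ = compArrow δ' ε' e' := Subtype.ext e''.symm
  subst this
  obtain ⟨e3, e4⟩ := hN ε' hεB δ' e'
  rw [Function.comp, e4]
  exact hV _ hδ _ hε e3

theorem Shape.exists_arrow (s : Shape P P') {a c : LocalChart P} (γ : Arrows a c) :
    ∃ (b : s.cover) (ε : Arrows a b.1), P.src ε.1 = P.src γ.1 := by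
  obtain ⟨b, hb, hp⟩ := s.covers (P.proj (P.src γ.1))
  rw [← pt_srcPt] at hp ⊢
  obtain ⟨ε, hε⟩ := LocalChart.exists_arrow_of_proj_mem hp
  exact ⟨⟨b, hb⟩, ε, hε⟩

namespace IsNat

variable {r s t : Shape P P'} {η₁ : GTransf r s} {η₂ : GTransf s t} {f : r.LocalMaps}
  {g : s.LocalMaps} {h : t.LocalMaps}

/-- An arrow `γ` is written as `(γ ε⁻¹) ε` with `ε` ending in a chart of the middle cover, and its
image is `H₂` of the first factor times `H₁` of the second. Naturality with respect to the middle
homomorphism makes the choice of `ε` immaterial. -/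
theorem exists_comp (h1 : P.C1) (h1' : P'.C1) (h2' : P'.C2)
    (hf : IsHom r f) (hg : IsHom s g) (hh : IsHom t h) (H₁ : IsNat η₁ f g) (H₂ : IsNat η₂ g h) :
    ∃ η : GTransf r t, IsNat η f h ∧
      ∀ (a : r.cover) (b : s.cover) (c : t.cover) (x : a.1.carrier) (ξ : T a.1 b.1)
        (ζ : T b.1 c.1) (ω : T a.1 c.1), T.CompAt x ξ ζ ω →
        T.CompAt (f a x) (η₁ a b ξ) (η₂ b c ζ) (η a c ω) := by
  have comp_ok : ∀ {a : r.cover} {b : s.cover} {c : t.cover} {γ : Arrows a.1 b.1}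
      {δ : Arrows b.1 c.1} (_ : P.src δ.1 = P.tgt γ.1),
      P'.src (H₂.lift δ).1 = P'.tgt (H₁.lift γ).1 := by
    exact H₁.src_lift_eq_tgt_lift H₂
  choose m ε hε using fun (a : r.cover) (c : t.cover) (γ : Arrows a.1 c.1) => s.exists_arrow γ
  have hε' : ∀ a c (γ : Arrows a.1 c.1), P.src γ.1 = P.tgt (invArrow (ε a c γ)).1 :=
    fun a c γ => by rw [tgt_invArrow, hε]
  have hε2 : ∀ a c (γ : Arrows a.1 c.1),
      P.src (compArrow γ (invArrow (ε a c γ)) (hε' a c γ)).1 = P.tgt (ε a c γ).1 :=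
    fun a c γ => by rw [src_compArrow, src_invArrow]
  let N : ∀ (a : r.cover) (c : t.cover), Arrows a.1 c.1 → Arrows (r.target a) (t.target c) :=
    fun a c γ => compArrow (H₂.lift (compArrow γ (invArrow (ε a c γ)) (hε' a c γ)))
      (H₁.lift (ε a c γ)) (comp_ok (hε2 a c γ))
  have hN : ∀ (a : r.cover) (b : s.cover) (c : t.cover) (ε' : Arrows a.1 b.1)
      (δ' : Arrows b.1 c.1) (e : P.src δ'.1 = P.tgt ε'.1),
      (N a c (compArrow δ' ε' e)).1 = P'.comp (H₂.lift δ').1 (H₁.lift ε').1 := by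
    intro a b c ε' δ' e
    set γ := compArrow δ' ε' e with hγ
    change P'.comp (H₂.lift (compArrow γ (invArrow (ε a c γ)) (hε' a c γ))).1
      (H₁.lift (ε a c γ)).1 = _
    have e0 : P.src ε'.1 = P.tgt (invArrow (ε a c γ)).1 := by
      rw [tgt_invArrow, hε, src_compArrow]
    -- `ω` leads from the chosen middle point to that of the given splitting; naturality of both
    -- transformations moves it from one factor to the other.
    let ω := compArrow ε' (invArrow (ε a c γ)) e0
    have e1 : P.src δ'.1 = P.tgt ω.1 := by rw [e, tgt_compArrow]
    have e2 : P.src ω.1 = P.tgt (ε a c γ).1 := by rw [src_compArrow, src_invArrow]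
    have e3 : compArrow γ (invArrow (ε a c γ)) (hε' a c γ) = compArrow δ' ω e1 :=
      Subtype.ext (P.assoc _ _ _ e e0)
    have e4 : compArrow ω (ε a c γ) e2 = ε' := by
      apply Subtype.ext
      change P.comp (P.comp _ (P.inv _)) _ = _
      rw [P.comp_cancel_inv]
      rw [hε, src_compArrow]
    have k1 := H₂.lift_comp_right h2' hg.isNat ω δ' e1
    have k2 := H₁.lift_comp_left h2' hg.isNat (ε a c γ) ω e2
    rw [e4] at k2
    rw [e3, k1, k2, P'.assoc]
    · exact hg.isNat.src_lift_eq_tgt_lift H₂ e1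
    · exact H₁.src_lift_eq_tgt_lift hg.isNat e2
  have split : ∀ (a : r.cover) (c : t.cover) (γ : Arrows a.1 c.1),
      compArrow (compArrow γ (invArrow (ε a c γ)) (hε' a c γ)) (ε a c γ) (hε2 a c γ) = γ := by
    intro a c γ
    exact Subtype.ext (P.comp_cancel_inv (hε a c γ).symm)
  have hNc : ∀ a c, Continuous (N a c) := by
    intro a c
    rw [continuous_iff_continuousAt]
    intro γ
    rw [← split a c γ]
    -- The choices `ε` need not vary continuously; by `hN` the middle chart chosen at `γ` may be
    -- used for all nearby arrows.
    exact continuousAt_of_split (hε2 a c γ)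
      (H₁.continuous_lift h1 h1' h2' hf.continuous _ _).continuousAt
      (H₂.continuous_lift h1 h1' h2' hg.continuous _ _).continuousAt univ_mem
      (fun ε' _ δ' e' => ⟨comp_ok e', hN _ _ _ _ _ _⟩)
  have key : ∃ η : GTransf r t, IsNat η f h ∧ ∀ a α γ, η a α (T.mk γ) = T.mk (N a α γ) := by
    refine exists_of_arrows hf.isNat hh.isNat N hNc ?_ ?_ ?_ ?_
    · intro a c γ
      rw [src_compArrow, H₁.src_lift_eq]
      rw [pt_srcPt, hε]
    · intro a c γ
      rw [tgt_compArrow, H₂.tgt_lift_eq]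
      rw [pt_tgtPt, tgt_compArrow]
    · intro a c d γ δ e
      have e1 : P.src δ.1 = P.tgt (compArrow γ (invArrow (ε a c γ)) (hε' a c γ)).1 := by
        rw [tgt_compArrow, e]
      have e2 : compArrow δ γ e = compArrow (compArrow δ _ e1) (ε a c γ)
          (by rw [src_compArrow, hε2]) := by
        apply Subtype.ext
        change _ = P.comp (P.comp δ.1 _) _
        rw [P.assoc _ _ _ e1 (hε2 a c γ)]
        exact congrArg (P.comp δ.1) (congrArg Subtype.val (split a c γ)).symm
      rw [e2, hN, H₂.lift_comp_left h2' hh.isNat _ _ e1, P'.assoc]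
      · rfl
      · exact H₂.src_lift_eq_tgt_lift hh.isNat e1
      · exact comp_ok (hε2 a c γ)
    · intro a b c γ δ e
      have e1 : P.src (ε b c δ).1 = P.tgt γ.1 := by rw [hε, e]
      have e2 : compArrow δ γ e = compArrow (compArrow δ (invArrow (ε b c δ)) (hε' b c δ))
          (compArrow (ε b c δ) γ e1) (by rw [hε2, tgt_compArrow]) := by
        apply Subtype.ext
        change _ = P.comp _ (P.comp _ γ.1)
        rw [← P.assoc _ _ _ (hε2 b c δ) e1]
        exact congrArg (fun z => P.comp z γ.1) (congrArg Subtype.val (split b c δ)).symm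
      rw [e2, hN, H₁.lift_comp_right h2' hf.isNat _ _ e1, ← P'.assoc]
      · rfl
      · exact comp_ok (hε2 b c δ)
      · exact hf.isNat.src_lift_eq_tgt_lift H₁ e1
  obtain ⟨η, hη, hηN⟩ := key
  refine ⟨η, hη, ?_⟩
  intro a b c x ξ ζ ω H
  obtain ⟨γ, δ, e, rfl, rfl, rfl, e4⟩ := H.elim
  exact ⟨H₁.lift γ, H₂.lift δ, N a c (compArrow δ γ e), H₁.mk_lift _, H₂.mk_lift _,
    (hηN _ _ _).symm, H₁.src_lift_eq e4, comp_ok e, hN _ _ _ _ _ _⟩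

/-- The composite of two natural transformations is determined by the composition law. -/
theorem comp_unique (h2' : P'.C2) (H₁ : IsNat η₁ f g)
    {η η' : GTransf r t} (H₂ : IsNat η₂ g h)
    (hη : ∀ (a : r.cover) (b : s.cover) (c : t.cover) (x : a.1.carrier) (ξ : T a.1 b.1)
        (ζ : T b.1 c.1) (ω : T a.1 c.1), T.CompAt x ξ ζ ω →
        T.CompAt (f a x) (η₁ a b ξ) (η₂ b c ζ) (η a c ω))
    (hη' : ∀ (a : r.cover) (b : s.cover) (c : t.cover) (x : a.1.carrier) (ξ : T a.1 b.1)
        (ζ : T b.1 c.1) (ω : T a.1 c.1), T.CompAt x ξ ζ ω →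
        T.CompAt (f a x) (η₁ a b ξ) (η₂ b c ζ) (η' a c ω)) : η = η' := by
  funext a c ω
  obtain ⟨γ, rfl⟩ := ω.exists_mk
  obtain ⟨b, ε, e⟩ := s.exists_arrow γ
  have e1 : P.src γ.1 = P.tgt (invArrow ε).1 := by rw [tgt_invArrow, e]
  have e2 : P.src (compArrow γ (invArrow ε) e1).1 = P.tgt ε.1 := by
    rw [src_compArrow, src_invArrow]
  have e3 : compArrow (compArrow γ (invArrow ε) e1) ε e2 = γ :=
    Subtype.ext (P.comp_cancel_inv e.symm)
  have H := T.CompAt.of_arrows ε (compArrow γ (invArrow ε) e1) e2 (pt_srcPt ε).symm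
  rw [e3] at H
  have k := hη _ _ _ _ _ _ _ H
  have k' := hη' _ _ _ _ _ _ _ H
  rw [← H₁.mk_lift, ← H₂.mk_lift] at k k'
  have ok : P'.src (H₂.lift (compArrow γ (invArrow ε) e1)).1 = P'.tgt (H₁.lift ε).1 := by
    rw [H₁.tgt_lift, H₂.src_lift_eq (e2.trans (pt_tgtPt _).symm)]
  rw [k.eq_mk h2' ok (H₁.src_lift ε), k'.eq_mk h2' ok (H₁.src_lift ε)]

end IsNat

end Transformations

end OrbispaceStr

namespace OrbispaceStr

/-! ### Restriction to finer covers, induced homomorphisms, equivalence. -/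

section Restriction

open Filter

variable {X : Type*} [TopologicalSpace X] {ι : Type*} {E : ι → Type*}
  [∀ i, TopologicalSpace (E i)] {G : ι → Type*} [∀ i, Group (G i)]
  {A : Type*} [TopologicalSpace A]
  {X' : Type*} [TopologicalSpace X'] {ι' : Type*} {E' : ι' → Type*}
  [∀ i, TopologicalSpace (E' i)] {G' : ι' → Type*} [∀ i, Group (G' i)]
  {A' : Type*} [TopologicalSpace A']
  {P : OrbispaceStr X E G A} {P' : OrbispaceStr X' E' G' A'}

theorem LocalChart.incl_rfl (c : LocalChart P) (x : c.carrier) :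
    LocalChart.incl (Set.Subset.refl c.units) x = x :=
  pt_injective c (LocalChart.pt_incl _ x)

theorem T.incl_rfl {c d : LocalChart P} (ξ : T c d) :
    T.incl (Set.Subset.refl c.units) (Set.Subset.refl d.units) ξ = ξ := by
  obtain ⟨γ, rfl⟩ := ξ.exists_mk
  rfl

theorem T.Maps.incl {c d c' d' : LocalChart P} (hc : c.units ⊆ c'.units)
    (hd : d.units ⊆ d'.units) {ξ : T c d} {x : c.carrier} {y : d.carrier} (h : ξ.Maps x y) :
    (T.incl hc hd ξ).Maps (LocalChart.incl hc x) (LocalChart.incl hd y) := by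
  obtain ⟨γ, rfl, e1, e2⟩ := h
  exact ⟨inclArrow hc hd γ, rfl, e1.trans (LocalChart.pt_incl hc x).symm,
    e2.trans (LocalChart.pt_incl hd y).symm⟩

theorem T.CompAt.incl {c d e c' d' e' : LocalChart P} (hc : c.units ⊆ c'.units)
    (hd : d.units ⊆ d'.units) (he : e.units ⊆ e'.units) {ξ : T c d} {η : T d e} {ζ : T c e}
    {x : c.carrier} (h : T.CompAt x ξ η ζ) :
    T.CompAt (LocalChart.incl hc x) (T.incl hc hd ξ) (T.incl hd he η) (T.incl hc he ζ) := by
  obtain ⟨γ, δ, ε, rfl, rfl, rfl, e1, e2, e3⟩ := h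
  exact ⟨inclArrow hc hd γ, inclArrow hd he δ, inclArrow hc he ε, rfl, rfl, rfl,
    e1.trans (LocalChart.pt_incl hc x).symm, e2, e3⟩

/-- The restriction of a shape to a cover by local charts contained in those of the shape. -/
def Shape.restrict (r : Shape P P') (C : Set (LocalChart P)) (hC : ∀ p : X, ∃ c ∈ C, p ∈ c.image)
    (θ : C → r.cover) (hθ : ∀ W, W.1.units ⊆ (θ W).1.units) : Shape P P' where
  cover := C
  covers := hC
  target W := r.target (θ W)
  rho W W' ξ := r.rho (θ W) (θ W') (T.incl (hθ W) (hθ W') ξ)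

/-- The restriction of the local maps of a homomorphism to smaller charts. -/
noncomputable def Shape.restrictMaps {r : Shape P P'} (f : r.LocalMaps) (C : Set (LocalChart P))
    (hC : ∀ p : X, ∃ c ∈ C, p ∈ c.image) (θ : C → r.cover)
    (hθ : ∀ W, W.1.units ⊆ (θ W).1.units) : (r.restrict C hC θ hθ).LocalMaps :=
  fun W x => f (θ W) (LocalChart.incl (hθ W) x)

theorem IsHom.restrict {r : Shape P P'} {f : r.LocalMaps} (hf : IsHom r f)
    (C : Set (LocalChart P)) (hC : ∀ p : X, ∃ c ∈ C, p ∈ c.image) (θ : C → r.cover)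
    (hθ : ∀ W, W.1.units ⊆ (θ W).1.units) :
    IsHom (r.restrict C hC θ hθ) (Shape.restrictMaps f C hC θ hθ) where
  continuous _ := (hf.continuous _).comp (LocalChart.continuous_incl _)
  maps W W' _ _ _ h := hf.maps _ _ _ _ _ (h.incl (hθ W) (hθ W'))
  comp W W' W'' _ _ _ _ h := hf.comp _ _ _ _ _ _ _ (h.incl (hθ W) (hθ W') (hθ W''))

theorem IsHom.isNat_restrict {r : Shape P P'} {f : r.LocalMaps} (hf : IsHom r f)
    (C : Set (LocalChart P)) (hC : ∀ p : X, ∃ c ∈ C, p ∈ c.image) (θ : C → r.cover)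
    (hθ : ∀ W, W.1.units ⊆ (θ W).1.units) :
    IsNat (r := r.restrict C hC θ hθ) (s := r)
      (fun W α ξ => r.rho (θ W) α (T.incl (hθ W) (Set.Subset.refl α.1.units) ξ))
      (Shape.restrictMaps f C hC θ hθ) f where
  maps W α ξ x y h := by
    have := hf.maps _ _ _ _ _ (h.incl (hθ W) (Set.Subset.refl α.1.units))
    rwa [LocalChart.incl_rfl] at this
  comp_left W α β ξ ζ ω x h := by
    have := hf.comp _ _ _ _ _ _ _
      (h.incl (hθ W) (Set.Subset.refl α.1.units) (Set.Subset.refl β.1.units))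
    rwa [T.incl_rfl] at this
  comp_right W W' α ξ ζ ω x h :=
    hf.comp _ _ _ _ _ _ _ (h.incl (hθ W) (hθ W') (Set.Subset.refl α.1.units))

/-- A natural transformation exhibits its source as induced by its target, via any data on the
side of the covers. -/
theorem IsNat.isInducedVia {r s : Shape P P'} {η : GTransf r s} {f : r.LocalMaps}
    {h : s.LocalMaps} (H : IsNat η f h) (θ : r.cover → s.cover) (ξ : ∀ a, T a.1 (θ a).1)
    (hξ : ∀ a x, ∃ y, (ξ a).Maps x y) :
    IsInducedVia s r h f θ ξ (fun a => η a (θ a) (ξ a)) where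
  maps a x := by
    obtain ⟨y, hy⟩ := hξ a x
    exact ⟨y, hy, H.maps _ _ _ _ _ hy⟩
  rho a b ζ ω μ x h1 h2 :=
    ⟨η a (θ b) μ, H.comp_left _ _ _ _ _ _ _ h1, H.comp_right _ _ _ _ _ _ _ h2⟩

/-- If `f` is induced by `h` via `(θ, ξ, ξ')` then there is exactly one natural transformation from
`f` to `h` with values `ξ'` on `ξ`. -/
theorem IsInducedVia.existsUnique_isNat (h1 : P.C1) (h2 : P.C2) (h1' : P'.C1) (h2' : P'.C2)
    {r s : Shape P P'} {f : r.LocalMaps} {h : s.LocalMaps} (hf : IsHom r f) (hh : IsHom s h)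
    {θ : r.cover → s.cover} {ξ : ∀ a, T a.1 (θ a).1}
    {ξ' : ∀ a, T (r.target a) (s.target (θ a))} (H : IsInducedVia s r h f θ ξ ξ') :
    ∃! η : GTransf r s, IsNat η f h ∧ ∀ a, η a (θ a) (ξ a) = ξ' a := by
  have Hh := hh.isNat
  have Hf := hf.isNat
  have ex : ∀ (a : r.cover) (x : a.1.carrier), ∃ (i : Arrows a.1 (θ a).1)
      (i' : Arrows (r.target a) (s.target (θ a))), T.mk i = ξ a ∧ T.mk i' = ξ' a ∧
      P.src i.1 = a.1.pt x ∧ P'.src i'.1 = (r.target a).pt (f a x) ∧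
      P'.tgt i'.1 = (s.target (θ a)).pt (h (θ a) (tgtPt i)) := by
    intro a x
    obtain ⟨y, ⟨i, e1, e2, e3⟩, ⟨i', e4, e5, e6⟩⟩ := H.maps a x
    exact ⟨i, i', e1, e4, e2, e5, by rw [e6, tgtPt_eq e3]⟩
  choose i i' hi hi' si si' ti' using ex
  -- the arrow `i a x` for the source `x` of an arrow
  have sI : ∀ (a : r.cover) (α : LocalChart P) (γ : Arrows a.1 α),
      P.src γ.1 = P.tgt (invArrow (i a (srcPt γ))).1 := by
    intro a α γ
    rw [tgt_invArrow, si, pt_srcPt]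
  have sD : ∀ (a : r.cover) (α : LocalChart P) (γ : Arrows a.1 α),
      P.src (compArrow γ (invArrow (i a (srcPt γ))) (sI a α γ)).1 =
        (θ a).1.pt (tgtPt (i a (srcPt γ))) := by
    intro a α γ
    rw [src_compArrow, src_invArrow, pt_tgtPt]
  have sN : ∀ (a : r.cover) (α : s.cover) (γ : Arrows a.1 α.1),
      P'.src (Hh.lift (compArrow γ (invArrow (i a (srcPt γ))) (sI a α.1 γ))).1 =
        P'.tgt (i' a (srcPt γ)).1 := by
    intro a α γ
    rw [ti', Hh.src_lift_eq (sD a α.1 γ)]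
  -- Naturality leaves no other choice: `γ = (γ i⁻¹) i` with `i` in the class `ξ a`, so the image is
  -- the `h`-image of `γ i⁻¹` times the prescribed arrow `i'`.
  let N : ∀ (a : r.cover) (α : s.cover), Arrows a.1 α.1 → Arrows (r.target a) (s.target α) :=
    fun a α γ => compArrow _ _ (sN a α γ)
  -- the value on a composite with an arrow of the class `ξ a`
  have hN : ∀ (a : r.cover) (α : s.cover) (ε : Arrows a.1 (θ a).1) (_ : T.mk ε = ξ a)
      (δ : Arrows (θ a).1 α.1) (e : P.src δ.1 = P.tgt ε.1),
      (N a α (compArrow δ ε e)).1 = P'.comp (Hh.lift δ).1 (i' a (srcPt ε)).1 := by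
    intro a α ε hε δ e
    have e1 : srcPt (compArrow δ ε e) = srcPt ε :=
      srcPt_eq ((src_compArrow _ _ _).trans (pt_srcPt ε).symm)
    have e2 : i a (srcPt ε) = ε :=
      T.eq_of_src_eq h2 ((hi _ _).trans hε.symm) ((si _ _).trans (pt_srcPt ε))
    change P'.comp (Hh.lift (compArrow (compArrow δ ε e)
      (invArrow (i a (srcPt (compArrow δ ε e)))) (sI a α.1 _))).1
      (i' a (srcPt (compArrow δ ε e))).1 = _
    have e3 : compArrow (compArrow δ ε e) (invArrow (i a (srcPt (compArrow δ ε e))))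
        (sI a α.1 _) = δ := by
      apply Subtype.ext
      change P.comp (P.comp δ.1 ε.1) (P.inv (i a (srcPt (compArrow δ ε e))).1) = δ.1
      rw [e1, e2, P.comp_inv_cancel e]
    rw [e3, e1]
  have i'cont : ∀ a, Continuous (i' a) := by
    intro a
    rw [continuous_iff_continuousAt]
    intro x
    refine tendsto_def.2 fun W hW => ?_
    have hW' : W ∩ {δ | T.mk δ = T.mk (i' a x)} ∈ 𝓝 (i' a x) :=
      inter_mem hW (T.eventually_mk_eq h1' _)
    have h3 := P'.isEtale.image_src_mem
      ((isOpen_arrows _ _).isOpenEmbedding_subtypeVal.image_mem_nhds.2 hW')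
    rw [si'] at h3
    have h4 := ((r.target a).continuous_pt.comp (hf.continuous a)).continuousAt h3
    refine mem_of_superset h4 ?_
    rintro z ⟨_, ⟨δ, ⟨hδ, hδ'⟩, rfl⟩, e⟩
    have : i' a z = δ := T.eq_of_src_eq h2' ((hi' _ _).trans ((hi' a x).symm.trans hδ'.symm))
      ((si' _ _).trans e.symm)
    rwa [Set.mem_preimage, this]
  have split : ∀ (a : r.cover) (α : s.cover) (γ : Arrows a.1 α.1),
      compArrow (compArrow γ (invArrow (i a (srcPt γ))) (sI a α.1 γ)) (i a (srcPt γ))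
        ((sD a α.1 γ).trans (pt_tgtPt _)) = γ :=
    fun a α γ => Subtype.ext (P.comp_cancel_inv (by rw [si, pt_srcPt]))
  have hNc : ∀ a α, Continuous (N a α) := by
    intro a α
    rw [continuous_iff_continuousAt]
    intro γ
    rw [← split a α γ]
    refine continuousAt_of_split (N₁ := fun ε => i' a (srcPt ε)) (N₂ := fun δ => Hh.lift δ)
      ((sD a α.1 γ).trans (pt_tgtPt _)) ((i'cont a).comp continuous_srcPt).continuousAt
      (Hh.continuous_lift h1 h1' h2' hh.continuous _ _).continuousAt
      (T.eventually_mk_eq h1 _) ?_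
    intro ε hε δ e
    have hε' : T.mk ε = ξ a := Eq.trans hε (hi a _)
    refine ⟨?_, hN a α ε hε' δ e⟩
    have e2 : i a (srcPt ε) = ε :=
      T.eq_of_src_eq h2 ((hi _ _).trans hε'.symm) ((si _ _).trans (pt_srcPt ε))
    rw [ti', e2, Hh.src_lift_eq (e.trans (pt_tgtPt _).symm)]
  have key : ∃ η : GTransf r s, IsNat η f h ∧ ∀ a α γ, η a α (T.mk γ) = T.mk (N a α γ) := by
    refine IsNat.exists_of_arrows Hf Hh N hNc ?_ ?_ ?_ ?_
    · intro a α γ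
      rw [src_compArrow, si']
    · intro a α γ
      rw [tgt_compArrow, Hh.tgt_lift_eq]
      rw [tgt_compArrow, pt_tgtPt]
    · intro a α β γ δ e
      have ok := (sD a α.1 γ).trans (pt_tgtPt _)
      have e1 : P.src δ.1 = P.tgt (compArrow γ (invArrow (i a (srcPt γ))) (sI a α.1 γ)).1 := by
        rw [tgt_compArrow, e]
      have e2 : compArrow δ γ e = compArrow (compArrow δ _ e1) (i a (srcPt γ))
          (by rw [src_compArrow, ok]) := by
        apply Subtype.ext
        change _ = P.comp (P.comp δ.1 _) _
        rw [P.assoc _ _ _ e1 ok]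
        exact congrArg (P.comp δ.1) (congrArg Subtype.val (split a α γ)).symm
      rw [e2, hN _ _ _ (hi _ _), Hh.lift_comp_left h2' Hh _ _ e1, P'.assoc]
      · have : srcPt (i a (srcPt γ)) = srcPt γ := srcPt_eq (si _ _)
        rw [this]
        rfl
      · exact Hh.src_lift_eq_tgt_lift Hh e1
      · rw [Hh.src_lift_eq (sD a α.1 γ), srcPt_eq (si _ _), ti']
    · intro a b α γ δ e
      have tγ : P.tgt γ.1 = b.1.pt (srcPt δ) := by rw [pt_srcPt, e]
      have e1 : P.src (i b (srcPt δ)).1 = P.tgt γ.1 := by rw [si, tγ]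
      have e2 : P.src γ.1 = P.tgt (invArrow (i a (srcPt γ))).1 := sI a b.1 γ
      -- Here `ω = i_b γ i_a⁻¹`, and `H.rho` compares the two ways around the resulting square: the
      -- two composites have the same class and the same source, hence agree.
      let ω := compArrow (compArrow (i b (srcPt δ)) γ e1) (invArrow (i a (srcPt γ)))
        ((src_compArrow _ _ _).trans e2)
      have sω : P.src ω.1 = P.tgt (i a (srcPt γ)).1 := by rw [src_compArrow, src_invArrow]
      have eμ : compArrow ω (i a (srcPt γ)) sω = compArrow (i b (srcPt δ)) γ e1 :=
        Subtype.ext (P.comp_cancel_inv (by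
          rw [src_compArrow, si, pt_srcPt]))
      have c1 := T.CompAt.of_arrows (i a (srcPt γ)) ω sω (si _ _)
      have c2 := T.CompAt.of_arrows γ (i b (srcPt δ)) e1 (pt_srcPt γ).symm
      rw [eμ, hi] at c1
      rw [hi] at c2
      obtain ⟨μ', c3, c4⟩ := H.rho a b (T.mk γ) (T.mk ω) _ _ c1 c2
      rw [← hi' a (srcPt γ), ← Hh.mk_lift] at c3
      rw [← hi' b (srcPt δ), ← Hf.mk_lift] at c4
      have sω' : P'.src (Hh.lift ω).1 = P'.tgt (i' a (srcPt γ)).1 := by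
        rw [ti', Hh.src_lift_eq (sω.trans (pt_tgtPt _).symm)]
      have sb' : P'.src (i' b (srcPt δ)).1 = P'.tgt (Hf.lift γ).1 := by
        rw [si', Hf.tgt_lift_eq tγ]
      have c5 := (c3.eq_mk h2' sω' (si' _ _)).symm.trans (c4.eq_mk h2' sb' (Hf.src_lift γ))
      have c6 := congrArg Subtype.val (T.eq_of_src_eq h2' c5 (by
        rw [src_compArrow, src_compArrow, si', Hf.src_lift]))
      have e3 : P.src (compArrow δ (invArrow (i b (srcPt δ))) (sI b α.1 δ)).1 = P.tgt ω.1 := by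
        rw [sD, pt_tgtPt, tgt_compArrow, tgt_compArrow]
      have e4 : compArrow δ γ e = compArrow (compArrow (compArrow δ (invArrow (i b (srcPt δ)))
          (sI b α.1 δ)) ω e3) (i a (srcPt γ)) (by rw [src_compArrow, sω]) := by
        apply Subtype.ext
        change P.comp δ.1 γ.1 = P.comp (P.comp _ ω.1) _
        rw [P.assoc _ _ _ e3 sω]
        change _ = P.comp _ (compArrow ω (i a (srcPt γ)) sω).1
        rw [eμ]
        change P.comp δ.1 γ.1 = P.comp (P.comp δ.1 (P.inv (i b (srcPt δ)).1))
          (P.comp (i b (srcPt δ)).1 γ.1)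
        rw [← P.assoc _ _ _ _ e1, P.comp_cancel_inv (by rw [si, pt_srcPt])]
        rw [P.src_comp _ _ (by rw [P.tgt_inv, si, pt_srcPt]), P.src_inv]
      rw [e4, hN _ _ _ (hi _ _), Hh.lift_comp_left h2' Hh _ _ e3, srcPt_eq (si _ _), P'.assoc]
      · change P'.comp _ (P'.comp (Hh.lift ω).1 (i' a (srcPt γ)).1) =
          P'.comp (P'.comp _ (i' b (srcPt δ)).1) _
        rw [P'.assoc _ _ _ (sN b α δ) sb']
        exact congrArg _ c6
      · exact Hh.src_lift_eq_tgt_lift Hh e3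
      · exact sω'
  obtain ⟨η, hη, hηN⟩ := key
  -- The arrow `i a x` is split as a unit times itself. The image of a unit is idempotent, hence a
  -- unit, so `N` takes `i a x` to `i' a x`.
  have hηξ : ∀ a, η a (θ a) (ξ a) = ξ' a := by
    intro a
    obtain ⟨x⟩ := a.1.isConnected_carrier.nonempty.to_subtype
    have hc : T.CompAt x (ξ a) (T.mk (⟨P.one (P.tgt (i a x).1), mem_arrows.2
        ⟨by rw [P.src_one]; exact tgt_mem_units _, by rw [P.tgt_one]; exact tgt_mem_units _⟩⟩ :
          Arrows (θ a).1 (θ a).1)) (ξ a) :=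
      ⟨i a x, _, i a x, hi a x, rfl, hi a x, si a x, P.src_one _, (P.one_comp _).symm⟩
    set u : Arrows (θ a).1 (θ a).1 := ⟨P.one (P.tgt (i a x).1), _⟩ with hu
    have e : P.src u.1 = P.tgt (i a x).1 := P.src_one _
    have e1 : compArrow u (i a x) e = i a x := Subtype.ext (P.one_comp _)
    have e2 := hN a (θ a) (i a x) (hi a x) u e
    rw [e1, srcPt_eq (si a x)] at e2
    have su' : P'.src (Hh.lift u).1 = P'.tgt (i' a x).1 := by
      rw [ti', Hh.src_lift_eq (e.trans (pt_tgtPt _).symm)]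
    have tu' : P'.tgt (Hh.lift u).1 = P'.src (Hh.lift u).1 := by
      have tu : P.tgt u.1 = P.src u.1 := (P.tgt_one _).trans (P.src_one _).symm
      rw [Hh.src_lift, Hh.tgt_lift_eq (tu.trans (pt_srcPt u).symm)]
    have e3 : compArrow u u (P.src_one _ |>.trans (P.tgt_one _).symm) = u := by
      apply Subtype.ext
      change P.comp (P.one _) (P.one _) = P.one _
      conv_lhs => rw [← P.src_one (P.tgt (i a x).1)]
      simp only [P.src_one]
      have := P.comp_one (P.one (P.tgt (i a x).1))
      rwa [P.src_one] at this
    have e4 := Hh.lift_comp_left h2' Hh u u (P.src_one _ |>.trans (P.tgt_one _).symm)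
    rw [e3] at e4
    have e5 := P'.one_eq_of_comp_self tu'.symm e4.symm
    rw [e5, su', P'.one_comp] at e2
    rw [← hi a x, hηN, ← hi' a x, Subtype.ext e2]
  refine ⟨η, ⟨hη, hηξ⟩, ?_⟩
  rintro η' ⟨hη', hη'ξ⟩
  funext a α ω
  obtain ⟨γ, rfl⟩ := ω.exists_mk
  have ok := (sD a α.1 γ).trans (pt_tgtPt _)
  have hc := T.CompAt.of_arrows (i a (srcPt γ)) _ ok (si _ _)
  rw [split, hi] at hc
  have k := hη.comp_left _ _ _ _ _ _ _ hc
  have k' := hη'.comp_left _ _ _ _ _ _ _ hc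
  rw [hηξ, ← hi' a (srcPt γ), ← Hh.mk_lift] at k
  rw [hη'ξ, ← hi' a (srcPt γ), ← Hh.mk_lift] at k'
  rw [k.eq_mk h2' (sN a α γ) (si' _ _), k'.eq_mk h2' (sN a α γ) (si' _ _)]

/-- Two homomorphisms are equivalent if and only if there is a natural transformation between
them. -/
theorem homEquiv_iff (h1 : P.C1) (h2 : P.C2) (h1' : P'.C1) (h2' : P'.C2) (σ τ : GroupoidHom P P') :
    HomEquiv P P' σ τ ↔ ∃ η : GTransf σ.1 τ.1, IsNat η σ.2.1 τ.2.1 := by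
  have nat_of_induces : ∀ σ κ : GroupoidHom P P', Induces σ κ →
      ∃ η : GTransf κ.1 σ.1, IsNat η κ.2.1 σ.2.1 := by
    rintro σ κ ⟨θ, ξ, ξ', H⟩
    obtain ⟨η, hη, -⟩ := H.existsUnique_isNat h1 h2 h1' h2' κ.2.2 σ.2.2
    exact ⟨η, hη.1⟩
  constructor
  · rintro ⟨κ, hσ, hτ⟩
    obtain ⟨η₁, H₁⟩ := nat_of_induces _ _ hσ
    obtain ⟨η₂, H₂⟩ := nat_of_induces _ _ hτ
    obtain ⟨η, hη, -⟩ := (IsNat.inv h2' κ.2.2.isNat σ.2.2.isNat H₁).exists_comp h1 h1' h2' σ.2.2 κ.2.2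
      τ.2.2 H₂
    exact ⟨η, hη⟩
  · rintro ⟨η, H⟩
    -- A common refinement: each chart of `C` lies inside a chart of `σ` and over the image of a
    -- chart of `τ`. The restriction of `σ` to `C` is induced by `σ`, and composing its inclusion
    -- with `η` shows that it is induced by `τ` as well.
    let C : Set (LocalChart P) := {W | ∃ (a : σ.1.cover) (α : τ.1.cover), W.units ⊆ a.1.units ∧
      W.image ⊆ α.1.image}
    have hC : ∀ p : X, ∃ c ∈ C, p ∈ c.image := by
      intro p
      obtain ⟨a, ha, hpa⟩ := σ.1.covers p
      obtain ⟨α, hα, hpα⟩ := τ.1.covers p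
      have hpa' := hpa
      rw [LocalChart.image_eq] at hpa'
      obtain ⟨u, hu, rfl⟩ := hpa'
      have hV := a.isOpen_image.inter α.isOpen_image
      refine ⟨LocalChart.component h1 hV u ⟨hpa, hpα⟩, ⟨⟨a, ha⟩, ⟨α, hα⟩, ?_, ?_⟩, ?_⟩
      · exact LocalChart.component_units_subset h1 hV u _ hu Set.inter_subset_left
      · exact (LocalChart.image_component_subset h1 hV u _).trans Set.inter_subset_right
      · exact LocalChart.proj_mem_image (LocalChart.mem_component h1 hV u _)
    choose θ φ hθ hφ using fun W : C => W.2
    have hκ := σ.2.2.restrict C hC θ hθ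
    have H₁ := σ.2.2.isNat_restrict C hC θ hθ
    obtain ⟨η₂, H₂, -⟩ := H₁.exists_comp h1 h1' h2' hκ σ.2.2 τ.2.2 H
    choose ξ hξ using fun W : C => T.exists_full h2 (c := W.1) (d := (θ W).1)
      (by rw [LocalChart.image_eq, LocalChart.image_eq]; exact Set.image_mono (hθ W))
    choose ξ₂ hξ₂ using fun W : C => T.exists_full h2 (hφ W)
    exact ⟨⟨_, _, hκ⟩, ⟨θ, ξ, _, H₁.isInducedVia θ ξ hξ⟩,
      ⟨φ, ξ₂, _, H₂.isInducedVia φ ξ₂ hξ₂⟩⟩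

theorem equivalence_homEquiv (h1 : P.C1) (h2 : P.C2) (h1' : P'.C1) (h2' : P'.C2) :
    Equivalence (HomEquiv P P') where
  refl σ := (homEquiv_iff h1 h2 h1' h2' _ _).2 ⟨_, σ.2.2.isNat⟩
  symm := by
    rintro σ τ ⟨κ, hσ, hτ⟩
    exact ⟨κ, hτ, hσ⟩
  trans := by
    intro σ τ υ
    rw [homEquiv_iff h1 h2 h1' h2', homEquiv_iff h1 h2 h1' h2', homEquiv_iff h1 h2 h1' h2']
    rintro ⟨η₁, H₁⟩ ⟨η₂, H₂⟩
    obtain ⟨η, hη, -⟩ := H₁.exists_comp h1 h1' h2' σ.2.2 τ.2.2 υ.2.2 H₂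
    exact ⟨η, hη⟩

end Restriction

end OrbispaceStr

namespace OrbispaceStr

/-! ### Existence of admissible charts and locally finite covers. -/

section AdmissibleCharts

open Filter

variable {X : Type*} [TopologicalSpace X] {ι : Type*} {E : ι → Type*}
  [∀ i, TopologicalSpace (E i)] {G : ι → Type*} [∀ i, Group (G i)]
  {A : Type*} [TopologicalSpace A] {P : OrbispaceStr X E G A}

theorem act_one (P : OrbispaceStr X E G A) (i : ι) (x : E i) : (P.act i).smul 1 x = x :=
  (P.act i).one_smul x

theorem act_mul (P : OrbispaceStr X E G A) (i : ι) (g h : G i) (x : E i) :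
    (P.act i).smul (g * h) x = (P.act i).smul g ((P.act i).smul h x) := (P.act i).mul_smul g h x

/-- The homeomorphism of a chart given by a group element. -/
def actHomeo (P : OrbispaceStr X E G A) (i : ι) (g : G i) : E i ≃ₜ E i where
  toFun := (P.act i).smul g
  invFun := (P.act i).smul g⁻¹
  left_inv x := by rw [← act_mul, inv_mul_cancel, act_one]
  right_inv x := by rw [← act_mul, mul_inv_cancel, act_one]
  continuous_toFun := P.continuous_act i g
  continuous_invFun := P.continuous_act i g⁻¹

theorem chartProj_act (P : OrbispaceStr X E G A) (i : ι) (g : G i) (x : E i) :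
    P.chartProj i ((P.act i).smul g x) = P.chartProj i x :=
  ((P.proj_chart_eq_iff i _ _).2 ⟨g, rfl⟩).symm

theorem continuous_chartProj (P : OrbispaceStr X E G A) (i : ι) : Continuous (P.chartProj i) :=
  P.continuous_proj.comp continuous_sigmaMk

namespace LocalChart

theorem chartProj_mem_image {c : LocalChart P} {x : E c.idx} (hx : x ∈ c.carrier) :
    P.chartProj c.idx x ∈ c.image := ⟨x, hx, rfl⟩

theorem subset_carrier (c : LocalChart P) {C : Set (E c.idx)} (hC : IsPreconnected C)
    (hp : ∀ x ∈ C, P.chartProj c.idx x ∈ c.image) (hne : (C ∩ c.carrier).Nonempty) :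
    C ⊆ c.carrier := by
  obtain ⟨x, hxC, hxc⟩ := hne
  have := c.subset_units (hC.image _ (continuous_sigmaMk (σ := E)).continuousOn)
    (by rintro _ ⟨y, hy, rfl⟩; exact hp y hy) ⟨_, ⟨x, hxC, rfl⟩, mem_units.2 hxc⟩
  exact fun y hy => mem_units.1 (this ⟨y, hy, rfl⟩)

/-- The translate of the chart is connected, has the same image and meets the chart, so it stays
inside; the inverse element gives the other inclusion. -/
theorem mem_group_of_mem {c : LocalChart P} {g : G c.idx} {x : E c.idx} (hx : x ∈ c.carrier)
    (hg : (P.act c.idx).smul g x ∈ c.carrier) : g ∈ c.group := by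
  have key : ∀ (g : G c.idx) (x : E c.idx), x ∈ c.carrier → (P.act c.idx).smul g x ∈ c.carrier →
      ∀ y ∈ c.carrier, (P.act c.idx).smul g y ∈ c.carrier := by
    intro g x hx hg y hy
    refine c.subset_carrier (C := (P.act c.idx).smul g '' c.carrier)
      (c.isConnected_carrier.isPreconnected.image _ (P.continuous_act _ g).continuousOn) ?_
      ⟨_, ⟨x, hx, rfl⟩, hg⟩ ⟨y, hy, rfl⟩
    rintro _ ⟨z, hz, rfl⟩
    rw [chartProj_act]
    exact chartProj_mem_image hz
  have e : ∀ y, (P.act c.idx).smul g⁻¹ ((P.act c.idx).smul g y) = y := fun y => by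
    rw [← act_mul, inv_mul_cancel, act_one]
  refine fun y => ⟨fun hy => ?_, fun hy => key g x hx hg y hy⟩
  have := key g⁻¹ _ hg (by rwa [e]) _ hy
  rwa [e] at this

end LocalChart

theorem IsParacompactLocallyCompactHausdorff.isCompact_preimage
    (hX : P.IsParacompactLocallyCompactHausdorff) {i : ι} {K : Set X} (hK : IsCompact K)
    (hsub : K ⊆ Set.range (P.chartProj i)) : IsCompact (P.chartProj i ⁻¹' K) := by
  have h1 : IsCompact ((Subtype.val : Set.range (P.chartProj i) → X) ⁻¹' K) := by
    rw [Subtype.isCompact_iff, Subtype.image_preimage_coe, Set.inter_eq_right.2 hsub]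
    exact hK
  exact (hX.proper_chart i).isCompact_preimage h1

theorem LocalChart.IsAdmissible.isCompact_closure_carrier
    (hX : P.IsParacompactLocallyCompactHausdorff) {c : LocalChart P} (hc : c.IsAdmissible) :
    IsCompact (closure c.carrier) := by
  refine (hX.isCompact_preimage hc.isCompact_closure hc.closure_subset).of_isClosed_subset
    isClosed_closure ?_
  rw [← Set.image_subset_iff, hc.image_closure]

/-- The stabilizer of a chart whose closure is compact over a compact set has finite index. -/
theorem LocalChart.finite_quotient_group (hX : P.IsParacompactLocallyCompactHausdorff)
    (c : LocalChart P) : Finite (G c.idx ⧸ c.group) := by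
  obtain ⟨x, hx⟩ := c.isConnected_carrier.nonempty
  have hK := hX.isCompact_preimage (i := c.idx) (K := {P.chartProj c.idx x}) isCompact_singleton
    (by rintro _ rfl; exact ⟨x, rfl⟩)
  obtain ⟨t, ht⟩ := hK.elim_finite_subcover
    (fun g : G c.idx => (P.act c.idx).smul g ⁻¹' c.carrier)
    (fun g => c.isOpen_carrier.preimage (P.continuous_act _ g)) (by
      intro y hy
      obtain ⟨g, rfl⟩ := (P.proj_chart_eq_iff c.idx _ _).1 hy
      exact Set.mem_iUnion.2 ⟨g, hx⟩)
  -- The fibre of `x` is covered by finitely many translates `g⁻¹ C` of the chart `C`, and `g (h x)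
  -- ∈ C` puts `h` in the coset of `g⁻¹`.
  refine Finite.of_surjective (fun g : t => (QuotientGroup.mk (g.1⁻¹) : G c.idx ⧸ c.group)) ?_
  intro q
  obtain ⟨h, rfl⟩ := QuotientGroup.mk_surjective q
  have hm : (P.act c.idx).smul h x ∈ P.chartProj c.idx ⁻¹' {P.chartProj c.idx x} := by
    rw [Set.mem_preimage, chartProj_act]
    rfl
  obtain ⟨g, hg⟩ := Set.mem_iUnion.1 (ht hm)
  obtain ⟨hgt, hg⟩ := Set.mem_iUnion.1 hg
  refine ⟨⟨g, hgt⟩, ?_⟩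
  rw [QuotientGroup.eq, inv_inv]
  refine LocalChart.mem_group_of_mem hx ?_
  rw [act_mul]
  exact hg

/-- For the component `C W` over a small neighbourhood `W`, two points of the closure might be
related only by elements outside the stabilizer. Stabilizers have finite index, so some `W₁` has the
least index. For `W₂` containing the closure of `W₁` the stabilizer contains that of `W₁` and, by
minimality, equals it. Since the closure of `C W₁` lies in `C W₂`, every element relating two points
of this closure belongs to the stabilizer. The desired chart is the interior of the closure. -/
theorem exists_isAdmissible (h1 : P.C1) (hX : P.IsParacompactLocallyCompactHausdorff)
    {u : Σ i, E i} {V : Set X} (hV : IsOpen V) (hu : P.proj u ∈ V) :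
    ∃ c : LocalChart P, c.IsAdmissible ∧ u ∈ c.units ∧ closure c.image ⊆ V := by
  have := hX.hausdorff
  have := hX.locallyCompact
  obtain ⟨i, x⟩ := u
  set V' : Set X := V ∩ Set.range (P.chartProj i) with hV'def
  have hV' : IsOpen V' := hV.inter (P.isOpen_range i)
  have hxV' : P.chartProj i x ∈ V' := ⟨hu, x, rfl⟩
  let F := {W : Set X // IsOpen W ∧ P.chartProj i x ∈ W ∧ closure W ⊆ V' ∧ IsCompact (closure W)}
  let ch : F → LocalChart P := fun W => LocalChart.component h1 W.2.1 ⟨i, x⟩ W.2.2.1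
  let H : F → Subgroup (G i) := fun W => (ch W).group
  let C : F → Set (E i) := fun W => (ch W).carrier
  have hxC : ∀ W, x ∈ C W := fun W => mem_connectedComponentIn W.2.2.1
  have hCW : ∀ W : F, C W ⊆ P.chartProj i ⁻¹' W.1 := fun W => connectedComponentIn_subset _ _
  have hfin : ∀ W, (H W).index ≠ 0 := fun W => by
    have := (ch W).finite_quotient_group hX
    exact Subgroup.index_ne_zero_of_finite (H := (ch W).group)
  have hne : Nonempty F := by
    obtain ⟨W, a1, a2, a3, a4⟩ := exists_open_between_and_isCompact_closure
      (isCompact_singleton (x := P.chartProj i x)) hV' (Set.singleton_subset_iff.2 hxV')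
    exact ⟨⟨W, a1, Set.singleton_subset_iff.1 a2, a3, a4⟩⟩
  -- a neighbourhood for which the number of translates of the chart is minimal
  obtain ⟨W₁, hmin⟩ : ∃ W₁, ∀ W, (H W₁).index ≤ (H W).index :=
    ⟨Function.argmin (fun W => (H W).index), 
      fun W => Function.argmin_le (fun W => (H W).index) W⟩
  obtain ⟨W₂, a1, a2, a3, a4⟩ := exists_open_between_and_isCompact_closure W₁.2.2.2.2 hV' W₁.2.2.2.1
  let W₂' : F := ⟨W₂, a1, a2 (subset_closure W₁.2.2.1), a3, a4⟩
  have hcl : closure (C W₁) ⊆ C W₂' := by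
    refine (isPreconnected_connectedComponentIn.closure).subset_connectedComponentIn
      (subset_closure (hxC W₁)) ?_
    intro y hy
    refine a2 (closure_mono (Set.image_subset_iff.2 (hCW W₁)) ?_)
    exact image_closure_subset_closure_image (P.continuous_chartProj i) ⟨y, hy, rfl⟩
  have hH12 : H W₁ ≤ H W₂' := by
    intro g hg
    exact LocalChart.mem_group_of_mem (c := ch W₂') (hxC W₂')
      (hcl (subset_closure ((hg x).2 (hxC W₁))))
  have hH21 : H W₂' ≤ H W₁ := by
    rw [← Subgroup.relIndex_eq_one]
    have e1 := Subgroup.relIndex_mul_index hH12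
    have e2 := hmin W₂'
    have e3 : (H W₁).relIndex (H W₂') ≠ 0 := fun h0 => hfin W₁ (by rw [← e1, h0, zero_mul])
    have e4 := Nat.pos_of_ne_zero (hfin W₂')
    by_contra hne1
    have : 2 ≤ (H W₁).relIndex (H W₂') := by omega
    nlinarith
  set D := interior (closure (C W₁)) with hD
  have hCopen : IsOpen (C W₁) := (ch W₁).isOpen_carrier
  have hCD : C W₁ ⊆ D := hCopen.subset_interior_iff.2 subset_closure
  have hDcl : D ⊆ closure (C W₁) := interior_subset
  have hclD : closure D = closure (C W₁) :=
    Set.Subset.antisymm (closure_minimal hDcl isClosed_closure) (closure_mono hCD)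
  have hinv : ∀ g ∈ H W₁, ∀ y, (P.act i).smul g y ∈ D ↔ y ∈ D := by
    intro g hg y
    have e1 : P.actHomeo i g ⁻¹' C W₁ = C W₁ := Set.ext fun z => hg z
    have e2 : P.actHomeo i g ⁻¹' D = D := by
      rw [hD, Homeomorph.preimage_interior, Homeomorph.preimage_closure, e1]
    exact Set.ext_iff.1 e2 y
  have hgrp : ∀ g : G i, ∀ y ∈ closure (C W₁), (P.act i).smul g y ∈ closure (C W₁) →
      g ∈ H W₁ := fun g y hy hgy =>
    hH21 (LocalChart.mem_group_of_mem (c := ch W₂') (hcl hy) (hcl hgy))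
  let c : LocalChart P :=
    { idx := i
      carrier := D
      isOpen_carrier := isOpen_interior
      isConnected_carrier := (ch W₁).isConnected_carrier.subset_closure hCD hDcl
      isComponent_carrier := by
        intro y hy
        have hpre : IsPreconnected D :=
          ((ch W₁).isConnected_carrier.subset_closure hCD hDcl).isPreconnected
        refine Set.Subset.antisymm ?_
          (hpre.subset_connectedComponentIn hy (Set.subset_preimage_image _ _))
        -- By `hgrp`, the points moved into `D` by elements outside the stabilizer form an open set
        -- disjoint from `D`. This set and `D` together cover the preimage of the image of `D`,
        -- which makes `D` a component.
        have hO : IsOpen {z | ∃ g, g ∉ H W₁ ∧ (P.act i).smul g z ∈ D} := by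
          have : {z | ∃ g, g ∉ H W₁ ∧ (P.act i).smul g z ∈ D} =
              ⋃ g, ⋃ _ : g ∉ H W₁, (P.act i).smul g ⁻¹' D := by
            ext z
            simp
          rw [this]
          exact isOpen_iUnion fun g => isOpen_iUnion fun _ =>
            isOpen_interior.preimage (P.continuous_act i g)
        have hdis : Disjoint D {z | ∃ g, g ∉ H W₁ ∧ (P.act i).smul g z ∈ D} := by
          rw [Set.disjoint_left]
          rintro z hz ⟨g, hg, hgz⟩
          exact hg (hgrp g z (hDcl hz) (hDcl hgz))
        refine IsPreconnected.subset_left_of_subset_union isOpen_interior hO hdis ?_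
          ⟨y, mem_connectedComponentIn ⟨y, hy, rfl⟩, hy⟩ isPreconnected_connectedComponentIn
        refine (connectedComponentIn_subset _ _).trans ?_
        rintro z ⟨w, hw, hwz⟩
        obtain ⟨g, rfl⟩ := (P.proj_chart_eq_iff i z w).1 hwz.symm
        by_cases hg : g ∈ H W₁
        · exact Or.inl ((hinv g hg z).1 hw)
        · exact Or.inr ⟨g, hg, hw⟩ }
  have hcimg : c.image ⊆ closure W₁.1 := by
    rintro _ ⟨y, hy, rfl⟩
    exact closure_mono (Set.image_subset_iff.2 (hCW W₁))
      (image_closure_subset_closure_image (P.continuous_chartProj i) ⟨y, hDcl hy, rfl⟩)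
  have hcimg' : closure c.image ⊆ closure W₁.1 := closure_minimal hcimg isClosed_closure
  have hW₁V : closure W₁.1 ⊆ V' := W₁.2.2.2.1
  -- Properness makes the closure of `D` compact, so its image is closed.
  have himg : P.chartProj i '' closure D = closure (P.chartProj i '' D) := by
    apply Set.Subset.antisymm (image_closure_subset_closure_image (P.continuous_chartProj i))
    refine closure_minimal (Set.image_mono subset_closure) (IsCompact.isClosed ?_)
    refine IsCompact.image ?_ (P.continuous_chartProj i)
    refine (hX.isCompact_preimage W₁.2.2.2.2
      (hW₁V.trans Set.inter_subset_right)).of_isClosed_subset isClosed_closure ?_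
    rw [hclD]
    rintro y hy
    exact closure_mono (Set.image_subset_iff.2 (hCW W₁))
      (image_closure_subset_closure_image (P.continuous_chartProj i) ⟨y, hy, rfl⟩)
  refine ⟨c, ⟨?_, ?_, ?_, himg, ?_⟩, ?_, ?_⟩
  · exact W₁.2.2.2.2.of_isClosed_subset isClosed_closure hcimg'
  · exact (hcimg'.trans hW₁V).trans Set.inter_subset_right
  · change interior (closure D) = D
    rw [hclD]
  · intro y hy z hz e
    change y ∈ closure D at hy
    change z ∈ closure D at hz
    rw [hclD] at hy hz
    obtain ⟨g, rfl⟩ := (P.proj_chart_eq_iff i y z).1 e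
    exact ⟨⟨g, fun w => hinv g (hgrp g y hy hz) w⟩, rfl⟩
  · exact (LocalChart.mem_units (c := c)).2 (hCD (hxC W₁))
  · exact (hcimg'.trans hW₁V).trans Set.inter_subset_left

theorem LocalChart.closure_units_subset {c d : LocalChart P} (h : closure c.image ⊆ d.image)
    {u : Σ i, E i} (hu : u ∈ c.units) (hud : u ∈ d.units) : closure c.units ⊆ d.units := by
  refine d.subset_units c.isPreconnected_units.closure ?_ ⟨u, subset_closure hu, hud⟩
  intro v hv
  apply h
  rw [c.image_eq]
  exact image_closure_subset_closure_image P.continuous_proj ⟨v, hv, rfl⟩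

/-- The admissible charts whose closures are contained in charts of a given cover form a basis
which contains a locally finite cover. -/
theorem exists_locallyFinite_cover (h1 : P.C1) (hX : P.IsParacompactLocallyCompactHausdorff)
    {B : Set (LocalChart P)} (hB : ∀ p : X, ∃ c ∈ B, p ∈ c.image) :
    ∃ C : Set (LocalChart P), (∀ p : X, ∃ c ∈ C, p ∈ c.image) ∧
      LocallyFinite (fun c : C => c.1.image) ∧
      ∀ c ∈ C, c.IsAdmissible ∧ ∃ b : B, closure c.units ⊆ b.1.units := by
  have := hX.hausdorff
  have := hX.locallyCompact
  have := hX.paracompact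
  have hK : ∀ p : X, ∃ W, IsOpen W ∧ p ∈ W ∧ IsCompact (closure W) := by
    intro p
    obtain ⟨W, a1, a2, -, a4⟩ := exists_open_between_and_isCompact_closure
      (isCompact_singleton (x := p)) isOpen_univ (Set.subset_univ _)
    exact ⟨W, a1, Set.singleton_subset_iff.1 a2, a4⟩
  choose W hWo hpW hWc using hK
  obtain ⟨O, hO, hOc, hOl, hOW⟩ := precise_refinement W hWo
    (Set.iUnion_eq_univ_iff.2 fun p => ⟨p, hpW p⟩)
  -- The shrunken sets `O' j` still cover, and their closures are compact and contained in the
  -- members `O j` of a locally finite cover. Finitely many admissible charts over `O j` therefore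
  -- suffice for each `j`.
  obtain ⟨O', hO'c, -, hO'⟩ := exists_iUnion_eq_closure_subset hO hOl.point_finite hOc
  have hcomp : ∀ j, IsCompact (closure (O' j)) := fun j =>
    (hWc j).of_isClosed_subset isClosed_closure ((hO' j).trans ((hOW j).trans subset_closure))
  have ex : ∀ (j : X) (p : X), p ∈ closure (O' j) → ∃ c : LocalChart P, c.IsAdmissible ∧
      p ∈ c.image ∧ c.image ⊆ O j ∧ ∃ b : B, closure c.units ⊆ b.1.units := by
    intro j p hp
    obtain ⟨b, hb, hpb⟩ := hB p
    have hpb' := hpb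
    rw [b.image_eq] at hpb'
    obtain ⟨u, hu, rfl⟩ := hpb'
    obtain ⟨c, c1, c2, c3⟩ := exists_isAdmissible h1 hX ((hO j).inter b.isOpen_image)
      ⟨hO' j hp, hpb⟩
    exact ⟨c, c1, LocalChart.proj_mem_image c2,
      (subset_closure.trans c3).trans Set.inter_subset_left, ⟨b, hb⟩,
      LocalChart.closure_units_subset (c3.trans Set.inter_subset_right) c2 hu⟩
  choose c hcadm hpc hcO hcb using ex
  choose t ht using fun j => (hcomp j).elim_nhds_subcover' (fun p hp => (c j p hp).image)
    (fun p hp => (c j p hp).isOpen_image.mem_nhds (hpc j p hp))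
  refine ⟨{d | ∃ j, ∃ p ∈ t j, d = c j p.1 p.2}, ?_, ?_, ?_⟩
  · intro p
    obtain ⟨j, hj⟩ := Set.iUnion_eq_univ_iff.1 hO'c p
    obtain ⟨q, hq, hpq⟩ := Set.mem_iUnion₂.1 (ht j (subset_closure hj))
    exact ⟨_, ⟨j, q, hq, rfl⟩, hpq⟩
  · intro p
    obtain ⟨N, hN, hfin⟩ := hOl p
    refine ⟨N, hN, ?_⟩
    apply Set.Finite.of_finite_image (f := Subtype.val) ?_ Subtype.val_injective.injOn
    refine (hfin.biUnion fun j _ => ((t j).finite_toSet.image fun q => c j q.1 q.2)).subset ?_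
    rintro _ ⟨⟨d, j, q, hq, rfl⟩, ⟨z, hz, hzN⟩, rfl⟩
    exact Set.mem_iUnion₂.2 ⟨j, ⟨z, hcO j _ _ hz, hzN⟩, q, hq, rfl⟩
  · rintro _ ⟨j, q, -, rfl⟩
    exact ⟨hcadm _ _ _, hcb _ _ _⟩

end AdmissibleCharts

/-! ### Admissible representatives of maps of orbispaces. -/

section Representation

open Filter

variable {X : Type*} [TopologicalSpace X] {ι : Type*} {E : ι → Type*}
  [∀ i, TopologicalSpace (E i)] {G : ι → Type*} [∀ i, Group (G i)]
  {A : Type*} [TopologicalSpace A]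
  {X' : Type*} [TopologicalSpace X'] {ι' : Type*} {E' : ι' → Type*}
  [∀ i, TopologicalSpace (E' i)] {G' : ι' → Type*} [∀ i, Group (G' i)]
  {A' : Type*} [TopologicalSpace A']
  {P : OrbispaceStr X E G A} {P' : OrbispaceStr X' E' G' A'}

theorem LocalChart.mk_mem_closure_units (c : LocalChart P) (x : closure c.carrier) :
    (⟨c.idx, x.1⟩ : Σ i, E i) ∈ closure c.units := by
  rw [c.closure_units]
  exact ⟨x.1, x.2, rfl⟩

/-- Every homomorphism is equivalent to an admissible one. -/
theorem exists_isAdmissible_isNat (h1 : P.C1)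
    (hX : P.IsParacompactLocallyCompactHausdorff) (σ : GroupoidHom P P') :
    ∃ (κ : GroupoidHom P P') (η : GTransf κ.1 σ.1), IsNat η κ.2.1 σ.2.1 ∧
      IsAdmissible κ.1 κ.2.1 := by
  obtain ⟨r, f, hf⟩ := σ
  obtain ⟨C, hC, hCl, hCB⟩ := exists_locallyFinite_cover h1 hX r.covers
  choose θ hθ' using fun c : C => (hCB c.1 c.2).2
  have hθ : ∀ c, c.1.units ⊆ (θ c).1.units := fun c => subset_closure.trans (hθ' c)
  refine ⟨⟨r.restrict C hC θ hθ, Shape.restrictMaps f C hC θ hθ, hf.restrict C hC θ hθ⟩, _,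
    hf.isNat_restrict C hC θ hθ, hCl, fun c hc => (hCB c hc).1, ?_⟩
  -- The closure of each small chart lies in a chart of `r`, so the values of `f` itself provide the
  -- extension.
  choose j hj using fun (c : C) (x : closure c.1.carrier) => hθ' c (c.1.mk_mem_closure_units x)
  have hjc : ∀ c, Continuous (j c) := by
    intro c
    rw [(θ c).1.isOpenEmbedding_pt.isEmbedding.continuous_iff]
    exact (continuous_sigmaMk.comp continuous_subtype_val).congr fun x => (hj c x).symm
  refine ⟨fun c x => f (θ c) (j c x), fun c => (hf.continuous _).comp (hjc c), ?_, ?_⟩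
  · intro c x
    change f (θ c) _ = f (θ c) _
    congr 1
    exact pt_injective _ ((hj _ _).trans (LocalChart.pt_incl (hθ c) x).symm)
  · intro c d x y γ _ hx hy
    have hγ : γ ∈ Arrows (θ c).1 (θ d).1 := ⟨⟨_, hx.trans (hj c x).symm⟩, ⟨_, hy.trans (hj d y).symm⟩⟩
    let γ₀ : Arrows (θ c).1 (θ d).1 := ⟨γ, hγ⟩
    refine ⟨hf.isNat.lift γ₀, hf.isNat.src_lift_eq (hx.trans (hj c x).symm),
      hf.isNat.tgt_lift_eq (hy.trans (hj d y).symm), (T.mk γ₀).arrows,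
      (T.isOpen_arrows h1 _).mem_nhds (T.mem_arrows_mk γ₀), ?_⟩
    rintro δ ⟨δ', h3, h4⟩
    have : δ' = inclArrow (hθ c) (hθ d) δ := Subtype.ext h4
    subst this
    change r.rho _ _ (T.mk _) = _
    rw [h3]
    exact (hf.isNat.mk_lift γ₀).symm

theorem exists_homSpace_toOrbMap_eq (h1 : P.C1) (h2 : P.C2) (h1' : P'.C1) (h2' : P'.C2)
    (hX : P.IsParacompactLocallyCompactHausdorff) (Φ : OrbMap P P') :
    ∃ (r : AdmShape P P') (f : HomSpace r), f.toOrbMap = Φ := by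
  obtain ⟨σ, rfl⟩ := Quot.exists_rep Φ
  obtain ⟨κ, η, hη, hκ⟩ := exists_isAdmissible_isNat h1 hX σ
  exact ⟨⟨κ.1, κ.2.1, κ.2.2, hκ⟩, ⟨κ.2.1, κ.2.2, hκ⟩,
    Quot.sound ((homEquiv_iff h1 h2 h1' h2' _ _).2 ⟨η, hη⟩)⟩

/-- Equality in the quotient means the equivalence relation generated by `HomEquiv`, which is
`HomEquiv` itself, and this amounts to the existence of a transformation. -/
theorem toOrbMap_eq_iff (h1 : P.C1) (h2 : P.C2) (h1' : P'.C1) (h2' : P'.C2)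
    {r s : AdmShape P P'} (f : HomSpace r) (h : HomSpace s) :
    f.toOrbMap = h.toOrbMap ↔ ∃ η : Transf r s, IsTransf η f h := by
  have key : f.toOrbMap = h.toOrbMap ↔
      HomEquiv P P' ⟨r.1, f.1, f.2.1⟩ ⟨s.1, h.1, h.2.1⟩ := by
    constructor
    · intro e
      exact (equivalence_homEquiv h1 h2 h1' h2').eqvGen_iff.1 (Quot.eqvGen_exact e)
    · exact fun e => Quot.sound e
  refine key.trans ((homEquiv_iff h1 h2 h1' h2' _ _).trans ?_)
  exact ⟨fun ⟨η, H⟩ => ⟨η, H.isTransf⟩, fun ⟨η, H⟩ => ⟨η, H.isNat⟩⟩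

end Representation

end OrbispaceStr

namespace OrbispaceStr

/-! ### Limits of classes at boundary points of charts. -/

section LimitClasses

open Filter

variable {X : Type*} [TopologicalSpace X] {ι : Type*} {E : ι → Type*}
  [∀ i, TopologicalSpace (E i)] {G : ι → Type*} [∀ i, Group (G i)]
  {A : Type*} [TopologicalSpace A]
  {X' : Type*} [TopologicalSpace X'] {ι' : Type*} {E' : ι' → Type*}
  [∀ i, TopologicalSpace (E' i)] {G' : ι' → Type*} [∀ i, Group (G' i)]
  {A' : Type*} [TopologicalSpace A']
  {P : OrbispaceStr X E G A} {P' : OrbispaceStr X' E' G' A'}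

/-- A point of the closure of a local chart, as a unit of the groupoid. -/
def LocalChart.cpt (c : LocalChart P) (x : closure c.carrier) : Σ i, E i := ⟨c.idx, x.1⟩

theorem LocalChart.continuous_cpt (c : LocalChart P) : Continuous c.cpt :=
  continuous_sigmaMk.comp continuous_subtype_val

theorem LocalChart.cpt_mem (c : LocalChart P) (x : closure c.carrier) :
    c.cpt x ∈ closure c.units := c.mk_mem_closure_units x

theorem LocalChart.proj_cpt_mem (c : LocalChart P) (x : closure c.carrier) :
    P.proj (c.cpt x) ∈ closure c.image := by
  rw [c.image_eq]
  exact image_closure_subset_closure_image P.continuous_proj ⟨_, c.cpt_mem x, rfl⟩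

/-- A point of a local chart, as a point of its closure. -/
def LocalChart.toClosure (c : LocalChart P) (x : c.carrier) : closure c.carrier :=
  ⟨x.1, subset_closure x.2⟩

theorem LocalChart.continuous_toClosure (c : LocalChart P) : Continuous c.toClosure :=
  continuous_subtype_val.subtype_mk _

/-- The value `τ` of a map of classes near an arrow `γ` which need not belong to the charts. -/
def LimClass {c d : LocalChart P} {c' d' : LocalChart P'} (η : T c d → T c' d') (γ : A)
    (τ : T c' d') : Prop :=
  ∀ᶠ δ in 𝓝 γ, ∀ h : δ ∈ Arrows c d, η (T.mk ⟨δ, h⟩) = τ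

theorem limClass_mk (h1 : P.C1) {c d : LocalChart P} {c' d' : LocalChart P'} (η : T c d → T c' d')
    (γ : Arrows c d) : LimClass η γ.1 (η (T.mk γ)) := by
  filter_upwards [(T.isOpen_arrows h1 (T.mk γ)).mem_nhds (T.mem_arrows_mk γ)] with δ hδ h
  obtain ⟨δ', h3, rfl⟩ := hδ
  exact congrArg η h3

/-- Off the closure of the arrows `LimClass` is vacuous; membership in the closure supplies an arrow
on which both values are attained. -/
theorem LimClass.unique {c d : LocalChart P} {c' d' : LocalChart P'} {η : T c d → T c' d'} {γ : A}
    {τ τ' : T c' d'} (hγ : γ ∈ closure (Arrows c d)) (h : LimClass η γ τ) (h' : LimClass η γ τ') :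
    τ = τ' := by
  obtain ⟨δ, hδ, h3, h4⟩ := ((mem_closure_iff_frequently.1 hγ).and_eventually (h.and h')).exists
  exact (h3 hδ).symm.trans (h4 hδ)

/-- Arrows near `γ` with source in `c` have targets filling a neighbourhood of the target of `γ`,
and this meets `d`. -/
theorem mem_closure_arrows {c d : LocalChart P} {γ : A} (hs : P.src γ ∈ c.units)
    (ht : P.tgt γ ∈ closure d.units) : γ ∈ closure (Arrows c d) := by
  rw [mem_closure_iff_nhds]
  intro N hN
  have h1 : N ∩ P.src ⁻¹' c.units ∈ 𝓝 γ :=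
    inter_mem hN (P.continuous_src.continuousAt (c.isOpen_units.mem_nhds hs))
  obtain ⟨_, ⟨δ, ⟨h2, h3⟩, rfl⟩, h4⟩ := mem_closure_iff_nhds.1 ht _ (P.isEtale.image_tgt_mem h1)
  exact ⟨δ, h2, mem_arrows.2 ⟨h3, h4⟩⟩

theorem T.CompAt.maps_iff (h2 : P.C2) {c d e : LocalChart P} {ξ : T c d} {η : T d e} {ζ : T c e}
    {x : c.carrier} {y : d.carrier} (h : T.CompAt x ξ η ζ) (hy : ξ.Maps x y) {w : e.carrier} :
    η.Maps y w ↔ ζ.Maps x w := by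
  obtain ⟨γ, δ, e1, rfl, rfl, rfl, e4⟩ := h.elim
  obtain ⟨γ', f1, f2, f3⟩ := hy
  obtain rfl := T.eq_of_src_eq h2 f1 (f2.trans e4.symm)
  have sδ : P.src δ.1 = d.pt y := e1.trans f3
  have tc : P.tgt (compArrow δ γ' e1).1 = P.tgt δ.1 := tgt_compArrow _ _ _
  constructor
  · rintro ⟨δ', g1, g2, g3⟩
    obtain rfl := T.eq_of_src_eq h2 g1 (g2.trans sδ.symm)
    exact ⟨compArrow δ' γ' e1, rfl, (src_compArrow _ _ _).trans e4, tc.trans g3⟩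
  · rintro ⟨ε, g1, g2, g3⟩
    obtain rfl := T.eq_of_src_eq h2 g1 (g2.trans ((src_compArrow _ _ _).trans e4).symm)
    exact ⟨δ, rfl, sδ, tc.symm.trans g3⟩

/-- Right cancellation of `ξ`: associativity gives `η₃ ξ = (η₂ η₁) ξ` at `x`. This transfers a law
known after precomposition with arrows out of one cover to the charts of another. -/
theorem T.CompAt.of_comp (h2 : P.C2) {b c d e : LocalChart P} {ξ : T b c} {ξ₂ : T b d}
    {ξ₃ : T b e} {η₁ : T c d} {η₂ : T d e} {η₃ : T c e} {x : b.carrier} {y : c.carrier}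
    (hy : ξ.Maps x y) (h₁ : T.CompAt x ξ η₁ ξ₂) (h₂ : T.CompAt x ξ₂ η₂ ξ₃)
    (h₃ : T.CompAt x ξ η₃ ξ₃) : T.CompAt y η₁ η₂ η₃ := by
  obtain ⟨γ, δ, e1, rfl, rfl, rfl, e4⟩ := h₁.elim
  obtain ⟨γ₂, δ₂, e2, a1, rfl, rfl, a4⟩ := h₂.elim
  obtain rfl := T.eq_of_src_eq h2 a1 (a4.trans ((src_compArrow _ _ _).trans e4).symm)
  obtain ⟨γ', f1, f2, f3⟩ := hy
  obtain rfl := T.eq_of_src_eq h2 f1 (f2.trans e4.symm)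
  have e5 : P.src δ₂.1 = P.tgt δ.1 := e2.trans (tgt_compArrow _ _ _)
  refine ⟨δ, δ₂, compArrow δ₂ δ e5, rfl, rfl, ?_, e1.trans f3, e5, rfl⟩
  obtain ⟨γ₃, δ₃, e6, b1, rfl, b3, b4⟩ := h₃.elim
  obtain rfl := T.eq_of_src_eq h2 b1 (b4.trans e4.symm)
  have e7 := congrArg Subtype.val (T.eq_of_src_eq h2 b3 (by
    rw [src_compArrow, src_compArrow, src_compArrow]))
  congr 1
  apply Subtype.ext
  change P.comp δ₂.1 δ.1 = δ₃.1
  change P.comp δ₃.1 γ₃.1 = P.comp δ₂.1 (P.comp δ.1 γ₃.1) at e7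
  rw [← P.assoc _ _ _ e5 e1] at e7
  exact (P.comp_right_cancel e6 ((src_compArrow δ₂ δ e5).trans e1) e7).symm

/-- A composition law passes to limits of arrows, and persists on connected sets. -/
theorem compAt_of_limClass (h1' : P'.C1) (h2' : P'.C2) {c d e : LocalChart P}
    {c' d' e' : LocalChart P'} {η₁ : T c d → T c' d'} {η₂ : T d e → T d' e'}
    {η₃ : T c e → T c' e'} {f : c.carrier → c'.carrier} (hf : Continuous f)
    (H : ∀ x ξ ζ ω, T.CompAt x ξ ζ ω → T.CompAt (f x) (η₁ ξ) (η₂ ζ) (η₃ ω)) {γ δ : A}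
    {x : c.carrier} (hx : P.src γ = c.pt x) (hδγ : P.src δ = P.tgt γ)
    (hδ : δ ∈ closure (Arrows d e)) {τ₁ : T c' d'} {τ₂ : T d' e'} {τ₃ : T c' e'}
    (l₁ : LimClass η₁ γ τ₁) (l₂ : LimClass η₂ δ τ₂) (l₃ : LimClass η₃ (P.comp δ γ) τ₃)
    {O : Set c'.carrier} (hO : IsOpen O) (hOc : IsPreconnected O) (hxO : f x ∈ O)
    (hOd : ∀ z ∈ O, P'.proj (c'.pt z) ∈ d'.image) (hOe : ∀ z ∈ O, P'.proj (c'.pt z) ∈ e'.image)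
    {z : c'.carrier} (hz : z ∈ O) : T.CompAt z τ₁ τ₂ τ₃ := by
  obtain ⟨W₂, hW₂, W₁, hW₁, hW⟩ := P.comp_mem_of_nhds hδγ l₃
  have m₁ : {γ' | ∀ h : γ' ∈ Arrows c d, η₁ (T.mk ⟨γ', h⟩) = τ₁} ∩ W₁ ∩
      P.src ⁻¹' (c.pt '' (f ⁻¹' O)) ∈ 𝓝 γ := by
    refine inter_mem (inter_mem l₁ hW₁) (P.continuous_src.continuousAt ?_)
    rw [hx, c.isOpenEmbedding_pt.image_mem_nhds]
    exact hf.continuousAt (hO.mem_nhds hxO)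
  have m₂ : {δ' | ∀ h : δ' ∈ Arrows d e, η₂ (T.mk ⟨δ', h⟩) = τ₂} ∩ W₂ ∩
      P.src ⁻¹' (P.tgt '' ({γ' | ∀ h : γ' ∈ Arrows c d, η₁ (T.mk ⟨γ', h⟩) = τ₁} ∩ W₁ ∩
      P.src ⁻¹' (c.pt '' (f ⁻¹' O)))) ∈ 𝓝 δ := by
    refine inter_mem (inter_mem l₂ hW₂) (P.continuous_src.continuousAt ?_)
    rw [hδγ]
    exact P.isEtale.image_tgt_mem m₁
  -- Composable arrows near `γ` and `δ` which do lie between the charts, with `f x' ∈ O`. The law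
  -- holds for them and continues over `O`.
  obtain ⟨δ', ⟨⟨n1, n2⟩, γ', ⟨⟨n3, n4⟩, ⟨x', n5, n6⟩⟩, n7⟩, hδ'⟩ := mem_closure_iff_nhds.1 hδ _ m₂
  have hγ' : γ' ∈ Arrows c d := ⟨⟨x', n6.symm⟩, by rw [n7]; exact hδ'.1⟩
  have key := H x' _ _ _ (T.CompAt.of_arrows ⟨γ', hγ'⟩ ⟨δ', hδ'⟩ n7.symm n6.symm)
  have n8 : η₃ (T.mk (compArrow ⟨δ', hδ'⟩ ⟨γ', hγ'⟩ n7.symm)) = τ₃ :=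
    hW _ n2 _ n4 n7.symm (compArrow ⟨δ', hδ'⟩ ⟨γ', hγ'⟩ n7.symm).2
  rw [n3 hγ', n1 hδ', n8] at key
  exact key.of_isPreconnected h1' h2' hOc n5 hOd hOe hz

/-- Extensions of a homomorphism to the closures of the charts. -/
structure IsExtension (r : Shape P P') (f : r.LocalMaps)
    (F : ∀ α : r.cover, closure α.1.carrier → (r.target α).carrier) : Prop where
  continuous : ∀ α, Continuous (F α)
  eq : ∀ (α : r.cover) (x : α.1.carrier), F α (α.1.toClosure x) = f α x
  arrows : ∀ (α β : r.cover) (x : closure α.1.carrier) (y : closure β.1.carrier) (γ : A),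
    γ ∈ closure (Arrows α.1 β.1) → P.src γ = α.1.cpt x → P.tgt γ = β.1.cpt y →
      ∃ γ' : Arrows (r.target α) (r.target β), P'.src γ'.1 = (r.target α).pt (F α x) ∧
        P'.tgt γ'.1 = (r.target β).pt (F β y) ∧ LimClass (r.rho α β) γ (T.mk γ')

theorem IsAdmissible.exists_isExtension {r : Shape P P'} {f : r.LocalMaps}
    (h : IsAdmissible r f) : ∃ F, IsExtension r f F := by
  obtain ⟨F, a1, a2, a3⟩ := h.extend
  refine ⟨F, a1, a2, fun α β x y γ hγ hx hy => ?_⟩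
  obtain ⟨γ', b1, b2, N, hN, b3⟩ := a3 α β x y γ hγ hx hy
  exact ⟨γ', b1, b2, mem_of_superset hN fun δ hδ hδA => b3 ⟨δ, hδA⟩ hδ⟩

theorem IsExtension.isAdmissible {r : Shape P P'} {f g : r.LocalMaps} (h : IsAdmissible r f)
    {F : ∀ α : r.cover, closure α.1.carrier → (r.target α).carrier} (hF : IsExtension r g F) :
    IsAdmissible r g where
  locallyFinite := h.locallyFinite
  charts := h.charts
  extend := by
    refine ⟨F, hF.continuous, hF.eq, fun α β x y γ hγ hx hy => ?_⟩
    obtain ⟨γ', b1, b2, b3⟩ := hF.arrows α β x y γ hγ hx hy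
    exact ⟨γ', b1, b2, _, b3, fun δ hδ => hδ δ.2⟩

section Extension

variable {r s : Shape P P'} {η : GTransf r s} {f : r.LocalMaps} {h : s.LocalMaps}
  {F : ∀ α : r.cover, closure α.1.carrier → (r.target α).carrier}
  {K : ∀ α : s.cover, closure α.1.carrier → (s.target α).carrier}

/-- Natural transformations extend to arrows ending at boundary points of the charts. -/
theorem IsNat.exists_limClass (h1 : P.C1) (h1' : P'.C1) (h2' : P'.C2) (hf : IsHom r f)
    (hh : IsHom s h) (H : IsNat η f h) (hK : IsExtension s h K) {a : r.cover} {α : s.cover} {γ : A}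
    {x : a.1.carrier} {y : closure α.1.carrier} (hx : P.src γ = a.1.pt x)
    (hy : P.tgt γ = α.1.cpt y) :
    ∃ γ' : Arrows (r.target a) (s.target α), P'.src γ'.1 = (r.target a).pt (f a x) ∧
      P'.tgt γ'.1 = (s.target α).pt (K α y) ∧ LimClass (η a α) γ (T.mk γ') := by
  -- `γ` is factored through a chart `β` of `s`: `γ₂` runs between charts and is mapped by `η`,
  -- while `γ₃` ends in the closure of `α` and is mapped by the extension `K`.
  obtain ⟨β, hβ, hp⟩ := s.covers (P.proj (a.1.pt x))
  lift β to s.cover using hβ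
  obtain ⟨γ₂, hγ₂⟩ := LocalChart.exists_arrow_of_proj_mem hp
  have e : P.src γ = P.tgt (P.inv γ₂.1) := by rw [P.tgt_inv, hx, hγ₂]
  set γ₃ := P.comp γ (P.inv γ₂.1) with hγ₃
  have s₃ : P.src γ₃ = P.tgt γ₂.1 := by rw [P.src_comp _ _ e, P.src_inv]
  have t₃ : P.tgt γ₃ = α.1.cpt y := by rw [P.tgt_comp _ _ e, hy]
  have e₃ : P.comp γ₃ γ₂.1 = γ := P.comp_cancel_inv (hx.trans hγ₂.symm)
  obtain ⟨γ₃', a1, a2, a3⟩ := hK.arrows β α (β.1.toClosure (tgtPt γ₂)) y γ₃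
    (mem_closure_arrows (by rw [s₃]; exact tgt_mem_units γ₂) (by rw [t₃]; exact α.1.cpt_mem y))
    (s₃.trans (pt_tgtPt γ₂).symm) t₃
  rw [hK.eq] at a1
  have ok : P'.src γ₃'.1 = P'.tgt (H.lift γ₂).1 := by rw [a1, H.tgt_lift]
  refine ⟨compArrow γ₃' (H.lift γ₂) ok, ?_, ?_, ?_⟩
  · rw [src_compArrow, H.src_lift_eq hγ₂]
  · rw [tgt_compArrow, a2]
  set κ := compArrow γ₃' (H.lift γ₂) ok with hκ
  obtain ⟨W₃, hW₃, W₂, hW₂, hW⟩ := P'.comp_mem_of_nhds ok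
    ((T.isOpen_arrows h1' (T.mk κ)).mem_nhds (T.mem_arrows_mk κ))
  have m₃ : P'.src '' (W₃ ∩ (T.mk γ₃').arrows) ∈ 𝓝 (P'.tgt (H.lift γ₂).1) := by
    rw [← ok]
    exact P'.isEtale.image_src_mem
      (inter_mem hW₃ ((T.isOpen_arrows h1' _).mem_nhds (T.mem_arrows_mk _)))
  have m₂ : W₂ ∩ P'.tgt ⁻¹' (P'.src '' (W₃ ∩ (T.mk γ₃').arrows)) ∈ 𝓝 (H.lift γ₂).1 :=
    inter_mem hW₂ (P'.continuous_tgt.continuousAt m₃)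
  have m₂' := (isOpen_arrows a.1 β.1).isOpenEmbedding_subtypeVal.image_mem_nhds.2
    ((continuous_subtype_val.comp
      (H.continuous_lift h1 h1' h2' hf.continuous a β)).continuousAt m₂)
  -- Arrows near `γ` split into arrows near `γ₃` and `γ₂`, whose images compose to an arrow of the
  -- class of `κ`.
  have := P.isEtale.eventually_exists_comp s₃ a3 m₂'
  rw [e₃] at this
  filter_upwards [this] with δ ⟨δ₃, n1, _, ⟨δ₂, ⟨n2, n3⟩, rfl⟩, n4, n5⟩ hδ
  have hδ₃ : δ₃ ∈ Arrows β.1 α.1 := by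
    rw [mem_arrows, n4, ← P.tgt_comp _ _ n4, n5]
    exact ⟨tgt_mem_units _, (mem_arrows.1 hδ).2⟩
  have n6 : (⟨δ, hδ⟩ : Arrows a.1 α.1) = compArrow ⟨δ₃, hδ₃⟩ δ₂ n4 := Subtype.ext n5.symm
  rw [← H.mk_lift, n6]
  have n7 := H.lift_comp_left h2' hh.isNat δ₂ ⟨δ₃, hδ₃⟩ n4
  have n8 := H.src_lift_eq_tgt_lift hh.isNat (γ := δ₂) (δ := ⟨δ₃, hδ₃⟩) n4
  obtain ⟨_, ⟨n9, ⟨δ', n10, rfl⟩⟩, n11⟩ := n3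
  have n12 : hh.isNat.lift ⟨δ₃, hδ₃⟩ = δ' :=
    T.eq_of_src_eq h2' (by rw [hh.isNat.mk_lift, n1 hδ₃, n10]) (n8.trans n11.symm)
  rw [n12] at n7 n8
  obtain ⟨ε, n13, n14⟩ := hW _ n9 _ n2 n8
  rw [← n13]
  congr 1
  exact Subtype.ext (n7.trans n14.symm)

/-- Both boundary points are reached by arrows from one genuine point `z` of a chart of `r`; the
limits of their images join `f z` to both values. -/
theorem IsNat.proj_eq (h1 : P.C1) (h1' : P'.C1) (h2' : P'.C2) (hf : IsHom r f) (hh : IsHom s h)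
    (H : IsNat η f h) (hF : IsExtension r f F) (hK : IsExtension s h K) {a : r.cover}
    {α : s.cover} {x : closure a.1.carrier} {y : closure α.1.carrier}
    (hxy : P.proj (a.1.cpt x) = P.proj (α.1.cpt y)) :
    P'.proj ((r.target a).pt (F a x)) = P'.proj ((s.target α).pt (K α y)) := by
  obtain ⟨b, hb, hp⟩ := r.covers (P.proj (a.1.cpt x))
  lift b to r.cover using hb
  rw [LocalChart.image_eq] at hp
  obtain ⟨_, ⟨z, rfl⟩, hz⟩ := hp
  obtain ⟨γ, hγ, hγ'⟩ := (P.proj_eq_iff _ _).1 hz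
  obtain ⟨δ, hδ, hδ'⟩ := (P.proj_eq_iff _ _).1 (hz.trans hxy)
  obtain ⟨γ₁, e1, e2, -⟩ := hf.isNat.exists_limClass h1 h1' h2' hf hf hF hγ hγ'
  obtain ⟨δ₁, e3, e4, -⟩ := H.exists_limClass h1 h1' h2' hf hh hK hδ hδ'
  rw [← e2, ← e4, ← P'.proj_src, ← P'.proj_src, e1, e3]

/-- By admissibility a point of the closure of `α.image` comes from the closed chart, where the
extension `K` takes values in the target chart. -/
theorem IsNat.proj_mem_image (h1 : P.C1) (h1' : P'.C1) (h2' : P'.C2) (hf : IsHom r f)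
    (hh : IsHom s h) (H : IsNat η f h) (hF : IsExtension r f F) (hs : IsAdmissible s h)
    {a : r.cover} {α : s.cover} {x : closure a.1.carrier}
    (hx : P.proj (a.1.cpt x) ∈ closure α.1.image) :
    P'.proj ((r.target a).pt (F a x)) ∈ (s.target α).image := by
  obtain ⟨K, hK⟩ := hs.exists_isExtension
  rw [← (hs.charts α.1 α.2).image_closure] at hx
  obtain ⟨y, hy, e⟩ := hx
  rw [H.proj_eq h1 h1' h2' hf hh hF hK (y := ⟨y, hy⟩) e.symm]
  exact LocalChart.proj_mem_image (LocalChart.pt_mem_units _ _)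

end Extension

end LimitClasses

end OrbispaceStr

namespace OrbispaceStr

/-! ### Sheets project homeomorphically onto open sets. -/

section Sheets

open Filter

variable {X : Type*} [TopologicalSpace X] {ι : Type*} {E : ι → Type*}
  [∀ i, TopologicalSpace (E i)] {G : ι → Type*} [∀ i, Group (G i)]
  {A : Type*} [TopologicalSpace A]
  {X' : Type*} [TopologicalSpace X'] {ι' : Type*} {E' : ι' → Type*}
  [∀ i, TopologicalSpace (E' i)] {G' : ι' → Type*} [∀ i, Group (G' i)]
  {A' : Type*} [TopologicalSpace A']
  {P : OrbispaceStr X E G A} {P' : OrbispaceStr X' E' G' A'}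

theorem isTransf_rho {r : AdmShape P P'} (f : HomSpace r) :
    IsTransf (r := r) (s := r) (fun a b => r.1.rho a b) f f :=
  ⟨f.2.1.maps, f.2.1.comp, f.2.1.comp⟩

theorem isOpen_basic {r : AdmShape P P'}
    {S : ∀ α : r.1.cover, Set (Set α.1.carrier × Set (r.1.target α).carrier)}
    (hS : IsBasicFamily S) : IsOpen (HomSpace.basic (r := r) S) :=
  TopologicalSpace.isOpen_generateFrom_of_mem ⟨S, hS, rfl⟩

theorem isTopologicalBasis_basic (r : AdmShape P P') :
    TopologicalSpace.IsTopologicalBasis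
      {W : Set (HomSpace r) | ∃ S, IsBasicFamily S ∧ W = HomSpace.basic (r := r) S} where
  exists_subset_inter := by
    rintro _ ⟨S, hS, rfl⟩ _ ⟨S', hS', rfl⟩ f ⟨hf, hf'⟩
    refine ⟨_, ⟨fun α => S α ∪ S' α, fun α => ⟨(hS α).1.union (hS' α).1, ?_⟩, rfl⟩, ?_, ?_⟩
    · rintro p (hp | hp)
      · exact (hS α).2 p hp
      · exact (hS' α).2 p hp
    · rintro α p (hp | hp)
      · exact hf α p hp
      · exact hf' α p hp
    · exact fun g hg => ⟨fun α p hp => hg α p (Or.inl hp), fun α p hp => hg α p (Or.inr hp)⟩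
  sUnion_eq := by
    rw [Set.eq_univ_iff_forall]
    intro f
    exact ⟨_, ⟨fun _ => ∅, fun _ => ⟨Set.finite_empty, by simp⟩, rfl⟩, fun _ _ hp => hp.elim⟩
  eq_generateFrom := rfl

/-- Some arrow `γ` leads from a point `x` of a chart of `r` to `y`. If `τ` is the limit class of `η`
at `γ`, then for every pair `(f', h')` in the sheet and `z` near `y` the value `h' z` is `φ_τ (f'
x')` with `x'` near `x`, so one compact-open condition on `f'` suffices. That the two chart images
meet is kept for the finiteness count in `IsTransf.uniform_control`. -/
theorem IsTransf.control (h1 : P.C1) (h1' : P'.C1) (h2' : P'.C2)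
    (hX : P.IsParacompactLocallyCompactHausdorff) {r s : AdmShape P P'} {η : Transf r s}
    {f : HomSpace r} {h : HomSpace s} (H : IsTransf η f h)
    {K : ∀ α : s.1.cover, closure α.1.carrier → (s.1.target α).carrier}
    (hK : IsExtension s.1 h.1 K) {α : s.1.cover} (y : closure α.1.carrier)
    {O : Set (s.1.target α).carrier} (hO : IsOpen O) (hy : K α y ∈ O) :
    ∃ M ∈ 𝓝 y, ∃ (a : r.1.cover) (B : Set a.1.carrier) (O' : Set (r.1.target a).carrier),
      IsCompact B ∧ IsOpen O' ∧ f.1 a '' B ⊆ O' ∧ (α.1.image ∩ a.1.image).Nonempty ∧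
      ∀ (f' : HomSpace r) (h' : HomSpace s), IsTransf η f' h' → f'.1 a '' B ⊆ O' →
        ∀ z : α.1.carrier, α.1.toClosure z ∈ M → h'.1 α z ∈ O := by
  obtain ⟨a, ha, hp⟩ := r.1.covers (P.proj (α.1.cpt y))
  lift a to r.1.cover using ha
  have hne : (α.1.image ∩ a.1.image).Nonempty := by
    rw [Set.inter_comm]
    exact mem_closure_iff.1 (α.1.proj_cpt_mem y) _ a.1.isOpen_image hp
  rw [LocalChart.image_eq] at hp
  obtain ⟨_, ⟨x, rfl⟩, hx⟩ := hp
  obtain ⟨γ, hγs, hγt⟩ := (P.proj_eq_iff _ _).1 hx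
  obtain ⟨γ', e1, e2, l⟩ := H.isNat.exists_limClass h1 h1' h2' f.2.1 h.2.1 hK hγs hγt
  have hO'o : IsOpen {z | ∃ w ∈ O, (T.mk γ').Maps z w} := by
    rw [isOpen_iff_mem_nhds]
    rintro z ⟨w, hw, hzw⟩
    exact hzw.preimage_mem_nhds h1' (hO.mem_nhds hw)
  have hxO' : f.1 a x ∈ {z | ∃ w ∈ O, (T.mk γ').Maps z w} := ⟨_, hy, γ', rfl, e1, e2⟩
  have := hX.locallyCompact_chart a.1.idx
  have : LocallyCompactSpace a.1.carrier :=
    a.1.isOpen_carrier.isOpenEmbedding_subtypeVal.locallyCompactSpace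
  obtain ⟨B, hBx, hBO, hB⟩ := local_compact_nhds
    ((f.2.1.continuous a).continuousAt (hO'o.mem_nhds hxO'))
  have hN : {δ | ∀ hδ : δ ∈ Arrows a.1 α.1, η a α (T.mk ⟨δ, hδ⟩) = T.mk γ'} ∩
      P.src ⁻¹' (a.1.pt '' B) ∈ 𝓝 γ := by
    refine inter_mem l (P.continuous_src.continuousAt ?_)
    rw [hγs, a.1.isOpenEmbedding_pt.image_mem_nhds]
    exact hBx
  have hM := P.isEtale.image_tgt_mem hN
  rw [hγt] at hM
  refine ⟨_, α.1.continuous_cpt.continuousAt hM, a, B, _, hB, hO'o, Set.image_subset_iff.2 hBO,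
    hne, ?_⟩
  rintro f' h' H' hf' z ⟨δ, ⟨hδ, ⟨x', hx'B, hx'⟩⟩, hδz⟩
  have hδA : δ ∈ Arrows a.1 α.1 := ⟨⟨x', hx'.symm⟩, ⟨z, hδz⟩⟩
  have m := H'.maps a α (T.mk ⟨δ, hδA⟩) x' z ⟨⟨δ, hδA⟩, rfl, hx'.symm, hδz⟩
  rw [hδ hδA] at m
  obtain ⟨w, hw, hw'⟩ := hf' ⟨x', hx'B, rfl⟩
  rwa [m.unique h2' hw']

/-- Given neighbourhoods of the values of (the extension of) `h`, there is a basic neighbourhood of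
`f` which controls `h'` for all isomorphisms `η : f' → h'`. -/
theorem IsTransf.uniform_control (h1 : P.C1) (h1' : P'.C1) (h2' : P'.C2)
    (hX : P.IsParacompactLocallyCompactHausdorff) {r s : AdmShape P P'} {η : Transf r s}
    {f : HomSpace r} {h : HomSpace s} (H : IsTransf η f h)
    {K : ∀ α : s.1.cover, closure α.1.carrier → (s.1.target α).carrier}
    (hK : IsExtension s.1 h.1 K) (M : ∀ α : s.1.cover, closure α.1.carrier →
      Set (closure α.1.carrier)) (hM : ∀ α y, M α y ∈ 𝓝 y)
    (O : ∀ α : s.1.cover, closure α.1.carrier → Set (s.1.target α).carrier)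
    (hO : ∀ α y, IsOpen (O α y)) (hKO : ∀ α y, K α y ∈ O α y) :
    ∃ S : ∀ a : r.1.cover, Set (Set a.1.carrier × Set (r.1.target a).carrier),
      IsBasicFamily S ∧ f ∈ HomSpace.basic S ∧
      ∀ (f' : HomSpace r) (h' : HomSpace s), IsTransf η f' h' → f' ∈ HomSpace.basic S →
        ∀ (α : s.1.cover) (z : α.1.carrier), ∃ y, α.1.toClosure z ∈ M α y ∧ h'.1 α z ∈ O α y := by
  choose N hN a B O' hB hO' hf hne hc using fun (α : s.1.cover) (y : closure α.1.carrier) =>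
    H.control h1 h1' h2' hX hK y (hO α y) (hKO α y)
  have hcomp : ∀ α : s.1.cover, CompactSpace (closure α.1.carrier) := fun α =>
    isCompact_iff_compactSpace.1 ((h.2.2.charts α.1 α.2).isCompact_closure_carrier hX)
  choose t ht using fun α : s.1.cover => CompactSpace.elim_nhds_subcover
    (fun y => M α y ∩ N α y) (fun y => inter_mem (hM α y) (hN α y))
  let Q : ∀ α : s.1.cover, closure α.1.carrier →
      Σ b : r.1.cover, Set b.1.carrier × Set (r.1.target b).carrier :=
    fun α y => ⟨a α y, B α y, O' α y⟩
  refine ⟨fun b => {p | ∃ α, ∃ y ∈ t α, Q α y = ⟨b, p⟩}, fun b => ⟨?_, ?_⟩, ?_, ?_⟩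
  -- The closure of the image of `b` is compact, so it meets only finitely many `α.image`, and each
  -- `α` contributes a finite subcover: finitely many conditions fall on `b`.
  · have hfin : {α : s.1.cover | (α.1.image ∩ closure b.1.image).Nonempty}.Finite :=
      h.2.2.locallyFinite.finite_nonempty_inter_compact (f.2.2.charts b.1 b.2).isCompact_closure
    have h3 : (⋃ α ∈ {α : s.1.cover | (α.1.image ∩ closure b.1.image).Nonempty},
        Q α '' (t α)).Finite := hfin.biUnion fun α _ => (t α).finite_toSet.image _
    refine (h3.preimage (sigma_mk_injective (i := b)).injOn).subset ?_
    rintro p ⟨α, y, hy, e⟩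
    refine Set.mem_iUnion₂.2 ⟨α, ?_, y, hy, e⟩
    have hb : a α y = b := congrArg Sigma.fst e
    rw [← hb]
    exact (hne α y).mono (Set.inter_subset_inter_right _ subset_closure)
  · rintro p ⟨α, y, hy, e⟩
    cases e
    exact ⟨hB α y, hO' α y⟩
  · rintro b p ⟨α, y, hy, e⟩
    cases e
    exact hf α y
  · intro f' h' H' hf' α z
    have : α.1.toClosure z ∈ ⋃ y ∈ t α, M α y ∩ N α y := by rw [ht]; trivial
    obtain ⟨y, hy, hzM, hzN⟩ := Set.mem_iUnion₂.1 this
    exact ⟨y, hzM, hc α y f' h' H' (hf' _ _ ⟨α, y, hy, rfl⟩) z hzN⟩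

theorem IsTransf.exists_basic_subset (h1 : P.C1) (h1' : P'.C1) (h2' : P'.C2)
    (hX : P.IsParacompactLocallyCompactHausdorff) {r s : AdmShape P P'} {η : Transf r s}
    {f : HomSpace r} {h : HomSpace s} (H : IsTransf η f h)
    {S : ∀ α : s.1.cover, Set (Set α.1.carrier × Set (s.1.target α).carrier)}
    (hS : IsBasicFamily S) (hh : h ∈ HomSpace.basic S) :
    ∃ N ∈ 𝓝 f, ∀ f' ∈ N, ∀ h' : HomSpace s, IsTransf η f' h' → h' ∈ HomSpace.basic S := by
  obtain ⟨K, hK⟩ := h.2.2.exists_isExtension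
  have hT2 : ∀ α : s.1.cover, T2Space (closure α.1.carrier) := fun α => by
    have := hX.hausdorff_chart α.1.idx
    infer_instance
  let I : ∀ α : s.1.cover, Set α.1.carrier × Set (s.1.target α).carrier →
      Set (closure α.1.carrier) := fun α p => α.1.toClosure '' p.1
  have hI : ∀ α, ∀ p ∈ S α, IsClosed (I α p) := fun α p hp =>
    (((hS α).2 p hp).1.image α.1.continuous_toClosure).isClosed
  -- Points near `y` avoid the compact sets of `S` not containing `y`; for the other pairs `K y`
  -- lies in the prescribed open set, and this is what has to be controlled.
  obtain ⟨S', hS', hf, hc⟩ := H.uniform_control h1 h1' h2' hX hK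
    (fun α y => ⋂ p ∈ {p ∈ S α | y ∉ I α p}, (I α p)ᶜ)
    (fun α y => (Filter.biInter_mem ((hS α).1.subset fun p hp => hp.1)).2
      fun p hp => (hI α p hp.1).isOpen_compl.mem_nhds hp.2)
    (fun α y => ⋂ p ∈ {p ∈ S α | y ∈ I α p}, p.2)
    (fun α y => ((hS α).1.subset fun p hp => hp.1).isOpen_biInter
      fun p hp => ((hS α).2 p hp.1).2)
    (fun α y => by
      refine Set.mem_iInter₂.2 ?_
      rintro p ⟨hp, x, hx, rfl⟩
      rw [hK.eq]
      exact hh α p hp ⟨x, hx, rfl⟩)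
  refine ⟨_, (isOpen_basic hS').mem_nhds hf, ?_⟩
  rintro f' hf' h' H' α p hp _ ⟨z, hz, rfl⟩
  obtain ⟨y, hy, hyO⟩ := hc f' h' H' hf' α z
  have hyI : y ∈ I α p := by
    by_contra hn
    exact Set.mem_iInter₂.1 hy p ⟨hp, hn⟩ ⟨z, hz, rfl⟩
  exact Set.mem_iInter₂.1 hyO p ⟨hp, hyI⟩

/-- Homomorphisms close to `f` are joined to `f`, pointwise, by small connected sets on which all
the classes involved are defined. -/
theorem IsTransf.exists_connected (h1 : P.C1) (h1' : P'.C1) (h2' : P'.C2)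
    (hX : P.IsParacompactLocallyCompactHausdorff) {r s t : AdmShape P P'} {η₁ : Transf r s}
    {η₂ : Transf r t} {f : HomSpace r} {g : HomSpace s} {h : HomSpace t} (H₁ : IsTransf η₁ f g)
    (H₂ : IsTransf η₂ f h) :
    ∃ N ∈ 𝓝 f, ∀ f' ∈ N, ∀ (a : r.1.cover) (x : a.1.carrier),
      ∃ O : Set (r.1.target a).carrier, IsOpen O ∧ IsPreconnected O ∧ f.1 a x ∈ O ∧
        f'.1 a x ∈ O ∧
        (∀ b : s.1.cover, P.proj (a.1.pt x) ∈ closure b.1.image → ∀ z ∈ O,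
          P'.proj ((r.1.target a).pt z) ∈ (s.1.target b).image) ∧
        ∀ α : t.1.cover, P.proj (a.1.pt x) ∈ closure α.1.image → ∀ z ∈ O,
          P'.proj ((r.1.target a).pt z) ∈ (t.1.target α).image := by
  obtain ⟨F, hF⟩ := f.2.2.exists_isExtension
  have lfr := g.2.2.locallyFinite.closure
  have lfs := h.2.2.locallyFinite.closure
  -- `D a x` lies over all target charts relevant at `x`. Local finiteness makes it open, and
  -- `IsNat.proj_mem_image` puts the extended value `F a x` in it, also at boundary points.
  let D : ∀ a : r.1.cover, closure a.1.carrier → Set (r.1.target a).carrier := fun a x =>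
    (⋂ b ∈ {b : s.1.cover | P.proj (a.1.cpt x) ∈ closure b.1.image},
      {z | P'.proj ((r.1.target a).pt z) ∈ (s.1.target b).image}) ∩
    ⋂ α ∈ {α : t.1.cover | P.proj (a.1.cpt x) ∈ closure α.1.image},
      {z | P'.proj ((r.1.target a).pt z) ∈ (t.1.target α).image}
  have hpc : ∀ a : r.1.cover, Continuous fun z => P'.proj ((r.1.target a).pt z) := fun a =>
    P'.continuous_proj.comp (r.1.target a).continuous_pt
  have hDo : ∀ a x, IsOpen (D a x) := fun a x =>
    ((lfr.point_finite _).isOpen_biInter fun b _ =>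
      (s.1.target b).isOpen_image.preimage (hpc a)).inter
    ((lfs.point_finite _).isOpen_biInter fun α _ => (t.1.target α).isOpen_image.preimage (hpc a))
  have hFD : ∀ a x, F a x ∈ D a x := by
    intro a x
    refine ⟨Set.mem_iInter₂.2 fun b hb => ?_, Set.mem_iInter₂.2 fun α hα => ?_⟩
    · exact H₁.isNat.proj_mem_image h1 h1' h2' f.2.1 g.2.1 hF g.2.2 hb
    · exact H₂.isNat.proj_mem_image h1 h1' h2' f.2.1 h.2.1 hF h.2.2 hα
  have hlc : ∀ a : r.1.cover, LocallyConnectedSpace (r.1.target a).carrier := fun a => by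
    have := locallyConnectedSpace_chart h1' (r.1.target a).idx
    exact (r.1.target a).isOpen_carrier.locallyConnectedSpace
  let O : ∀ a : r.1.cover, closure a.1.carrier → Set (r.1.target a).carrier := fun a x =>
    connectedComponentIn (D a x) (F a x)
  have hOo : ∀ a x, IsOpen (O a x) := fun a x => (hDo a x).connectedComponentIn
  have hFO : ∀ a x, F a x ∈ O a x := fun a x => mem_connectedComponentIn (hFD a x)
  -- Control is applied to the identity transformation of `f`. The neighbourhoods are so small that
  -- no new closed chart images are met, so the component chosen at one point serves for all points
  -- near it.
  obtain ⟨S, hS, hfS, hc⟩ := (isTransf_rho f).uniform_control h1 h1' h2' hX hF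
    (fun a x => F a ⁻¹' O a x ∩ {y |
      {b : s.1.cover | P.proj (a.1.cpt y) ∈ closure b.1.image} ⊆
        {b : s.1.cover | P.proj (a.1.cpt x) ∈ closure b.1.image} ∧
      {α : t.1.cover | P.proj (a.1.cpt y) ∈ closure α.1.image} ⊆
        {α : t.1.cover | P.proj (a.1.cpt x) ∈ closure α.1.image}})
    (fun a x => by
      have hcp : ContinuousAt (fun y => P.proj (a.1.cpt y)) x :=
        (P.continuous_proj.comp a.1.continuous_cpt).continuousAt
      exact inter_mem ((hF.continuous a).continuousAt ((hOo a x).mem_nhds (hFO a x)))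
        ((hcp.eventually (lfr.eventually_subset (fun _ => isClosed_closure) _)).and
          (hcp.eventually (lfs.eventually_subset (fun _ => isClosed_closure) _))))
    O hOo hFO
  refine ⟨_, (isOpen_basic hS).mem_nhds hfS, fun f' hf' a x => ?_⟩
  obtain ⟨y, ⟨e1, e2, e3⟩, e4⟩ := hc f' f' (isTransf_rho f') hf' a x
  rw [Set.mem_preimage, hF.eq] at e1
  have hsub : O a y ⊆ D a y := connectedComponentIn_subset _ _
  refine ⟨O a y, hOo a y, isPreconnected_connectedComponentIn, e1, e4, ?_, ?_⟩
  · exact fun b hb z hz => Set.mem_iInter₂.1 (hsub hz).1 b (e2 hb)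
  · exact fun α hα z hz => Set.mem_iInter₂.1 (hsub hz).2 α (e3 hα)

/-- For every `f'` close to `f` there is an isomorphism with source `f'` in the sheet of a given
isomorphism `η : f → h`. -/
theorem IsTransf.exists_isTransf (h1 : P.C1) (h1' : P'.C1) (h2' : P'.C2)
    (hX : P.IsParacompactLocallyCompactHausdorff) {r s : AdmShape P P'} {η : Transf r s}
    {f : HomSpace r} {h : HomSpace s} (H : IsTransf η f h) :
    ∀ᶠ g in 𝓝 f, ∃ k : HomSpace s, IsTransf η g k := by
  obtain ⟨N, hN, hNc⟩ := (isTransf_rho f).exists_connected h1 h1' h2' hX H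
  obtain ⟨K, hK⟩ := h.2.2.exists_isExtension
  filter_upwards [hN] with g hg
  have Hc := hNc g hg
  have Hn := H.isNat
  -- the limit classes at arrows ending at a boundary point
  let Good : ∀ (α : s.1.cover) (_ : closure α.1.carrier) (a : r.1.cover) (_ : a.1.carrier) (_ : A)
      (_ : T (r.1.target a) (s.1.target α)), Prop := fun α y a x γ τ =>
    P.src γ = a.1.pt x ∧ P.tgt γ = α.1.cpt y ∧ LimClass (η a α) γ τ ∧ τ.Maps (f.1 a x) (K α y)
  have good_of : ∀ {α : s.1.cover} {y : closure α.1.carrier} {a : r.1.cover} {x : a.1.carrier}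
      {γ : A}, P.src γ = a.1.pt x → P.tgt γ = α.1.cpt y → ∃ τ, Good α y a x γ τ := by
    intro α y a x γ hs ht
    obtain ⟨γ', e1, e2, l⟩ := Hn.exists_limClass h1 h1' h2' f.2.1 h.2.1 hK hs ht
    exact ⟨T.mk γ', hs, ht, l, γ', rfl, e1, e2⟩
  have good_of_lim : ∀ {α : s.1.cover} {y : closure α.1.carrier} {a : r.1.cover}
      {x : a.1.carrier} {γ : A} {τ : T (r.1.target a) (s.1.target α)}, P.src γ = a.1.pt x →
      P.tgt γ = α.1.cpt y → LimClass (η a α) γ τ → Good α y a x γ τ := by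
    intro α y a x γ τ hs ht l
    obtain ⟨τ', hτ'⟩ := good_of hs ht
    have hγ : γ ∈ closure (Arrows a.1 α.1) :=
      mem_closure_arrows (by rw [hs]; exact a.1.pt_mem_units x) (by rw [ht]; exact α.1.cpt_mem y)
    rwa [LimClass.unique hγ l hτ'.2.2.1]
  have proj_mem : ∀ {α : s.1.cover} {y : closure α.1.carrier} {a : r.1.cover} {x : a.1.carrier}
      {γ : A}, P.src γ = a.1.pt x → P.tgt γ = α.1.cpt y →
      P.proj (a.1.pt x) ∈ closure α.1.image := by
    intro α y a x γ hs ht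
    rw [← hs, P.proj_src, ht]
    exact α.1.proj_cpt_mem y
  have good_maps : ∀ {α y a x γ τ}, Good α y a x γ τ → ∃ w, τ.Maps (g.1 a x) w := by
    rintro α y a x γ τ ⟨hs, ht, l, m⟩
    obtain ⟨O, hO, hOc, hfO, hgO, -, hOs⟩ := Hc a x
    exact m.exists_of_isPreconnected h2' hOc hfO (hOs α (proj_mem hs ht)) hgO
  -- The new target at `y` is to be `φ_τ (g x)`. Two choices of `γ` differ by the arrow `ω = γ₂⁻¹
  -- γ`; the limit form of `η(γ₂ ω) = η(γ₂) ρ(ω)` continues within `O` to `g x` and shows that both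
  -- give the same value.
  have indep : ∀ {α : s.1.cover} {y : closure α.1.carrier} {a b : r.1.cover} {x x₂ γ γ₂}
      {τ : T (r.1.target a) (s.1.target α)} {τ₂ : T (r.1.target b) (s.1.target α)},
      Good α y a x γ τ → Good α y b x₂ γ₂ τ₂ → ∀ w, τ₂.Maps (g.1 b x₂) w → τ.Maps (g.1 a x) w := by
    rintro α y a b x x₂ γ γ₂ τ τ₂ ⟨hs, ht, l, m⟩ ⟨hs₂, ht₂, l₂, m₂⟩ w hw
    obtain ⟨O, hO, hOc, hfO, hgO, hOr, hOs⟩ := Hc a x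
    have e : P.src (P.inv γ₂) = P.tgt γ := by rw [P.src_inv, ht, ht₂]
    let ω : Arrows a.1 b.1 := ⟨P.comp (P.inv γ₂) γ, mem_arrows.2
      ⟨by rw [P.src_comp _ _ e, hs]; exact a.1.pt_mem_units x,
        by rw [P.tgt_comp _ _ e, P.tgt_inv, hs₂]; exact b.1.pt_mem_units x₂⟩⟩
    have sω : P.src ω.1 = a.1.pt x := (P.src_comp _ _ e).trans hs
    have tω : P.tgt ω.1 = b.1.pt x₂ := (P.tgt_comp _ _ e).trans ((P.tgt_inv _).trans hs₂)
    have eω : P.comp γ₂ ω.1 = γ := P.cancel_inv_comp (ht₂.trans ht.symm)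
    have key := compAt_of_limClass (f := f.1 a) h1' h2' (f.2.1.continuous a)
      (fun x ξ ζ ω => H.comp_right a b α ξ ζ ω x) sω (hs₂.trans tω.symm)
      (mem_closure_arrows (by rw [hs₂]; exact b.1.pt_mem_units x₂)
        (by rw [ht₂]; exact α.1.cpt_mem y))
      (limClass_mk h1 (r.1.rho a b) ω) l₂ (τ₃ := τ) (by rwa [eω]) hO hOc hfO
      (hOr b (subset_closure (by
        rw [← sω]
        exact proj_src_mem_image ω))) (hOs α (proj_mem hs ht)) hgO
    have hm := g.2.1.maps a b (T.mk ω) x x₂ ⟨ω, rfl, sω, tω⟩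
    exact (key.maps_iff h2' hm).1 hw
  have ex : ∀ (α : s.1.cover) (y : closure α.1.carrier), ∃ w : (s.1.target α).carrier,
      (∃ a x γ τ, Good α y a x γ τ) ∧
      ∀ a x γ τ, Good α y a x γ τ → τ.Maps (g.1 a x) w := by
    intro α y
    obtain ⟨a, ha, hp⟩ := r.1.covers (P.proj (α.1.cpt y))
    lift a to r.1.cover using ha
    rw [LocalChart.image_eq] at hp
    obtain ⟨_, ⟨x, rfl⟩, hx⟩ := hp
    obtain ⟨γ, hγs, hγt⟩ := (P.proj_eq_iff _ _).1 hx
    obtain ⟨τ, hτ⟩ := good_of hγs hγt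
    obtain ⟨w, hw⟩ := good_maps hτ
    exact ⟨w, ⟨a, x, γ, τ, hτ⟩, fun a₂ x₂ γ₂ τ₂ h₂ => indep h₂ hτ w hw⟩
  choose L hLex hL using ex
  have hLc : ∀ α, Continuous (L α) := by
    intro α
    rw [continuous_iff_continuousAt]
    intro y
    refine tendsto_def.2 fun O hO => ?_
    obtain ⟨a, x, γ, τ, hg⟩ := hLex α y
    have hm := hL α y a x γ τ hg
    obtain ⟨hs, ht, l, -⟩ := hg
    have hB := (g.2.1.continuous a).continuousAt (hm.preimage_mem_nhds h1' hO)
    have hN : {δ | LimClass (η a α) δ τ} ∩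
        P.src ⁻¹' (a.1.pt '' (g.1 a ⁻¹' {z | ∃ w ∈ O, τ.Maps z w})) ∈ 𝓝 γ := by
      refine inter_mem (eventually_eventually_nhds.2 l) (P.continuous_src.continuousAt ?_)
      rw [hs, a.1.isOpenEmbedding_pt.image_mem_nhds]
      exact hB
    have hM := P.isEtale.image_tgt_mem hN
    rw [ht] at hM
    filter_upwards [α.1.continuous_cpt.continuousAt hM] with y' ⟨δ, ⟨l', x', ⟨w, hw, hxw⟩, hx'⟩, hδ⟩
    have := hL α y' a x' δ τ (good_of_lim hx'.symm hδ l')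
    rw [Set.mem_preimage, this.unique h2' hxw]
    exact hw
  -- An auxiliary arrow `γ` from a chart of `r` to `y` turns compatibility with `ρ` at a limit arrow
  -- `δ` into `η(δ γ) = ρ(δ) η(γ)`, which continues from `f` to `g`.
  have hLa : ∀ (α β : s.1.cover) (y : closure α.1.carrier) (w : closure β.1.carrier) (δ : A),
      δ ∈ closure (Arrows α.1 β.1) → P.src δ = α.1.cpt y → P.tgt δ = β.1.cpt w →
      ∃ δ' : Arrows (s.1.target α) (s.1.target β), P'.src δ'.1 = (s.1.target α).pt (L α y) ∧
        P'.tgt δ'.1 = (s.1.target β).pt (L β w) ∧ LimClass (s.1.rho α β) δ (T.mk δ') := by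
    intro α β y w δ hδ hδs hδt
    obtain ⟨δ₀, -, -, lδ⟩ := hK.arrows α β y w δ hδ hδs hδt
    obtain ⟨a, x, γ, τ, hγ⟩ := hLex α y
    have hm := hL α y a x γ τ hγ
    obtain ⟨hs, ht, l, -⟩ := hγ
    have e : P.src δ = P.tgt γ := hδs.trans ht.symm
    have hs₃ : P.src (P.comp δ γ) = a.1.pt x := (P.src_comp _ _ e).trans hs
    have ht₃ : P.tgt (P.comp δ γ) = β.1.cpt w := (P.tgt_comp _ _ e).trans hδt
    obtain ⟨τ₃, hγ₃⟩ := good_of hs₃ ht₃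
    obtain ⟨O, hO, hOc, hfO, hgO, hOr, hOs⟩ := Hc a x
    have key := compAt_of_limClass (f := f.1 a) h1' h2' (f.2.1.continuous a)
      (fun x ξ ζ ω => H.comp_left a α β ξ ζ ω x) hs e hδ l lδ hγ₃.2.2.1 hO hOc hfO
      (hOs α (proj_mem hs ht)) (hOs β (proj_mem hs₃ ht₃)) hgO
    obtain ⟨δ', e1, e2, e3⟩ := (key.maps_iff h2' hm).2 (hL β w a x _ τ₃ hγ₃)
    exact ⟨δ', e2, e3, by rwa [e1]⟩
  let k : s.1.LocalMaps := fun α y => L α (α.1.toClosure y)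
  have maps_k : ∀ (a : r.1.cover) (α : s.1.cover) (ξ : T a.1 α.1) (x : a.1.carrier)
      (y : α.1.carrier), ξ.Maps x y → (η a α ξ).Maps (g.1 a x) (k α y) := by
    rintro a α ξ x y ⟨γ, rfl, hs, ht⟩
    exact hL α _ a x γ.1 _ (good_of_lim hs ht (limClass_mk h1 (η a α) γ))
  have left_k : ∀ (a : r.1.cover) (α β : s.1.cover) (ξ : T a.1 α.1) (ζ : T α.1 β.1)
      (ω : T a.1 β.1) (x : a.1.carrier), T.CompAt x ξ ζ ω →
      T.CompAt (g.1 a x) (η a α ξ) (s.1.rho α β ζ) (η a β ω) := by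
    intro a α β ξ ζ ω x hc
    obtain ⟨O, hO, hOc, hfO, hgO, hOr, hOs⟩ := Hc a x
    refine (H.comp_left a α β ξ ζ ω x hc).of_isPreconnected h1' h2' hOc hfO
      (hOs α (subset_closure ?_)) (hOs β (subset_closure ?_)) hgO
    · obtain ⟨γ, δ, e, -, -, -, e4⟩ := hc.elim
      rw [← e4]
      exact proj_src_mem_image γ
    · obtain ⟨γ, δ, e, -, -, -, e4⟩ := hc.elim
      rw [← e4, ← src_compArrow δ γ e]
      exact proj_src_mem_image _
  have right_k : ∀ (a b : r.1.cover) (α : s.1.cover) (ξ : T a.1 b.1) (ζ : T b.1 α.1)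
      (ω : T a.1 α.1) (x : a.1.carrier), T.CompAt x ξ ζ ω →
      T.CompAt (g.1 a x) (r.1.rho a b ξ) (η b α ζ) (η a α ω) := by
    intro a b α ξ ζ ω x hc
    obtain ⟨O, hO, hOc, hfO, hgO, hOr, hOs⟩ := Hc a x
    refine (H.comp_right a b α ξ ζ ω x hc).of_isPreconnected h1' h2' hOc hfO
      (hOr b (subset_closure ?_)) (hOs α (subset_closure ?_)) hgO
    · obtain ⟨γ, δ, e, -, -, -, e4⟩ := hc.elim
      rw [← e4]
      exact proj_src_mem_image γ
    · obtain ⟨γ, δ, e, -, -, -, e4⟩ := hc.elim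
      rw [← e4, ← src_compArrow δ γ e]
      exact proj_src_mem_image _
  have hkh : IsHom s.1 k := by
    refine ⟨fun α => (hLc α).comp α.1.continuous_toClosure, ?_, ?_⟩
    · rintro α β ξ y w ⟨δ, rfl, hs, ht⟩
      have hδ : δ.1 ∈ closure (Arrows α.1 β.1) := subset_closure δ.2
      obtain ⟨δ', e1, e2, l⟩ := hLa α β (α.1.toClosure y) (β.1.toClosure w) δ.1 hδ hs ht
      exact ⟨δ', LimClass.unique hδ l (limClass_mk h1 _ δ), e1, e2⟩
    · intro α β ε ξ ζ ω y hc
      obtain ⟨δ₁, δ₂, e, rfl, rfl, rfl, e4⟩ := hc.elim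
      -- Precomposition with an arrow `γ` out of a chart of `r` reduces the law to `left_k`, and
      -- `T.CompAt.of_comp` then cancels `γ`.
      obtain ⟨a, δ₀, hδ₀⟩ := r.1.exists_arrow δ₁
      let γ := invArrow δ₀
      have f1 : P.src δ₁.1 = P.tgt γ.1 := by rw [tgt_invArrow, hδ₀]
      have f2 : P.src δ₂.1 = P.tgt (compArrow δ₁ γ f1).1 := by rw [tgt_compArrow, e]
      have f3 : P.src (compArrow δ₂ δ₁ e).1 = P.tgt γ.1 := by rw [src_compArrow, f1]
      have hx := (pt_srcPt γ).symm
      have k1 := left_k _ _ _ _ _ _ _ (T.CompAt.of_arrows γ δ₁ f1 hx)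
      have k2 := left_k _ _ _ _ _ _ _ (T.CompAt.of_arrows (compArrow δ₁ γ f1) δ₂ f2
        ((src_compArrow _ _ _).trans hx))
      have k3 := left_k _ _ _ _ _ _ _ (T.CompAt.of_arrows γ (compArrow δ₂ δ₁ e) f3 hx)
      have f4 : compArrow (compArrow δ₂ δ₁ e) γ f3 = compArrow δ₂ (compArrow δ₁ γ f1) f2 :=
        Subtype.ext (P.assoc _ _ _ e f1)
      rw [f4] at k3
      exact T.CompAt.of_comp h2'
        (maps_k a α (T.mk γ) _ y ⟨γ, rfl, hx, f1.symm.trans e4⟩) k1 k2 k3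
  have hka : IsAdmissible s.1 k := IsExtension.isAdmissible h.2.2 (F := L) ⟨hLc, fun _ _ => rfl, hLa⟩
  exact ⟨⟨k, hkh, hka⟩, maps_k, left_k, right_k⟩

/-- Every `y` is the target of an arrow from a chart of `r`; for the class `ξ` of this arrow the
value at `y` must be `φ_{η(ξ)} (f x)`. -/
theorem IsTransf.target_unique (h2' : P'.C2) {r s : AdmShape P P'} {η : Transf r s}
    {f : HomSpace r} {h h' : HomSpace s} (H : IsTransf η f h) (H' : IsTransf η f h') : h = h' := by
  apply Subtype.ext
  funext α y
  obtain ⟨a, ha, hp⟩ := r.1.covers (P.proj (α.1.pt y))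
  lift a to r.1.cover using ha
  rw [LocalChart.image_eq] at hp
  obtain ⟨_, ⟨x, rfl⟩, hx⟩ := hp
  obtain ⟨γ, hγs, hγt⟩ := (P.proj_eq_iff _ _).1 hx
  have m : (T.mk (⟨γ, ⟨x, hγs⟩, ⟨y, hγt⟩⟩ : Arrows a.1 α.1)).Maps x y := ⟨_, rfl, hγs, hγt⟩
  exact (H.maps _ _ _ _ _ m).unique h2' (H'.maps _ _ _ _ _ m)

theorem nhds_sheet {r s : AdmShape P P'} {η : Transf r s} (p : Sheet η) :
    𝓝 p = comap (fun q : Sheet η => q.1) (𝓝 p.1) := nhds_induced _ _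

theorem continuous_sheet_fst {r s : AdmShape P P'} (η : Transf r s) :
    Continuous fun p : Sheet η => p.1.1 := by
  change Continuous fun p : {p : HomSpace r × HomSpace s // IsTransf η p.1 p.2} => p.1.1
  exact continuous_fst.comp continuous_subtype_val

/-- Injectivity is uniqueness of the target. Openness combines the existence of a target for every
nearby source with the continuity of that target. -/
theorem isOpenEmbedding_sheet_fst (h1 : P.C1) (h1' : P'.C1) (h2' : P'.C2)
    (hX : P.IsParacompactLocallyCompactHausdorff) {r s : AdmShape P P'} (η : Transf r s) :
    IsOpenEmbedding fun p : Sheet η => p.1.1 := by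
  refine .of_continuous_injective_isOpenMap (continuous_sheet_fst η) ?_ ?_
  · rintro ⟨⟨f, h⟩, H⟩ ⟨⟨f', h'⟩, H'⟩ (e : f = f')
    subst e
    have : h = h' := IsTransf.target_unique h2' H H'
    subst this
    rfl
  · rw [isOpenMap_iff_nhds_le]
    rintro ⟨⟨f, h⟩, H⟩ W hW
    change _ ∈ 𝓝 f
    obtain ⟨V, hV, hVW⟩ := mem_comap.1 ((nhds_sheet (⟨(f, h), H⟩ : Sheet η)).ge hW)
    obtain ⟨V₁, hV₁, V₂, hV₂, hV⟩ := mem_nhds_prod_iff.1 hV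
    obtain ⟨_, ⟨S, hS, rfl⟩, hhS, hSV⟩ := (isTopologicalBasis_basic s).mem_nhds_iff.1 hV₂
    obtain ⟨N, hN, hNS⟩ := H.exists_basic_subset h1 h1' h2' hX hS hhS
    filter_upwards [hV₁, hN, H.exists_isTransf h1 h1' h2' hX] with f' hf₁ hfN ⟨k, hk⟩
    exact hVW (a := ⟨(f', k), hk⟩) (hV ⟨hf₁, hSV (hNS f' hfN k hk)⟩)

/-- The inverse of a family of maps of classes. -/
def Transf.inv {r s : AdmShape P P'} (η : Transf r s) : Transf s r :=
  GTransf.inv (r := r.1) (s := s.1) η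

theorem Transf.inv_inv {r s : AdmShape P P'} (η : Transf r s) : η.inv.inv = η :=
  GTransf.inv_inv (r := r.1) (s := s.1) η

theorem IsTransf.inv (h2' : P'.C2) {r s : AdmShape P P'} {η : Transf r s} {f : HomSpace r}
    {h : HomSpace s} (H : IsTransf η f h) : IsTransf η.inv h f := by
  have := IsNat.inv h2' f.2.1.isNat h.2.1.isNat H.isNat
  exact ⟨this.maps, this.comp_left, this.comp_right⟩

/-- Inversion of isomorphisms, from the sheet of `η` to the sheet of its inverse. -/
def Sheet.inv (h2' : P'.C2) {r s : AdmShape P P'} {η : Transf r s} (p : Sheet η) : Sheet η.inv :=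
  ⟨(p.1.2, p.1.1), IsTransf.inv h2' p.2⟩

theorem Sheet.continuous_inv (h2' : P'.C2) {r s : AdmShape P P'} {η : Transf r s} :
    Continuous (Sheet.inv h2' : Sheet η → Sheet η.inv) := by
  change Continuous fun p : {p : HomSpace r × HomSpace s // IsTransf η p.1 p.2} => _
  exact Continuous.subtype_mk (continuous_swap.comp continuous_subtype_val) _

/-- Inversion, as a homeomorphism from the sheet of `η` to the sheet of its inverse. -/
def sheetInv (h2' : P'.C2) {r s : AdmShape P P'} (η : Transf r s) : Sheet η ≃ₜ Sheet η.inv where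
  toFun := Sheet.inv h2'
  invFun p := ⟨(p.1.2, p.1.1), by
    have := IsTransf.inv h2' p.2
    rwa [Transf.inv_inv] at this⟩
  left_inv _ := rfl
  right_inv _ := rfl
  continuous_toFun := Sheet.continuous_inv h2'
  continuous_invFun := by
    change Continuous fun p : {p : HomSpace s × HomSpace r // IsTransf η.inv p.1 p.2} => _
    exact Continuous.subtype_mk (continuous_swap.comp continuous_subtype_val) _

/-- Inversion exchanges source and target, so this is the first projection on the sheet of `η.inv`.
-/
theorem isOpenEmbedding_sheet_snd (h1 : P.C1) (h1' : P'.C1) (h2' : P'.C2)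
    (hX : P.IsParacompactLocallyCompactHausdorff) {r s : AdmShape P P'} (η : Transf r s) :
    IsOpenEmbedding fun p : Sheet η => p.1.2 :=
  (isOpenEmbedding_sheet_fst h1 h1' h2' hX η.inv).comp (sheetInv h2' η).isOpenEmbedding

end Sheets

end OrbispaceStr

namespace OrbispaceStr

/-! ### Group elements acting on classes of arrows. -/

section ChartGroups

variable {X : Type*} [TopologicalSpace X] {ι : Type*} {E : ι → Type*}
  [∀ i, TopologicalSpace (E i)] {G : ι → Type*} [∀ i, Group (G i)]
  {A : Type*} [TopologicalSpace A] {P : OrbispaceStr X E G A} {c d e : LocalChart P}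

theorem LocalChart.continuous_arrow (c : LocalChart P) (g : c.group) :
    Continuous (c.arrow g) := by
  let _ : TopologicalSpace (G c.idx) := ⊥
  exact ((P.isEmbedding_prod c.idx).continuous.comp
    (continuous_const.prodMk continuous_subtype_val)).subtype_mk _

theorem LocalChart.continuous_smul (c : LocalChart P) (g : c.group) : Continuous (c.smul g) :=
  ((P.continuous_act _ _).comp continuous_subtype_val).subtype_mk _

/-- The chart is connected, so the base point chosen in `ofGroup` is immaterial. -/
theorem LocalChart.mk_arrow (c : LocalChart P) (g : c.group) (x : c.carrier) :
    T.mk (c.arrow g x) = c.ofGroup g := by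
  have : PreconnectedSpace c.carrier :=
    Subtype.preconnectedSpace c.isConnected_carrier.isPreconnected
  exact T.mk_eq_of_isPreconnected (S := Set.range fun z => (c.arrow g z).1)
    (isPreconnected_range (continuous_subtype_val.comp (c.continuous_arrow g)))
    (by rintro _ ⟨z, rfl⟩; exact (c.arrow g z).2) ⟨_, rfl⟩ ⟨_, rfl⟩

/-- Over one `E i` the groupoid is a product groupoid, so an arrow from `c` to `c` comes from some
`g` in the group of `E i`; moving a point of `c` into `c`, it preserves `c`. -/
theorem T.exists_ofGroup (ξ : T c c) : ∃ g : c.group, ξ = c.ofGroup g := by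
  obtain ⟨γ, rfl⟩ := ξ.exists_mk
  have hγ : γ.1 ∈ Set.range fun p : G c.idx × E c.idx => P.prod c.idx p.1 p.2 := by
    rw [P.range_prod]
    exact T.mem_between γ
  obtain ⟨⟨g, x⟩, hg⟩ := hγ
  change P.prod c.idx g x = γ.1 at hg
  have hs : (⟨c.idx, x⟩ : Σ i, E i) ∈ c.units := by
    rw [← P.src_prod c.idx g x]
    rw [hg]
    exact src_mem_units γ
  have ht : (⟨c.idx, (P.act c.idx).smul g x⟩ : Σ i, E i) ∈ c.units := by
    rw [← P.tgt_prod c.idx g x]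
    rw [hg]
    exact tgt_mem_units γ
  rw [LocalChart.mem_units] at hs ht
  refine ⟨⟨g, LocalChart.mem_group_of_mem hs ht⟩, ?_⟩
  rw [← c.mk_arrow _ ⟨x, hs⟩]
  exact congrArg T.mk (Subtype.ext hg.symm)

theorem LocalChart.arrow_injective {g h : c.group} {x : c.carrier}
    (e : c.arrow g x = c.arrow h x) : g = h := by
  let _ : TopologicalSpace (G c.idx) := ⊥
  have := @(P.isEmbedding_prod c.idx).injective (g.1, x.1) (h.1, x.1) (congrArg Subtype.val e)
  exact Subtype.ext (congrArg Prod.fst this)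

theorem T.maps_ofGroup (g : c.group) (x : c.carrier) : (c.ofGroup g).Maps x (c.smul g x) :=
  ⟨c.arrow g x, c.mk_arrow g x, src_arrow _ _ _, tgt_arrow _ _ _⟩

/-- The composite of an arrow with an element of the group of the chart of its target. -/
noncomputable def postArrow (g : d.group) (γ : Arrows c d) : Arrows c d :=
  compArrow (d.arrow g (tgtPt γ)) γ (by rw [src_arrow, pt_tgtPt])

theorem postArrow_eq (g : d.group) {γ : Arrows c d} {y : d.carrier} (hy : P.tgt γ.1 = d.pt y) :
    (postArrow g γ).1 = P.comp (d.arrow g y).1 γ.1 := by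
  obtain rfl := tgtPt_eq hy
  rfl

theorem src_postArrow (g : d.group) (γ : Arrows c d) : P.src (postArrow g γ).1 = P.src γ.1 :=
  src_compArrow _ _ _

theorem tgt_postArrow (g : d.group) {γ : Arrows c d} {y : d.carrier} (hy : P.tgt γ.1 = d.pt y) :
    P.tgt (postArrow g γ).1 = d.pt (d.smul g y) := by
  obtain rfl := tgtPt_eq hy
  exact (tgt_compArrow _ _ _).trans (tgt_arrow _ _ _)

theorem continuous_postArrow (g : d.group) :
    Continuous (postArrow g : Arrows c d → Arrows c d) := by
  refine Continuous.subtype_mk (P.continuousOn_comp.comp_continuous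
    (f := fun γ : Arrows c d => ((d.arrow g (tgtPt γ)).1, γ.1)) ?_ ?_) _
  · exact (continuous_subtype_val.comp ((d.continuous_arrow g).comp continuous_tgtPt)).prodMk
      continuous_subtype_val
  · intro γ
    change P.src (d.arrow g (tgtPt γ)).1 = P.tgt γ.1
    rw [src_arrow, pt_tgtPt]

/-- The composite of a class of arrows with an element of the group of the target chart. -/
noncomputable def T.post (g : d.group) : T c d → T c d :=
  (continuous_postArrow g).connectedComponentsMap

theorem T.post_mk (g : d.group) (γ : Arrows c d) : T.post g (T.mk γ) = T.mk (postArrow g γ) := rfl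

theorem T.post_one (ξ : T c d) : T.post 1 ξ = ξ := by
  obtain ⟨γ, rfl⟩ := ξ.exists_mk
  rw [T.post_mk]
  congr 1
  apply Subtype.ext
  rw [postArrow_eq _ (pt_tgtPt γ).symm, arrow_one, pt_tgtPt, P.one_comp]

theorem T.post_mul (g h : d.group) (ξ : T c d) : T.post (g * h) ξ = T.post g (T.post h ξ) := by
  obtain ⟨γ, rfl⟩ := ξ.exists_mk
  rw [T.post_mk, T.post_mk, T.post_mk]
  congr 1
  apply Subtype.ext
  have hy := (pt_tgtPt γ).symm
  rw [postArrow_eq _ (tgt_postArrow h hy), postArrow_eq _ hy, postArrow_eq _ hy, arrow_mul,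
    P.assoc]
  · rw [src_arrow, tgt_arrow]
  · rw [src_arrow, hy]

theorem T.Maps.post (g : d.group) {ξ : T c d} {x : c.carrier} {y : d.carrier} (h : ξ.Maps x y) :
    (T.post g ξ).Maps x (d.smul g y) := by
  obtain ⟨γ, rfl, h2, h3⟩ := h
  exact ⟨postArrow g γ, rfl, (src_postArrow g γ).trans h2, tgt_postArrow g h3⟩

theorem T.Maps.compAt_ofGroup (g : d.group) {ξ : T c d} {x : c.carrier} {y : d.carrier}
    (h : ξ.Maps x y) : T.CompAt x ξ (d.ofGroup g) (T.post g ξ) := by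
  obtain ⟨γ, rfl, h2, h3⟩ := h
  exact ⟨γ, d.arrow g y, postArrow g γ, rfl, d.mk_arrow g y, rfl, h2,
    (src_arrow _ _ _).trans h3.symm, postArrow_eq g h3⟩

theorem T.CompAt.eq_post (h2 : P.C2) {g : d.group} {ξ : T c d} {ζ : T c d} {x : c.carrier}
    {y : d.carrier} (h : ξ.Maps x y) (H : T.CompAt x ξ (d.ofGroup g) ζ) : ζ = T.post g ξ := by
  obtain ⟨γ, rfl, h3, h4⟩ := h
  rw [← d.mk_arrow g y] at H
  rw [H.eq_mk h2 ((src_arrow _ _ _).trans h4.symm) h3, T.post_mk]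
  congr 1
  exact Subtype.ext (postArrow_eq g h4).symm

theorem T.CompAt.post (g : e.group) {x : c.carrier} {ξ : T c d} {ζ : T d e} {ω : T c e}
    (H : T.CompAt x ξ ζ ω) : T.CompAt x ξ (T.post g ζ) (T.post g ω) := by
  obtain ⟨γ, δ, h, rfl, rfl, rfl, h4⟩ := H.elim
  refine ⟨γ, postArrow g δ, postArrow g (compArrow δ γ h), rfl, rfl, rfl, h4,
    (src_postArrow g δ).trans h, ?_⟩
  have hy := (pt_tgtPt δ).symm
  rw [postArrow_eq g hy, postArrow_eq g ((tgt_compArrow δ γ h).trans hy)]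
  exact (P.assoc _ _ _ ((src_arrow _ _ _).trans hy.symm) h).symm

/-- Conjugation of arrows by elements of the groups of the charts. -/
noncomputable def conjArrow (g : c.group) (h : d.group) (γ : Arrows c d) : Arrows c d :=
  postArrow h (invArrow (postArrow g (invArrow γ)))

/-- Conjugation of classes of arrows by elements of the groups of the charts. -/
noncomputable def T.conj (g : c.group) (h : d.group) (ξ : T c d) : T c d :=
  T.post h (T.inv (T.post g (T.inv ξ)))

theorem T.conj_mk (g : c.group) (h : d.group) (γ : Arrows c d) :
    T.conj g h (T.mk γ) = T.mk (conjArrow g h γ) := rfl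

theorem src_conjArrow (g : c.group) (h : d.group) {γ : Arrows c d} {x : c.carrier}
    (hx : P.src γ.1 = c.pt x) : P.src (conjArrow g h γ).1 = c.pt (c.smul g x) := by
  rw [conjArrow, src_postArrow, src_invArrow,
    tgt_postArrow g ((tgt_invArrow γ).trans hx)]

theorem tgt_conjArrow (g : c.group) (h : d.group) {γ : Arrows c d} {y : d.carrier}
    (hy : P.tgt γ.1 = d.pt y) : P.tgt (conjArrow g h γ).1 = d.pt (d.smul h y) := by
  apply tgt_postArrow
  rw [tgt_invArrow, src_postArrow, src_invArrow, hy]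

theorem conjArrow_comp (g : c.group) (h : d.group) {γ : Arrows c d} {x : c.carrier}
    {y : d.carrier} (hx : P.src γ.1 = c.pt x) (hy : P.tgt γ.1 = d.pt y) :
    P.comp (conjArrow g h γ).1 (c.arrow g x).1 = P.comp (d.arrow h y).1 γ.1 := by
  have hx' : P.tgt (invArrow γ).1 = c.pt x := (tgt_invArrow γ).trans hx
  have e1 : P.src (c.arrow g x).1 = P.tgt (P.inv γ.1) := by rw [src_arrow, P.tgt_inv, hx]
  have e2 : (invArrow (postArrow g (invArrow γ))).1 = P.comp γ.1 (P.inv (c.arrow g x).1) := by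
    change P.inv (postArrow g (invArrow γ)).1 = _
    rw [postArrow_eq g hx']
    change P.inv (P.comp _ (P.inv γ.1)) = _
    rw [P.inv_comp_rev e1, P.inv_inv]
  have e3 : P.src γ.1 = P.tgt (P.inv (c.arrow g x).1) := by rw [P.tgt_inv, src_arrow, hx]
  have e4 : P.tgt (invArrow (postArrow g (invArrow γ))).1 = d.pt y := by
    rw [e2, P.tgt_comp _ _ e3, hy]
  rw [conjArrow, postArrow_eq h e4, e2, P.assoc, P.comp_cancel_inv]
  · rw [hx, src_arrow]
  · rw [P.tgt_comp _ _ e3, src_arrow, hy]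
  · rw [P.src_comp _ _ e3, P.src_inv]

theorem conj_conjArrow (g : c.group) (h : d.group) (γ : Arrows c d) :
    Conj g h γ (conjArrow g h γ) :=
  have hx := (pt_srcPt γ).symm
  have hy := (pt_tgtPt γ).symm
  ⟨_, _, hx, hy, src_conjArrow g h hx, conjArrow_comp g h hx hy⟩

theorem Conj.eq_conjArrow {g : c.group} {h : d.group} {γ δ : Arrows c d} (H : Conj g h γ δ) :
    δ = conjArrow g h γ := by
  obtain ⟨x, y, hx, hy, hs, hc⟩ := H
  apply Subtype.ext
  refine P.comp_right_cancel (ε := (c.arrow g x).1) ?_ ?_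
    (hc.trans (conjArrow_comp g h hx hy).symm)
  · rw [hs, tgt_arrow]
  · rw [src_conjArrow g h hx, tgt_arrow]

theorem T.Maps.conj (g : c.group) (h : d.group) {ξ : T c d} {x : c.carrier} {y : d.carrier}
    (H : ξ.Maps x y) : (T.conj g h ξ).Maps (c.smul g x) (d.smul h y) := by
  obtain ⟨γ, rfl, hx, hy⟩ := H
  exact ⟨conjArrow g h γ, rfl, src_conjArrow g h hx, tgt_conjArrow g h hy⟩

theorem T.CompAt.conj_post (g : d.group) (h : e.group) {x : c.carrier} {ξ : T c d} {ζ : T d e}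
    {ω : T c e} (H : T.CompAt x ξ ζ ω) :
    T.CompAt x (T.post g ξ) (T.conj g h ζ) (T.post h ω) := by
  obtain ⟨γ, δ, e1, rfl, rfl, rfl, e4⟩ := H.elim
  have hy := (pt_srcPt δ).symm
  have hy' : P.tgt γ.1 = d.pt (srcPt δ) := e1.symm.trans hy
  have hz := (pt_tgtPt δ).symm
  have e5 : P.src (d.arrow g (srcPt δ)).1 = P.tgt γ.1 := (src_arrow _ _ _).trans hy'.symm
  refine ⟨postArrow g γ, conjArrow g h δ, postArrow h (compArrow δ γ e1), rfl, rfl, rfl,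
    (src_postArrow g γ).trans e4, (src_conjArrow g h hy).trans (tgt_postArrow g hy').symm, ?_⟩
  rw [postArrow_eq h ((tgt_compArrow δ γ e1).trans hz), postArrow_eq g hy', ← P.assoc,
    conjArrow_comp g h hy hz, P.assoc]
  · rfl
  · rw [src_arrow, hz]
  · exact e1
  · rw [src_conjArrow g h hy, tgt_arrow]
  · exact e5

theorem T.CompAt.conj (g : c.group) (h : d.group) (k : e.group) {x : c.carrier} {ξ : T c d}
    {ζ : T d e} {ω : T c e} (H : T.CompAt x ξ ζ ω) :
    T.CompAt (c.smul g x) (T.conj g h ξ) (T.conj h k ζ) (T.conj g k ω) := by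
  obtain ⟨γ, δ, e1, rfl, rfl, rfl, hx⟩ := H.elim
  have hy := (pt_srcPt δ).symm
  have hy' : P.tgt γ.1 = d.pt (srcPt δ) := e1.symm.trans hy
  have hz := (pt_tgtPt δ).symm
  have e2 : P.src (conjArrow h k δ).1 = P.tgt (conjArrow g h γ).1 :=
    (src_conjArrow h k hy).trans (tgt_conjArrow g h hy').symm
  have hx1 := src_conjArrow g h hx
  refine ⟨conjArrow g h γ, conjArrow h k δ, conjArrow g k (compArrow δ γ e1), rfl, rfl, rfl,
    hx1, e2, ?_⟩
  have hc : Conj g k (compArrow δ γ e1) (compArrow (conjArrow h k δ) (conjArrow g h γ) e2) := by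
    refine ⟨x, tgtPt δ, (src_compArrow _ _ _).trans hx, (tgt_compArrow _ _ _).trans hz,
      (src_compArrow _ _ _).trans hx1, ?_⟩
    change P.comp (P.comp _ _) _ = P.comp _ (P.comp _ _)
    rw [P.assoc _ _ _ e2 (by rw [hx1, tgt_arrow]), conjArrow_comp g h hx hy', ← P.assoc,
      conjArrow_comp h k hy hz, P.assoc]
    · rw [src_arrow, hz]
    · exact e1
    · rw [src_conjArrow h k hy, tgt_arrow]
    · rw [src_arrow, hy']
  exact congrArg Subtype.val hc.eq_conjArrow.symm

/-- If `ξ ∘ g` and `h ∘ ξ` agree at `x`, the arrow of `ξ` starting at `g x` is `h γ g⁻¹`, so `ξ` and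
its conjugate share an arrow. -/
theorem T.conj_eq_self (h2 : P.C2) {g : c.group} {h : d.group} {ξ : T c d} {x : c.carrier}
    {y : d.carrier} (H : ξ.Maps x y) (hc : T.CompAt x (c.ofGroup g) ξ (T.post h ξ)) :
    T.conj g h ξ = ξ := by
  obtain ⟨γ, rfl, hx, hy⟩ := H
  obtain ⟨ε, δ, e1, a1, a2, a3, a4⟩ := hc.elim
  obtain rfl := T.eq_of_src_eq h2 (a1.trans (c.mk_arrow g x).symm)
    (a4.trans (src_arrow _ _ _).symm)
  have e2 := T.eq_of_src_eq h2 (a3.trans (T.post_mk h γ))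
    (by rw [src_compArrow, src_arrow, src_postArrow, hx])
  have hc : Conj g h γ δ :=
    ⟨x, y, hx, hy, e1.trans (tgt_arrow _ _ _),
      (congrArg Subtype.val e2).trans (postArrow_eq h hy)⟩
  rw [T.conj_mk, ← hc.eq_conjArrow, a2]

theorem T.Maps.one_compAt {ξ : T c d} {x : c.carrier} {y : d.carrier} (H : ξ.Maps x y) :
    T.CompAt x (c.ofGroup 1) ξ ξ := by
  obtain ⟨γ, rfl, hx, hy⟩ := H
  refine ⟨c.arrow 1 x, γ, γ, c.mk_arrow 1 x, rfl, rfl, src_arrow _ _ _, ?_, ?_⟩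
  · rw [tgt_arrow, smul_one, hx]
  · rw [arrow_one, ← hx, P.comp_one]

end ChartGroups

/-! ### The group of a shape and its action. -/

section ShapeGroups

open Filter

variable {X : Type*} [TopologicalSpace X] {ι : Type*} {E : ι → Type*}
  [∀ i, TopologicalSpace (E i)] {G : ι → Type*} [∀ i, Group (G i)]
  {A : Type*} [TopologicalSpace A]
  {X' : Type*} [TopologicalSpace X'] {ι' : Type*} {E' : ι' → Type*}
  [∀ i, TopologicalSpace (E' i)] {G' : ι' → Type*} [∀ i, Group (G' i)]
  {A' : Type*} [TopologicalSpace A']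
  {P : OrbispaceStr X E G A} {P' : OrbispaceStr X' E' G' A'}

/-- Conjugation is an invertible operation on classes, so the condition on pairs of conjugate arrows
says that each `ρ(ξ)` is fixed. -/
theorem mem_shapeGroup_iff {r : AdmShape P P'} {g : ∀ α : r.1.cover, (r.1.target α).group} :
    g ∈ ShapeGroup r ↔ ∀ (α β : r.1.cover) (ξ : T α.1 β.1),
      T.conj (g α) (g β) (r.1.rho α β ξ) = r.1.rho α β ξ := by
  constructor
  · intro hg α β ξ
    obtain ⟨γ, hγ⟩ := (r.1.rho α β ξ).exists_mk
    have := (hg α β γ _ (conj_conjArrow _ _ γ) ξ).1 hγ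
    rwa [← T.conj_mk, hγ] at this
  · intro hg α β γ δ hc ξ
    constructor
    · intro e
      rw [hc.eq_conjArrow, ← T.conj_mk, e, hg]
    · intro e
      obtain ⟨γ', hγ'⟩ := (r.1.rho α β ξ).exists_mk
      have h1 : T.mk (conjArrow (g α) (g β) γ') = T.mk δ := by rw [← T.conj_mk, hγ', hg, e]
      have hc' : Conj (g α)⁻¹ (g β)⁻¹ δ γ := conj_inv (by rwa [_root_.inv_inv, _root_.inv_inv])
      have hc'' : Conj (g α)⁻¹ (g β)⁻¹ (conjArrow (g α) (g β) γ') γ' :=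
        conj_inv (by rw [_root_.inv_inv, _root_.inv_inv]; exact conj_conjArrow _ _ _)
      rw [hc'.eq_conjArrow, ← hγ', hc''.eq_conjArrow, ← T.conj_mk, ← T.conj_mk, ← h1]

/-- The composite of a family of local maps with a family of group elements. -/
def Shape.smulMaps {r : Shape P P'} (g : ∀ α : r.cover, (r.target α).group) (f : r.LocalMaps) :
    r.LocalMaps := fun α x => (r.target α).smul (g α) (f α x)

theorem IsHom.smul {r : AdmShape P P'} {f : r.1.LocalMaps} (hf : IsHom r.1 f)
    (g : ShapeGroup r) : IsHom r.1 (Shape.smulMaps g.1 f) where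
  continuous α := (LocalChart.continuous_smul _ _).comp (hf.continuous α)
  maps α β ξ x y h := by
    have := (hf.maps α β ξ x y h).conj (g.1 α) (g.1 β)
    rwa [mem_shapeGroup_iff.1 g.2] at this
  comp α β δ ξ η ζ x h := by
    have := (hf.comp α β δ ξ η ζ x h).conj (g.1 α) (g.1 β) (g.1 δ)
    rwa [mem_shapeGroup_iff.1 g.2, mem_shapeGroup_iff.1 g.2, mem_shapeGroup_iff.1 g.2] at this

theorem LimClass.exists_eq {c d : LocalChart P} {c' d' : LocalChart P'} {η : T c d → T c' d'}
    {γ : A} {τ : T c' d'} (h : LimClass η γ τ) (hγ : γ ∈ closure (Arrows c d)) :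
    ∃ ξ, η ξ = τ := by
  obtain ⟨δ, hδ, h'⟩ := ((mem_closure_iff_frequently.1 hγ).and_eventually h).exists
  exact ⟨_, h' hδ⟩

theorem IsAdmissible.smul {r : AdmShape P P'} {f : r.1.LocalMaps} (hf : IsAdmissible r.1 f)
    (g : ShapeGroup r) : IsAdmissible r.1 (Shape.smulMaps g.1 f) := by
  obtain ⟨F, hF⟩ := hf.exists_isExtension
  refine IsExtension.isAdmissible hf (F := fun α x => (r.1.target α).smul (g.1 α) (F α x))
    ⟨fun α => (LocalChart.continuous_smul _ _).comp (hF.continuous α), ?_, ?_⟩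
  · intro α x
    rw [hF.eq]
    rfl
  · intro α β x y γ hγ hx hy
    obtain ⟨γ', h1, h2, l⟩ := hF.arrows α β x y γ hγ hx hy
    refine ⟨conjArrow (g.1 α) (g.1 β) γ', src_conjArrow _ _ h1, tgt_conjArrow _ _ h2, ?_⟩
    obtain ⟨ξ, hξ⟩ := l.exists_eq hγ
    rwa [← T.conj_mk, ← hξ, mem_shapeGroup_iff.1 g.2, hξ]

/-- The action of the group of a shape. -/
def HomSpace.smul {r : AdmShape P P'} (g : ShapeGroup r) (f : HomSpace r) : HomSpace r :=
  ⟨Shape.smulMaps g.1 f.1, f.2.1.smul g, f.2.2.smul g⟩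

theorem HomSpace.one_smul {r : AdmShape P P'} (f : HomSpace r) :
    HomSpace.smul (1 : ShapeGroup r) f = f :=
  Subtype.ext (funext fun _ => funext fun _ => OrbispaceStr.smul_one _ _)

theorem HomSpace.mul_smul {r : AdmShape P P'} (g h : ShapeGroup r) (f : HomSpace r) :
    HomSpace.smul (g * h) f = HomSpace.smul g (HomSpace.smul h f) :=
  Subtype.ext (funext fun _ => funext fun _ => OrbispaceStr.smul_mul _ _ _ _)

/-- The isomorphism `ξ ↦ g_β ∘ ρ_{βα}(ξ)` given by an element of the group of a shape. -/
noncomputable def ShapeGroup.transf {r : AdmShape P P'} (g : ShapeGroup r) : Transf r r :=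
  fun α β ξ => T.post (g.1 β) (r.1.rho α β ξ)

theorem ShapeGroup.transf_one {r : AdmShape P P'} :
    ShapeGroup.transf (1 : ShapeGroup r) = fun α β => r.1.rho α β := by
  funext α β ξ
  exact T.post_one _

theorem ShapeGroup.isTransf {r : AdmShape P P'} (g : ShapeGroup r) (f : HomSpace r) :
    IsTransf (ShapeGroup.transf g) f (f.smul g) where
  maps a α ξ x y h := (f.2.1.maps a α ξ x y h).post (g.1 α)
  comp_left a α β ξ ζ ω x h := by
    have := (f.2.1.comp a α β ξ ζ ω x h).conj_post (g.1 α) (g.1 β)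
    rwa [mem_shapeGroup_iff.1 g.2] at this
  comp_right a b α ξ ζ ω x h := (f.2.1.comp a b α ξ ζ ω x h).post (g.1 α)

theorem ShapeGroup.compAt_transf_mul {r : AdmShape P P'} (g h : ShapeGroup r) (f : HomSpace r)
    {a b c : r.1.cover} {x : a.1.carrier} {ξ : T a.1 b.1} {ζ : T b.1 c.1} {ω : T a.1 c.1}
    (H : T.CompAt x ξ ζ ω) :
    T.CompAt (f.1 a x) (ShapeGroup.transf h a b ξ) (ShapeGroup.transf g b c ζ)
      (ShapeGroup.transf (g * h) a c ω) := by
  have e : ShapeGroup.transf (g * h) a c ω = T.post (g.1 c) (ShapeGroup.transf h a c ω) :=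
    T.post_mul _ _ _
  rw [e]
  exact ((ShapeGroup.isTransf h f).comp_left a b c ξ ζ ω x H).post (g.1 c)

theorem ShapeGroup.transf_injective (h2' : P'.C2) {r : AdmShape P P'} (f : HomSpace r)
    {g h : ShapeGroup r} (e : ShapeGroup.transf g = ShapeGroup.transf h) : g = h := by
  apply Subtype.ext
  funext α
  obtain ⟨x, hx⟩ := α.1.isConnected_carrier.nonempty
  obtain ⟨γ, h1, h2, h3⟩ := f.2.1.maps α α _ _ _ (T.maps_ofGroup 1 ⟨x, hx⟩)
  have e1 : T.post (g.1 α) (T.mk γ) = T.post (h.1 α) (T.mk γ) := by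
    rw [h1]
    exact congrFun (congrFun (congrFun e α) α) _
  have e2 := T.eq_of_src_eq h2' e1 (by rw [src_postArrow, src_postArrow])
  have e3 := congrArg Subtype.val e2
  rw [postArrow_eq _ h3, postArrow_eq _ h3] at e3
  exact LocalChart.arrow_injective (Subtype.ext (P'.comp_right_cancel
    ((src_arrow _ _ _).trans h3.symm) ((src_arrow _ _ _).trans h3.symm) e3))

/-- All isomorphisms between homomorphisms of the same shape come from the group of the shape. -/
theorem IsTransf.exists_shapeGroup (h2' : P'.C2) {r : AdmShape P P'} {η : Transf r r}
    {f h : HomSpace r} (H : IsTransf η f h) :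
    ∃ g : ShapeGroup r, η = ShapeGroup.transf g ∧ h = f.smul g := by
  -- The group element at `α` is the value of `η` on the identity class. Writing `ξ` as `1 ∘ ξ` and
  -- as `ξ ∘ 1` gives `η(ξ) = g_β ρ(ξ)` and `η(ξ) = ρ(ξ) g_α`, and comparing the two is the
  -- condition for membership in `ShapeGroup`.
  choose g hg using fun α : r.1.cover => (η α α (α.1.ofGroup 1)).exists_ofGroup
  have hη : ∀ (α β : r.1.cover) (ξ : T α.1 β.1), η α β ξ = T.post (g β) (r.1.rho α β ξ) ∧
      T.conj (g α) (g β) (r.1.rho α β ξ) = r.1.rho α β ξ := by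
    intro α β ξ
    obtain ⟨γ, rfl⟩ := ξ.exists_mk
    have m := T.maps_mk γ
    have m' := f.2.1.maps _ _ _ _ _ m
    have k1 := H.comp_right _ _ _ _ _ _ _ (m.compAt_ofGroup 1)
    rw [T.post_one, hg] at k1
    have k2 := H.comp_left _ _ _ _ _ _ _ m.one_compAt
    have k3 := k1.eq_post h2' m'
    rw [hg, k3] at k2
    exact ⟨k3, T.conj_eq_self h2' m' k2⟩
  refine ⟨⟨g, mem_shapeGroup_iff.2 fun α β ξ => (hη α β ξ).2⟩, ?_, ?_⟩
  · funext α β ξ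
    exact (hη α β ξ).1
  · apply Subtype.ext
    funext α x
    have m := T.maps_ofGroup (1 : α.1.group) x
    rw [OrbispaceStr.smul_one] at m
    have m' := H.maps _ _ _ _ _ m
    rw [hg] at m'
    exact m'.unique h2' (T.maps_ofGroup _ _)

end ShapeGroups

end OrbispaceStr

namespace OrbispaceStr

/-! ### Inverses and associativity for composites of classes. -/

section Composition

variable {X : Type*} [TopologicalSpace X] {ι : Type*} {E : ι → Type*}
  [∀ i, TopologicalSpace (E i)] {G : ι → Type*} [∀ i, Group (G i)]
  {A : Type*} [TopologicalSpace A] {P : OrbispaceStr X E G A} {b c d e : LocalChart P}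

theorem T.CompAt.inv_right {x : b.carrier} {ξ : T b c} {ζ : T c d} {ω : T b d}
    (H : T.CompAt x ξ ζ ω) : T.CompAt x ω ζ.inv ξ := by
  obtain ⟨γ, δ, h, rfl, rfl, rfl, hx⟩ := H.elim
  exact ⟨compArrow δ γ h, invArrow δ, γ, rfl, rfl, rfl, (src_compArrow _ _ _).trans hx,
    (src_invArrow δ).trans (tgt_compArrow δ γ h).symm, (P.inv_comp_cancel h).symm⟩

theorem T.CompAt.assoc (h2 : P.C2) {x : b.carrier} {y : c.carrier} {ξ : T b c} {ζ : T c d}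
    {ω : T b d} {κ : T d e} {μ : T c e} {ν : T b e} (hy : ξ.Maps x y) (h₁ : T.CompAt x ξ ζ ω)
    (h₂ : T.CompAt x ω κ ν) (h₃ : T.CompAt y ζ κ μ) : T.CompAt x ξ μ ν := by
  obtain ⟨γ, δ, e1, rfl, rfl, rfl, e4⟩ := h₁.elim
  obtain ⟨γ', a1, a2, a3⟩ := hy
  obtain rfl := T.eq_of_src_eq h2 a1 (a2.trans e4.symm)
  obtain ⟨δ', ε, e5, b1, rfl, rfl, b4⟩ := h₃.elim
  obtain rfl := T.eq_of_src_eq h2 b1 (b4.trans (e1.trans a3).symm)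
  have e6 : P.src (compArrow ε δ' e5).1 = P.tgt γ'.1 := (src_compArrow _ _ _).trans e1
  have e7 : P.src ε.1 = P.tgt (compArrow δ' γ' e1).1 := e5.trans (tgt_compArrow _ _ _).symm
  rw [h₂.eq_mk h2 e7 ((src_compArrow _ _ _).trans e4)]
  exact ⟨γ', compArrow ε δ' e5, compArrow ε (compArrow δ' γ' e1) e7, rfl, rfl, rfl, e4, e6,
    (P.assoc _ _ _ e5 e1).symm⟩

end Composition

/-! ### The mapping groupoid and its orbit space. -/

section MappingGroupoid

open Filter

variable {X : Type*} [TopologicalSpace X] {ι : Type*} {E : ι → Type*}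
  [∀ i, TopologicalSpace (E i)] {G : ι → Type*} [∀ i, Group (G i)]
  {A : Type*} [TopologicalSpace A]
  {X' : Type*} [TopologicalSpace X'] {ι' : Type*} {E' : ι' → Type*}
  [∀ i, TopologicalSpace (E' i)] {G' : ι' → Type*} [∀ i, Group (G' i)]
  {A' : Type*} [TopologicalSpace A']
  {P : OrbispaceStr X E G A} {P' : OrbispaceStr X' E' G' A'}

/-- The composition law for isomorphisms between admissible homomorphisms. -/
def CompLaw {r s t : AdmShape P P'} (η₁ : Transf r s) (η₂ : Transf s t) (η : Transf r t)
    (f : HomSpace r) : Prop :=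
  ∀ (a : r.1.cover) (b : s.1.cover) (c : t.1.cover) (x : a.1.carrier) (ξ : T a.1 b.1)
    (ζ : T b.1 c.1) (ω : T a.1 c.1), T.CompAt x ξ ζ ω →
    T.CompAt (f.1 a x) (η₁ a b ξ) (η₂ b c ζ) (η a c ω)

theorem CompLaw.exists (h1 : P.C1) (h1' : P'.C1) (h2' : P'.C2) {r s t : AdmShape P P'}
    {η₁ : Transf r s} {η₂ : Transf s t} {f : HomSpace r} {g : HomSpace s} {h : HomSpace t}
    (H₁ : IsTransf η₁ f g) (H₂ : IsTransf η₂ g h) :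
    ∃ η : Transf r t, IsTransf η f h ∧ CompLaw η₁ η₂ η f := by
  obtain ⟨η, hη, hc⟩ := H₁.isNat.exists_comp h1 h1' h2' f.2.1 g.2.1 h.2.1 H₂.isNat
  exact ⟨η, ⟨hη.maps, hη.comp_left, hη.comp_right⟩, hc⟩

theorem CompLaw.unique (h2' : P'.C2) {r s t : AdmShape P P'} {η₁ : Transf r s} {η₂ : Transf s t}
    {f : HomSpace r} {g : HomSpace s} {h : HomSpace t} (H₁ : IsTransf η₁ f g)
    (H₂ : IsTransf η₂ g h) {η η' : Transf r t} (hη : CompLaw η₁ η₂ η f)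
    (hη' : CompLaw η₁ η₂ η' f) : η = η' :=
  H₁.isNat.comp_unique h2' H₂.isNat hη hη'

/-- The law continues from `f` to `f'` along the connected sets of `IsTransf.exists_connected`, so a
single `η` is the composite of `η₁` and `η₂` for all sources near `f`. -/
theorem CompLaw.eventually (h1 : P.C1) (h1' : P'.C1) (h2' : P'.C2)
    (hX : P.IsParacompactLocallyCompactHausdorff) {r s t : AdmShape P P'} {η₁ : Transf r s}
    {η₂ : Transf s t} {η : Transf r t} {f : HomSpace r} {g : HomSpace s} {h : HomSpace t}
    (H₁ : IsTransf η₁ f g) (H : IsTransf η f h) (hc : CompLaw η₁ η₂ η f) :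
    ∀ᶠ f' in 𝓝 f, CompLaw η₁ η₂ η f' := by
  obtain ⟨N, hN, hNc⟩ := H₁.exists_connected h1 h1' h2' hX H
  filter_upwards [hN] with f' hf' a b c x ξ ζ ω hx
  obtain ⟨O, -, hOc, hfO, hfO', hs, ht⟩ := hNc f' hf' a x
  obtain ⟨γ, δ, e, -, -, -, e4⟩ := hx.elim
  refine (hc a b c x ξ ζ ω hx).of_isPreconnected h1' h2' hOc hfO (hs b (subset_closure ?_))
    (ht c (subset_closure ?_)) hfO'
  · rw [← e4]
    exact proj_src_mem_image γ
  · rw [← e4, ← src_compArrow δ γ e]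
    exact proj_src_mem_image _

theorem CompLaw.assoc (h2' : P'.C2) {r s t u : AdmShape P P'} {η₁ : Transf r s} {η₂ : Transf s t}
    {η₃ : Transf t u} {η₁₂ : Transf r t} {η₂₃ : Transf s u} {η : Transf r u} {f : HomSpace r}
    {g : HomSpace s} (H₁ : IsTransf η₁ f g) (h₁₂ : CompLaw η₁ η₂ η₁₂ f)
    (h : CompLaw η₁₂ η₃ η f) (h₂₃ : CompLaw η₂ η₃ η₂₃ g) : CompLaw η₁ η₂₃ η f := by
  intro a b d x ξ ζ ω H
  obtain ⟨γ, δ, e, rfl, rfl, rfl, e4⟩ := H.elim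
  -- The laws for `η₁₂` and `η₃` concern only arrows split through a chart of `t`, so `δ` is written
  -- as `κ ε` with `ε` ending in such a chart.
  obtain ⟨c, ε, hε⟩ := t.1.exists_arrow δ
  let κ := compArrow δ (invArrow ε) (by rw [tgt_invArrow, hε])
  have e1 : P.src κ.1 = P.tgt ε.1 := by rw [src_compArrow, src_invArrow]
  have e2 : P.src ε.1 = P.tgt γ.1 := hε.trans e
  have e3 : compArrow κ ε e1 = δ := Subtype.ext (P.comp_cancel_inv hε.symm)
  have e5 : P.src κ.1 = P.tgt (compArrow ε γ e2).1 := e1.trans (tgt_compArrow _ _ _).symm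
  have e6 : compArrow κ (compArrow ε γ e2) e5 = compArrow δ γ e := by
    apply Subtype.ext
    change P.comp κ.1 (P.comp ε.1 γ.1) = P.comp δ.1 γ.1
    rw [← P.assoc _ _ _ e1 e2]
    exact congrArg (fun z => P.comp z.1 γ.1) e3
  have hy := (pt_tgtPt γ).symm
  have k1 := h₁₂ _ _ _ _ _ _ _ (T.CompAt.of_arrows γ ε e2 e4)
  have k2 := h _ _ _ _ _ _ _ (T.CompAt.of_arrows _ κ e5 ((src_compArrow _ _ _).trans e4))
  have k3 := h₂₃ _ _ _ _ _ _ _ (T.CompAt.of_arrows ε κ e1 (e2.trans hy))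
  rw [e6] at k2
  rw [e3] at k3
  exact T.CompAt.assoc h2' (H₁.maps _ _ _ _ _ ⟨γ, rfl, e4, hy⟩) k1 k2 k3

namespace MapArrow

/-- The arrow given by an element of a sheet. -/
def ofSheet {r s : AdmShape P P'} {η : Transf r s} (p : Sheet η) : MapArrow P P' :=
  ⟨⟨r, s, η⟩, p⟩

theorem isOpenEmbedding_ofSheet {r s : AdmShape P P'} (η : Transf r s) :
    IsOpenEmbedding (ofSheet : Sheet η → MapArrow P P') :=
  IsOpenEmbedding.sigmaMk (σ := fun k : (Σ r s : AdmShape P P', Transf r s) => Sheet k.2.2)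
    (i := ⟨r, s, η⟩)

/-- The source of an arrow of the mapping groupoid. -/
def src (m : MapArrow P P') : Σ r : AdmShape P P', HomSpace r := ⟨m.1.1, m.2.1.1⟩

/-- The target of an arrow of the mapping groupoid. -/
def tgt (m : MapArrow P P') : Σ r : AdmShape P P', HomSpace r := ⟨m.1.2.1, m.2.1.2⟩

/-- The identity arrows of the mapping groupoid. -/
def one (u : Σ r : AdmShape P P', HomSpace r) : MapArrow P P' :=
  mk (fun a b => u.1.1.rho a b) u.2 u.2 (isTransf_rho u.2)

/-- The inverse of an arrow of the mapping groupoid. -/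
def inv (h2' : P'.C2) (m : MapArrow P P') : MapArrow P P' :=
  ⟨⟨m.1.2.1, m.1.1, m.1.2.2.inv⟩, Sheet.inv h2' m.2⟩

/-- `IsComp m₂ m₁ m` means that `m` is the composite of `m₂` and `m₁`. -/
inductive IsComp : MapArrow P P' → MapArrow P P' → MapArrow P P' → Prop
  | of {r s t : AdmShape P P'} {η₁ : Transf r s} {η₂ : Transf s t} {η : Transf r t}
    {f : HomSpace r} {g : HomSpace s} {h : HomSpace t} (H₁ : IsTransf η₁ f g)
    (H₂ : IsTransf η₂ g h) (H : IsTransf η f h) (hc : CompLaw η₁ η₂ η f) :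
    IsComp (mk η₂ g h H₂) (mk η₁ f g H₁) (mk η f h H)

theorem exists_eq_mk (m : MapArrow P P') : ∃ (r s : AdmShape P P') (η : Transf r s)
    (f : HomSpace r) (h : HomSpace s) (H : IsTransf η f h), m = mk η f h H :=
  ⟨m.1.1, m.1.2.1, m.1.2.2, m.2.1.1, m.2.1.2, m.2.2, rfl⟩

theorem mk_congr {r s : AdmShape P P'} {η η' : Transf r s} {f f' : HomSpace r}
    {h h' : HomSpace s} (H : IsTransf η f h) (hη : η = η') (hf : f = f') (hh : h = h') :
    mk η f h H = mk η' f' h' (hη ▸ hf ▸ hh ▸ H) := by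
  subst hη hf hh
  rfl

theorem exists_isComp (h1 : P.C1) (h1' : P'.C1) (h2' : P'.C2) {m₂ m₁ : MapArrow P P'}
    (e : src m₂ = tgt m₁) : ∃ m, IsComp m₂ m₁ m := by
  obtain ⟨r, s, η₁, f, g, H₁, rfl⟩ := exists_eq_mk m₁
  obtain ⟨s', t, η₂, g', h, H₂, rfl⟩ := exists_eq_mk m₂
  cases e
  obtain ⟨η, H, hc⟩ := CompLaw.exists h1 h1' h2' H₁ H₂
  exact ⟨_, .of H₁ H₂ H hc⟩

theorem IsComp.unique (h2' : P'.C2) {m₂ m₁ m m' : MapArrow P P'} (h : IsComp m₂ m₁ m)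
    (h' : IsComp m₂ m₁ m') : m = m' := by
  cases h with
  | of H₁ H₂ H hc =>
    cases h' with
    | of H₁' H₂' H' hc' =>
      exact mk_congr _ (hc.unique h2' H₁ H₂ hc') rfl rfl

open Classical in
/-- Composition in the mapping groupoid; the value is `m₁` if the composite is not defined. -/
noncomputable def comp (m₂ m₁ : MapArrow P P') : MapArrow P P' :=
  if h : ∃ m, IsComp m₂ m₁ m then h.choose else m₁

theorem IsComp.comp_eq (h2' : P'.C2) {m₂ m₁ m : MapArrow P P'} (h : IsComp m₂ m₁ m) :
    comp m₂ m₁ = m := by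
  have h' : ∃ m, IsComp m₂ m₁ m := ⟨m, h⟩
  rw [comp, dif_pos h']
  exact h'.choose_spec.unique h2' h

theorem isComp_comp (h1 : P.C1) (h1' : P'.C1) (h2' : P'.C2) {m₂ m₁ : MapArrow P P'}
    (e : src m₂ = tgt m₁) : IsComp m₂ m₁ (comp m₂ m₁) := by
  obtain ⟨m, h⟩ := exists_isComp h1 h1' h2' e
  rwa [h.comp_eq h2']

theorem IsComp.src_eq {m₂ m₁ m : MapArrow P P'} (h : IsComp m₂ m₁ m) : src m = src m₁ := by
  cases h
  rfl

theorem IsComp.tgt_eq {m₂ m₁ m : MapArrow P P'} (h : IsComp m₂ m₁ m) : tgt m = tgt m₂ := by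
  cases h
  rfl

theorem inv_inv (h2' : P'.C2) (m : MapArrow P P') : inv h2' (inv h2' m) = m := by
  obtain ⟨r, s, η, f, h, H, rfl⟩ := exists_eq_mk m
  exact mk_congr _ η.inv_inv rfl rfl

theorem isComp_one (m : MapArrow P P') : IsComp m (one (src m)) m := by
  obtain ⟨r, s, η, f, h, H, rfl⟩ := exists_eq_mk m
  exact .of (isTransf_rho f) H H fun a b c x ξ ζ ω => H.comp_right a b c ξ ζ ω x

theorem one_isComp (m : MapArrow P P') : IsComp (one (tgt m)) m m := by
  obtain ⟨r, s, η, f, h, H, rfl⟩ := exists_eq_mk m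
  exact .of H (isTransf_rho h) H fun a b c x ξ ζ ω => H.comp_left a b c ξ ζ ω x

theorem inv_isComp (h2' : P'.C2) (m : MapArrow P P') :
    IsComp (inv h2' m) m (one (src m)) := by
  obtain ⟨r, s, η, f, h, H, rfl⟩ := exists_eq_mk m
  exact .of H (H.inv h2') (isTransf_rho f) fun a b c x ξ ζ ω hc =>
    (H.comp_right _ _ _ _ _ _ _ hc.inv_right).inv_right

theorem IsComp.assoc (h2' : P'.C2) {m₃ m₂ m₁ m₃₂ m₂₁ m : MapArrow P P'} (h₂₁ : IsComp m₂ m₁ m₂₁)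
    (h₃₂ : IsComp m₃ m₂ m₃₂) (h : IsComp m₃ m₂₁ m) : IsComp m₃₂ m₁ m := by
  cases h₂₁ with
  | of H₁ H₂ H hc =>
    cases h₃₂ with
    | of _ H₃ H' hc' =>
      cases h with
      | of _ _ H'' hc'' => exact .of H₁ H' H'' (hc.assoc h2' H₁ hc'' hc')

/-- Within a sheet a neighbourhood is detected by the source alone, so continuity into the space of
arrows reduces to continuity of the source. -/
theorem mem_nhds_mk (h1 : P.C1) (h1' : P'.C1) (h2' : P'.C2)
    (hX : P.IsParacompactLocallyCompactHausdorff) {r s : AdmShape P P'} {η : Transf r s}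
    {f : HomSpace r} {h : HomSpace s} (H : IsTransf η f h) {W : Set (MapArrow P P')}
    (hW : W ∈ 𝓝 (mk η f h H)) : ∀ᶠ f' in 𝓝 f, ∀ h' (H' : IsTransf η f' h'), mk η f' h' H' ∈ W := by
  have := (isOpenEmbedding_sheet_fst h1 h1' h2' hX η).image_mem_nhds.2
    ((isOpenEmbedding_ofSheet η).continuous.continuousAt (x := ⟨(f, h), H⟩) hW)
  filter_upwards [this] with f' hf' h' H'
  obtain ⟨⟨⟨f'', h''⟩, H''⟩, hw, rfl⟩ := hf'
  obtain rfl := H'.target_unique h2' H''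
  exact hw

theorem continuous_of_sheet {Y : Type*} [TopologicalSpace Y] {φ : MapArrow P P' → Y}
    (h : ∀ (r s : AdmShape P P') (η : Transf r s),
      Continuous fun p : Sheet η => φ (ofSheet p)) : Continuous φ :=
  continuous_sigma fun k => h k.1 k.2.1 k.2.2

theorem isLocalHomeomorph_of_sheet {Y : Type*} [TopologicalSpace Y] {φ : MapArrow P P' → Y}
    (h : ∀ (r s : AdmShape P P') (η : Transf r s),
      IsOpenEmbedding fun p : Sheet η => φ (ofSheet p)) : IsLocalHomeomorph φ := by
  rw [isLocalHomeomorph_iff_isOpenEmbedding_restrict]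
  rintro ⟨⟨r, s, η⟩, p⟩
  change ∃ U ∈ 𝓝 (ofSheet (η := η) p), _
  have hs := isOpenEmbedding_ofSheet (P := P) (P' := P') η
  refine ⟨Set.range ofSheet, hs.isOpen_range.mem_nhds ⟨p, rfl⟩, ?_⟩
  have : (Set.range (ofSheet : Sheet η → MapArrow P P')).domRestrict φ =
      (fun p : Sheet η => φ (ofSheet p)) ∘ hs.isEmbedding.toHomeomorph.symm := by
    funext q
    obtain ⟨q, rfl⟩ := hs.isEmbedding.toHomeomorph.surjective q
    rw [Function.comp, Homeomorph.symm_apply_apply]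
    rfl
  rw [this]
  exact (h r s η).comp (Homeomorph.isOpenEmbedding _)

theorem isOpenEmbedding_src_sheet (h1 : P.C1) (h1' : P'.C1) (h2' : P'.C2)
    (hX : P.IsParacompactLocallyCompactHausdorff) (r s : AdmShape P P') (η : Transf r s) :
    IsOpenEmbedding fun p : Sheet η => src (ofSheet p) :=
  (IsOpenEmbedding.sigmaMk (i := r)).comp (isOpenEmbedding_sheet_fst h1 h1' h2' hX η)

theorem isOpenEmbedding_tgt_sheet (h1 : P.C1) (h1' : P'.C1) (h2' : P'.C2)
    (hX : P.IsParacompactLocallyCompactHausdorff) (r s : AdmShape P P') (η : Transf r s) :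
    IsOpenEmbedding fun p : Sheet η => tgt (ofSheet p) :=
  (IsOpenEmbedding.sigmaMk (i := s)).comp (isOpenEmbedding_sheet_snd h1 h1' h2' hX η)

/-- A family of isomorphisms of the same type, with varying source, is continuous. -/
theorem continuous_mk {Y : Type*} [TopologicalSpace Y] {r s : AdmShape P P'} {η : Transf r s}
    (h1 : P.C1) (h1' : P'.C1) (h2' : P'.C2)
    (hX : P.IsParacompactLocallyCompactHausdorff) {φ : Y → HomSpace r} {ψ : Y → HomSpace s}
    (hφ : Continuous φ) (H : ∀ y, IsTransf η (φ y) (ψ y)) :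
    Continuous fun y => mk η (φ y) (ψ y) (H y) := by
  rw [continuous_iff_continuousAt]
  intro y
  refine tendsto_def.2 fun W hW => ?_
  filter_upwards [hφ.continuousAt.eventually (mem_nhds_mk h1 h1' h2' hX (H y) hW)] with z hz
  exact hz _ _

theorem continuousOn_comp (h1 : P.C1) (h1' : P'.C1) (h2' : P'.C2)
    (hX : P.IsParacompactLocallyCompactHausdorff) :
    ContinuousOn (fun p : MapArrow P P' × MapArrow P P' => comp p.1 p.2)
      {p | src p.1 = tgt p.2} := by
  rintro ⟨m₂, m₁⟩ (e : src m₂ = tgt m₁)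
  refine tendsto_def.2 fun W hW => ?_
  have hm := isComp_comp h1 h1' h2' e
  change W ∈ 𝓝 (comp m₂ m₁) at hW
  generalize comp m₂ m₁ = m at hm hW
  cases hm with
  | @of r s t η₁ η₂ η f g h H₁ H₂ H hc =>
    -- On this neighbourhood of the first arrow the law for the same `η` persists, so nearby
    -- composites stay in its sheet, and their membership in `W` is read off from the source.
    have n₁ := (isOpenEmbedding_ofSheet (P := P) (P' := P') η₁).image_mem_nhds.2
      ((continuous_sheet_fst η₁).continuousAt (x := ⟨(f, g), H₁⟩)
        ((hc.eventually h1 h1' h2' hX H₁ H).and (mem_nhds_mk h1 h1' h2' hX H hW)))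
    have n₂ := (isOpenEmbedding_ofSheet (P := P) (P' := P') η₂).isOpen_range.mem_nhds
      ⟨(⟨(g, h), H₂⟩ : Sheet η₂), rfl⟩
    filter_upwards [mem_nhdsWithin_of_mem_nhds (prod_mem_nhds n₂ n₁), self_mem_nhdsWithin]
      with ⟨m₂', m₁'⟩ ⟨⟨⟨⟨g'', h'⟩, H₂'⟩, e₂⟩, ⟨⟨⟨f', g'⟩, H₁'⟩, ⟨hc', hW'⟩, e₁⟩⟩ e'
    subst e₁ e₂
    have : g'' = g' := sigma_mk_injective (i := s) e'
    subst this
    obtain ⟨η', H', hc''⟩ := CompLaw.exists h1 h1' h2' H₁' H₂'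
    obtain rfl := hc''.unique h2' H₁' H₂' hc'
    have hcomp := (IsComp.of H₁' H₂' H' hc'').comp_eq h2'
    exact (congrArg (· ∈ W) hcomp).mpr (hW' _ _)

end MapArrow

/-- The groupoid of isomorphisms between admissible homomorphisms. -/
noncomputable def mapGroupoid (h1 : P.C1) (h1' : P'.C1) (h2' : P'.C2)
    (hX : P.IsParacompactLocallyCompactHausdorff) :
    TopGroupoid (Σ r : AdmShape P P', HomSpace r) (MapArrow P P') where
  src := MapArrow.src
  tgt := MapArrow.tgt
  one := MapArrow.one
  inv := MapArrow.inv h2'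
  comp := MapArrow.comp
  src_one _ := rfl
  tgt_one _ := rfl
  src_inv _ := rfl
  tgt_inv _ := rfl
  src_comp _ _ e := (MapArrow.isComp_comp h1 h1' h2' e).src_eq
  tgt_comp _ _ e := (MapArrow.isComp_comp h1 h1' h2' e).tgt_eq
  comp_one m := (MapArrow.isComp_one m).comp_eq h2'
  one_comp m := (MapArrow.one_isComp m).comp_eq h2'
  inv_comp m := (MapArrow.inv_isComp h2' m).comp_eq h2'
  comp_inv m := by
    have := (MapArrow.inv_isComp h2' (MapArrow.inv h2' m)).comp_eq h2'
    rwa [MapArrow.inv_inv] at this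
  assoc m₃ m₂ m₁ e e' := by
    have c₂₁ := MapArrow.isComp_comp h1 h1' h2' e'
    have c₃₂ := MapArrow.isComp_comp h1 h1' h2' e
    have c := MapArrow.isComp_comp h1 h1' h2' (e.trans c₂₁.tgt_eq.symm)
    exact (c₂₁.assoc h2' c₃₂ c).comp_eq h2'
  continuous_src := MapArrow.continuous_of_sheet fun r s η =>
    (MapArrow.isOpenEmbedding_src_sheet h1 h1' h2' hX r s η).continuous
  continuous_tgt := MapArrow.continuous_of_sheet fun r s η =>
    (MapArrow.isOpenEmbedding_tgt_sheet h1 h1' h2' hX r s η).continuous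
  continuous_one := continuous_sigma fun r =>
    MapArrow.continuous_mk h1 h1' h2' hX continuous_id fun f => isTransf_rho f
  continuous_inv := MapArrow.continuous_of_sheet fun _ _ η =>
    (MapArrow.isOpenEmbedding_ofSheet η.inv).continuous.comp (Sheet.continuous_inv h2')
  continuousOn_comp := MapArrow.continuousOn_comp h1 h1' h2' hX

theorem isEtale_mapGroupoid (h1 : P.C1) (h1' : P'.C1) (h2' : P'.C2)
    (hX : P.IsParacompactLocallyCompactHausdorff) : (mapGroupoid h1 h1' h2' hX).IsEtale :=
  ⟨MapArrow.isLocalHomeomorph_of_sheet (MapArrow.isOpenEmbedding_src_sheet h1 h1' h2' hX),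
    MapArrow.isLocalHomeomorph_of_sheet (MapArrow.isOpenEmbedding_tgt_sheet h1 h1' h2' hX)⟩

/-- The arrow given by an element of the group of a shape. -/
noncomputable def MapArrow.ofGroup {r : AdmShape P P'} (g : ShapeGroup r) (f : HomSpace r) :
    MapArrow P P' :=
  MapArrow.mk (ShapeGroup.transf g) f (f.smul g) (ShapeGroup.isTransf g f)

theorem MapArrow.ofGroup_mul (h2' : P'.C2) {r : AdmShape P P'} (g h : ShapeGroup r)
    (f : HomSpace r) : MapArrow.ofGroup (g * h) f =
      MapArrow.comp (MapArrow.ofGroup g (f.smul h)) (MapArrow.ofGroup h f) := by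
  have e := HomSpace.mul_smul g h f
  have H : IsTransf (ShapeGroup.transf (g * h)) f ((f.smul h).smul g) :=
    e ▸ ShapeGroup.isTransf (g * h) f
  have := (MapArrow.IsComp.of (ShapeGroup.isTransf h f) (ShapeGroup.isTransf g (f.smul h)) H
    fun a b c x ξ ζ ω => ShapeGroup.compAt_transf_mul g h f).comp_eq h2'
  exact (MapArrow.mk_congr _ rfl rfl e).trans this.symm

theorem MapArrow.ofGroup_one {r : AdmShape P P'} (f : HomSpace r) :
    MapArrow.ofGroup (1 : ShapeGroup r) f = MapArrow.one ⟨r, f⟩ :=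
  MapArrow.mk_congr _ ShapeGroup.transf_one rfl (HomSpace.one_smul f)

theorem MapArrow.continuous_ofGroup (h1 : P.C1) (h1' : P'.C1) (h2' : P'.C2)
    (hX : P.IsParacompactLocallyCompactHausdorff) {r : AdmShape P P'} (g : ShapeGroup r) :
    Continuous fun f : HomSpace r => MapArrow.ofGroup g f :=
  MapArrow.continuous_mk h1 h1' h2' hX continuous_id fun f => ShapeGroup.isTransf g f

/-- Each `g` contributes the sheet of `ShapeGroup.transf g`, which the source parametrizes, and
distinct `g` give distinct sheets; the map is even open. -/
theorem MapArrow.isEmbedding_ofGroup (h1 : P.C1) (h1' : P'.C1) (h2' : P'.C2)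
    (hX : P.IsParacompactLocallyCompactHausdorff) (r : AdmShape P P') :
    letI : TopologicalSpace (ShapeGroup r) := ⊥
    IsEmbedding fun p : ShapeGroup r × HomSpace r => MapArrow.ofGroup p.1 p.2 := by
  let _ : TopologicalSpace (ShapeGroup r) := ⊥
  have : DiscreteTopology (ShapeGroup r) := ⟨rfl⟩
  refine (IsOpenEmbedding.of_continuous_injective_isOpenMap ?_ ?_ ?_).isEmbedding
  · exact continuous_prod_of_discrete_left.2 fun g => continuous_ofGroup h1 h1' h2' hX g
  · rintro ⟨g, f⟩ ⟨g', f'⟩ e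
    obtain rfl : f = f' := sigma_mk_injective (i := r) (congrArg MapArrow.src e)
    have e1 := congrArg Sigma.fst e
    have e2 : ShapeGroup.transf g = ShapeGroup.transf g' :=
      sigma_mk_injective (i := r) (sigma_mk_injective (i := r) e1)
    rw [ShapeGroup.transf_injective h2' f e2]
  · rw [isOpenMap_iff_nhds_le]
    rintro ⟨g, f⟩ W hW
    have hV : {f' | MapArrow.ofGroup g f' ∈ W} ∈ 𝓝 f :=
      (continuous_const.prodMk continuous_id).continuousAt (f := fun f' => (g, f')) hW
    have := (MapArrow.isOpenEmbedding_ofSheet (P := P) (P' := P')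
      (ShapeGroup.transf g)).image_mem_nhds.2
      ((continuous_sheet_fst _).continuousAt (x := ⟨(f, f.smul g), ShapeGroup.isTransf g f⟩) hV)
    refine mem_of_superset this ?_
    rintro _ ⟨⟨⟨f', h'⟩, H'⟩, hf', rfl⟩
    obtain rfl := H'.target_unique h2' (ShapeGroup.isTransf g f')
    exact hf'

theorem MapArrow.range_ofGroup (h2' : P'.C2) (r : AdmShape P P') :
    Set.range (fun p : ShapeGroup r × HomSpace r => MapArrow.ofGroup p.1 p.2) =
      {m | (MapArrow.src m).1 = r ∧ (MapArrow.tgt m).1 = r} := by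
  ext m
  constructor
  · rintro ⟨p, rfl⟩
    exact ⟨rfl, rfl⟩
  · obtain ⟨r₁, r₂, η, f, h, H, rfl⟩ := MapArrow.exists_eq_mk m
    rintro ⟨e₁ : r₁ = r, e₂ : r₂ = r⟩
    subst e₁ e₂
    obtain ⟨g, rfl, rfl⟩ := H.exists_shapeGroup h2'
    exact ⟨(g, f), rfl⟩

theorem isOpen_toOrbMap_image_basic {r : AdmShape P P'}
    {S : ∀ α : r.1.cover, Set (Set α.1.carrier × Set (r.1.target α).carrier)}
    (hS : IsBasicFamily S) :
    IsOpen ((HomSpace.toOrbMap : HomSpace r → OrbMap P P') '' HomSpace.basic S) :=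
  TopologicalSpace.isOpen_generateFrom_of_mem ⟨r, S, hS, rfl⟩

/-- Openness is built in, since the images of basic subsets are open by definition; the content lies
in continuity. -/
theorem isOpenMap_toOrbMap (r : AdmShape P P') :
    IsOpenMap (HomSpace.toOrbMap : HomSpace r → OrbMap P P') := by
  refine (isTopologicalBasis_basic r).isOpenMap_iff.2 ?_
  rintro _ ⟨S, hS, rfl⟩
  exact isOpen_toOrbMap_image_basic hS

/-- The preimage in `𝒪_r` of the image of a basic subset of `𝒪_s` is the union over `η` of the
target projections of the parts of the sheets over that subset, and target projections of sheets are
open maps. -/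
theorem continuous_toOrbMap (h1 : P.C1) (h2 : P.C2) (h1' : P'.C1) (h2' : P'.C2)
    (hX : P.IsParacompactLocallyCompactHausdorff) (r : AdmShape P P') :
    Continuous (HomSpace.toOrbMap : HomSpace r → OrbMap P P') := by
  refine continuous_generateFrom_iff.2 ?_
  rintro _ ⟨s, S, hS, rfl⟩
  have e : HomSpace.toOrbMap ⁻¹' (HomSpace.toOrbMap '' HomSpace.basic (r := s) S) =
      ⋃ η : Transf s r, (fun p : Sheet η => p.1.2) '' ((fun p : Sheet η => p.1.1) ⁻¹'
        HomSpace.basic (r := s) S) := by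
    ext h
    simp only [Set.mem_preimage, Set.mem_iUnion]
    constructor
    · rintro ⟨f, hf, e⟩
      obtain ⟨η, H⟩ := (toOrbMap_eq_iff h1 h2 h1' h2' f h).1 e
      exact ⟨η, ⟨(f, h), H⟩, hf, rfl⟩
    · rintro ⟨η, ⟨⟨f, h'⟩, H⟩, hf, rfl⟩
      exact ⟨f, hf, (toOrbMap_eq_iff h1 h2 h1' h2' f h').2 ⟨η, H⟩⟩
  rw [e]
  exact isOpen_iUnion fun η => (isOpenEmbedding_sheet_snd h1 h1' h2' hX η).isOpenMap _
    ((isOpen_basic hS).preimage (continuous_sheet_fst η))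

/-- The orbispace structure on the space of maps of orbispaces. -/
noncomputable def mapOrbispace (h1 : P.C1) (h2 : P.C2) (h1' : P'.C1) (h2' : P'.C2)
    (hX : P.IsParacompactLocallyCompactHausdorff) :
    OrbispaceStr (OrbMap P P') (fun r : AdmShape P P' => HomSpace r)
      (fun r : AdmShape P P' => ShapeGroup r) (MapArrow P P') where
  toTopGroupoid := mapGroupoid h1 h1' h2' hX
  isEtale := isEtale_mapGroupoid h1 h1' h2' hX
  act r :=
    { smul := HomSpace.smul
      one_smul := HomSpace.one_smul
      mul_smul := HomSpace.mul_smul }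
  -- On the sheet of `ShapeGroup.transf g` the action is the second projection after the inverse of
  -- the first.
  continuous_act r g :=
    continuous_iff_continuousAt.2 fun f => by
      refine tendsto_def.2 fun V hV => ?_
      have := (isOpenEmbedding_sheet_fst h1 h1' h2' hX (ShapeGroup.transf g)).image_mem_nhds.2
        ((isOpenEmbedding_sheet_snd h1 h1' h2' hX (ShapeGroup.transf g)).continuous.continuousAt
          (x := ⟨(f, f.smul g), ShapeGroup.isTransf g f⟩) hV)
      refine mem_of_superset this ?_
      rintro _ ⟨⟨⟨f', h'⟩, H'⟩, hf', rfl⟩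
      obtain rfl := H'.target_unique h2' (ShapeGroup.isTransf g f')
      exact hf'
  prod r := MapArrow.ofGroup
  src_prod _ _ _ := rfl
  tgt_prod _ _ _ := rfl
  prod_one _ := MapArrow.ofGroup_one
  prod_mul _ := MapArrow.ofGroup_mul h2'
  isEmbedding_prod := MapArrow.isEmbedding_ofGroup h1 h1' h2' hX
  range_prod := MapArrow.range_ofGroup h2'
  proj u := u.2.toOrbMap
  isQuotientMap_proj := by
    refine IsOpenMap.isQuotientMap ?_ ?_ ?_
    · exact isOpenMap_sigma.2 isOpenMap_toOrbMap
    · exact continuous_sigma fun r => continuous_toOrbMap h1 h2 h1' h2' hX r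
    · intro Φ
      obtain ⟨r, f, e⟩ := exists_homSpace_toOrbMap_eq h1 h2 h1' h2' hX Φ
      exact ⟨⟨r, f⟩, e⟩
  proj_eq_iff := by
    rintro ⟨r, f⟩ ⟨s, h⟩
    refine (toOrbMap_eq_iff h1 h2 h1' h2' f h).trans ⟨?_, ?_⟩
    · rintro ⟨η, H⟩
      exact ⟨MapArrow.mk η f h H, rfl, rfl⟩
    · rintro ⟨m, e₁, e₂⟩
      obtain ⟨r', s', η, f', h', H, rfl⟩ := MapArrow.exists_eq_mk m
      cases e₁
      cases e₂
      exact ⟨η, H⟩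
  isOpen_range r := (isOpenMap_toOrbMap r).isOpen_range
  isQuotientMap_chart r := by
    refine IsOpenMap.isQuotientMap ?_ ?_ Set.rangeFactorization_surjective
    · exact (isOpenMap_toOrbMap r).subtype_mk _
    · exact (continuous_toOrbMap h1 h2 h1' h2' hX r).subtype_mk _
  proj_chart_eq_iff r f h := by
    refine (toOrbMap_eq_iff h1 h2 h1' h2' f h).trans ⟨?_, ?_⟩
    · rintro ⟨η, H⟩
      obtain ⟨g, -, rfl⟩ := H.exists_shapeGroup h2'
      exact ⟨g, rfl⟩
    · rintro ⟨g, rfl⟩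
      exact ⟨_, ShapeGroup.isTransf g f⟩

end MappingGroupoid

end OrbispaceStr

/-! ### The theorem. -/

open OrbispaceStr in
theorem theorem1p3 {X : Type*} [TopologicalSpace X] {ι : Type*} {E : ι → Type*}
    [∀ i, TopologicalSpace (E i)] {G : ι → Type*} [∀ i, Group (G i)]
    {A : Type*} [TopologicalSpace A]
    {X' : Type*} [TopologicalSpace X'] {ι' : Type*} {E' : ι' → Type*}
    [∀ i, TopologicalSpace (E' i)] {G' : ι' → Type*} [∀ i, Group (G' i)]
    {A' : Type*} [TopologicalSpace A']
    (P : OrbispaceStr X E G A) (P' : OrbispaceStr X' E' G' A')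
    (hC1 : P.C1) (hC2 : P.C2) (hC1' : P'.C1) (hC2' : P'.C2)
    (hX : P.IsParacompactLocallyCompactHausdorff) :
    -- equivalence of homomorphisms is an equivalence relation
    Equivalence (HomEquiv P P') ∧
    -- every map of orbispaces is represented by an admissible homomorphism
    (∀ Φ : OrbMap P P', ∃ (r : AdmShape P P') (f : HomSpace r), f.toOrbMap = Φ) ∧
    -- every sheet is the graph of a homeomorphism between open subsets
    (∀ (r s : AdmShape P P') (η : Transf r s),
      IsOpenEmbedding (fun p : Sheet η => p.1.1) ∧ IsOpenEmbedding (fun p : Sheet η => p.1.2)) ∧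
    -- if `τ` is induced by `σ`, then the isomorphisms from `τ` to `σ` are those given by the
    -- data via which `τ` is induced by `σ`
    (∀ (r s : AdmShape P P') (τ : HomSpace r) (σ : HomSpace s) (θ : r.1.cover → s.1.cover)
      (ξ : ∀ a, T a.1 (θ a).1), (∀ a x, ∃ y, (ξ a).Maps x y) →
      (∀ η : Transf r s, IsTransf η τ σ →
        IsInducedVia s.1 r.1 σ.1 τ.1 θ ξ (fun a => η a (θ a) (ξ a))) ∧
      ∀ ξ', IsInducedVia s.1 r.1 σ.1 τ.1 θ ξ ξ' →
        ∃! η : Transf r s, IsTransf η τ σ ∧ ∀ a, η a (θ a) (ξ a) = ξ' a) ∧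
    -- `[X; X']` is an orbispace, with charts `𝒪_ρ`, groups `G_ρ`, and arrows `⋃ Γ_{στ}`
    ∃ S : OrbispaceStr (OrbMap P P') (fun r : AdmShape P P' => HomSpace r)
        (fun r : AdmShape P P' => ShapeGroup r) (MapArrow P P'),
      (∀ (r : AdmShape P P') (f : HomSpace r), S.proj ⟨r, f⟩ = f.toOrbMap) ∧
      (∀ (r s : AdmShape P P') (η : Transf r s) (f : HomSpace r) (h : HomSpace s)
        (hη : IsTransf η f h),
        S.src (MapArrow.mk η f h hη) = ⟨r, f⟩ ∧ S.tgt (MapArrow.mk η f h hη) = ⟨s, h⟩) ∧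
      -- composition
      (∀ (r s t : AdmShape P P') (η₁ : Transf r s) (η₂ : Transf s t) (f : HomSpace r)
        (g : HomSpace s) (h : HomSpace t) (h₁ : IsTransf η₁ f g) (h₂ : IsTransf η₂ g h),
        ∃ (η : Transf r t) (hη : IsTransf η f h),
          S.comp (MapArrow.mk η₂ g h h₂) (MapArrow.mk η₁ f g h₁) = MapArrow.mk η f h hη ∧
          ∀ (a : r.1.cover) (b : s.1.cover) (c : t.1.cover) (x : a.1.carrier) (ξ : T a.1 b.1)
            (ζ : T b.1 c.1) (ω : T a.1 c.1), T.CompAt x ξ ζ ω →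
            T.CompAt (f.1 a x) (η₁ a b ξ) (η₂ b c ζ) (η a c ω)) ∧
      -- the action of `G_ρ` on `𝒪_ρ` is `{g_α} · {f_α} = {g_α ∘ f_α}`
      (∀ (r : AdmShape P P') (g : ShapeGroup r) (f : HomSpace r) (α : r.1.cover)
        (x : α.1.carrier),
        ((S.act r).smul g f).1 α x = (r.1.target α).smul (g.1 α) (f.1 α x)) ∧
      -- the pair `(g, f)` corresponds to the isomorphism `ξ ↦ g_β ∘ ρ_{βα}(ξ)` from `f` to `g · f`
      (∀ (r : AdmShape P P') (g : ShapeGroup r) (f : HomSpace r),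
        ∃ (η : Transf r r) (hη : IsTransf η f ((S.act r).smul g f)),
          S.prod r g f = MapArrow.mk η f ((S.act r).smul g f) hη ∧
          ∀ (α β : r.1.cover) (ξ : T α.1 β.1) (x y), (r.1.rho α β ξ).Maps x y →
            T.CompAt x (r.1.rho α β ξ) ((r.1.target β).ofGroup (g.1 β)) (η α β ξ)) := by
  refine ⟨equivalence_homEquiv hC1 hC2 hC1' hC2',
    exists_homSpace_toOrbMap_eq hC1 hC2 hC1' hC2' hX,
    fun r s η => ⟨isOpenEmbedding_sheet_fst hC1 hC1' hC2' hX η,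
      isOpenEmbedding_sheet_snd hC1 hC1' hC2' hX η⟩, ?_,
    mapOrbispace hC1 hC2 hC1' hC2' hX, fun _ _ => rfl, fun _ _ _ _ _ _ => ⟨rfl, rfl⟩, ?_,
    fun _ _ _ _ _ => rfl, ?_⟩
  · intro r s τ σ θ ξ hξ
    refine ⟨fun η H => H.isNat.isInducedVia θ ξ hξ, fun ξ' H => ?_⟩
    obtain ⟨η, ⟨hη, hηξ⟩, hu⟩ := H.existsUnique_isNat hC1 hC2 hC1' hC2' τ.2.1 σ.2.1
    exact ⟨η, ⟨⟨hη.maps, hη.comp_left, hη.comp_right⟩, hηξ⟩, fun η' h => hu η' ⟨h.1.isNat, h.2⟩⟩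
  · intro r s t η₁ η₂ f g h h₁ h₂
    obtain ⟨η, H, hc⟩ := CompLaw.exists hC1 hC1' hC2' h₁ h₂
    exact ⟨η, H, (MapArrow.IsComp.of h₁ h₂ H hc).comp_eq hC2', hc⟩
  · intro r g f
    exact ⟨ShapeGroup.transf g, ShapeGroup.isTransf g f, rfl,
      fun α β ξ x y h => h.compAt_ofGroup (g.1 β)⟩
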